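/- **Setting.** Let $K$ be a field, $\Lambda$ a $K$-algebra and $n\ge 1$. Modules are left modules; right modules are modules over $\Lambda^{\mathrm{op}}$. We are in one of two cases. * *Ungraded case:* $\Lambda$ is semiperfect and two-sided Noetherian, and all simple $\Lambda$-modules are finite dimensional over $K$. "Module" means $\Lambda$-module and $D=\operatorname{Hom}_K(-,K)$. * *Graded case:* $\Lambda=\bigoplus_{i\ge 0}\Lambda_i$ is positively graded with $\Lambda_0\cong K^t$ as $K$-algebras for some $t$, $\dim_K\Lambda_i<\infty$ for all $i$, and $\Lambda_{\ge 1}$ is finitely generated as a left and as a right $\Lambda$-module. "Module" means $\mathbb Z$-graded $\Lambda$-module, morphisms have degree $0$, $D$ is the graded dual $(DM)_j=\operatorname{Hom}_K(M_{-j},K)$, and $\operatorname{Ext}^i(M,\Lambda)$ stands for $\bigoplus_j\operatorname{Ext}^i(M,\Lambda(j))$. Let $\mathcal H^n_\Lambda$ be the full subcategory of the modules $M$ with $\operatorname{pd}M=n$ and $\operatorname{Ext}^i(M,\Lambda)=0$ for all $i\ne n$ which have a projective resolution by finitely generated modules, and put $\operatorname{tr}^n=\operatorname{Ext}^n(-,\Lambda)$,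 which takes left modules to right modules and right modules to left modules. Assume that $\Lambda$ is *generalized Artin–Schelter regular of dimension $n$*: the (graded) global dimension of $\Lambda$ is $n$; every simple module of projective dimension $n$ over $\Lambda$ (respectively $\Lambda^{\mathrm{op}}$) lies in $\mathcal H^n_\Lambda$ (respectively $\mathcal H^n_{\Lambda^{\mathrm{op}}}$); and for every simple $\Lambda^{\mathrm{op}}$-module $S$ of projective dimension $n$ the module $\operatorname{tr}^n_{\Lambda^{\mathrm{op}}}(S)$ has a simple submodule which lies in $\mathcal H^n_\Lambda$. Assume also that $\mathcal H^n_\Lambda$ is a Krull–Schmidt category, i.e. each of its objects is a finite direct sum of objects of $\mathcal H^n_\Lambda$ with local endomorphism rings. A nonzero $\eta\in\operatorname{Ext}^n_\Lambda(C,A)$ is an *$n$-fold almost split extension* if for all modules $X,Y$, every nonsplit epimorphism $f\colon X\to C$ and every nonsplit monomorphism $g\colon A\to Y$, the pullback $\eta\cdot f\in\operatorname{Ext}^n(X,A)$ and the pushout $g\cdot\eta\in\operatorname{Ext}^n(C,Y)$ are zero. **Proposition.** (a) If $n=1$, then $\mathcal H^1_\Lambda$ has almost split sequences: for every indecomposable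 $C\in\mathcal H^1_\Lambda$ with $\operatorname{Ext}^1_\Lambda(C,L)\neq0$ for some $L\in\mathcal H^1_\Lambda$ there is an almost split sequence $0\to A\to B\to C\to0$ in $\mathcal H^1_\Lambda$, and for every indecomposable $A\in\mathcal H^1_\Lambda$ with $\operatorname{Ext}^1_\Lambda(L,A)\ne0$ for some $L\in\mathcal H^1_\Lambda$ there is an almost split sequence $0\to A\to B\to C\to 0$ in $\mathcal H^1_\Lambda$. Here a sequence in $\mathcal H^1_\Lambda$ is almost split if it is exact and nonsplit, $A$ and $C$ are indecomposable, every morphism $X\to C$ with $X\in\mathcal H^1_\Lambda$ that is not a split epimorphism factors through $B\to C$, and every morphism $A\to Y$ with $Y\in\mathcal H^1_\Lambda$ that is not a split monomorphism factors through $A\to B$. (b) If $n>1$, then $\mathcal H^n_\Lambda$ has $n$-fold almost split extensions: for every indecomposable $C\in\mathcal H^n_\Lambda$ there is an $n$-fold almost split extension in $\operatorname{Ext}^n_\Lambda(C,D\operatorname{tr}^n_\Lambda C)$; and for every indecomposable $A\in\mathcal H^n_\Lambda$ with $DA\in\mathcal H^n_{\Lambda^{\mathrm{op}}}$ there are an indecomposable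 $C\in\mathcal H^n_\Lambda$ and an $n$-fold almost split extension in $\operatorname{Ext}^n_\Lambda(C,A)$. For $n=1$ these two assertions hold as well. -/

import Mathlib

open CategoryTheory Limits

universe u v

/-! ### Graded modules

`Λ` is a `K`-algebra with a grading `𝒜 : ℤ → Submodule K Λ`. A graded left module is a family of
`K`-spaces `M_j` with multiplication maps `Λ_i × M_j → M_{i+j}`; morphisms have degree zero.
The index `k` of the target comes with an equation `i + j = k`, which avoids casts. -/

section GradedModules

variable {K Λ : Type u} [Field K] [Ring Λ] [Algebra K Λ]

/-- A `ℤ`-graded left module over the graded algebra `Λ = ⨁ i, 𝒜 i`. -/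
structure GrMod (𝒜 : ℤ → Submodule K Λ) [SetLike.GradedMonoid 𝒜] where
  obj : ℤ → Type u
  [grp : ∀ j, AddCommGroup (obj j)]
  [mod : ∀ j, Module K (obj j)]
  act : ∀ {i j k : ℤ}, i + j = k → (𝒜 i →ₗ[K] obj j →ₗ[K] obj k)
  one_act : ∀ {j : ℤ} (h : 0 + j = j) (e : 𝒜 0) (_ : (e : Λ) = 1) (x : obj j), act h e x = x
  mul_act : ∀ {i i' s j k l : ℤ} (h : i' + j = k) (h' : i + k = l) (h'' : s + j = l)
    (a : 𝒜 i) (b : 𝒜 i') (c : 𝒜 s) (_ : (c : Λ) = a * b) (x : obj j),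
    act h'' c x = act h' a (act h b x)

attribute [instance] GrMod.grp GrMod.mod

namespace GrMod

variable {𝒜 : ℤ → Submodule K Λ} [SetLike.GradedMonoid 𝒜]

/-- A homomorphism of graded modules (of degree zero). -/
@[ext]
structure Hom (M N : GrMod 𝒜) where
  app : ∀ j, M.obj j →ₗ[K] N.obj j
  comm : ∀ {i j k : ℤ} (h : i + j = k) (a : 𝒜 i) (x : M.obj j),
    app k (M.act h a x) = N.act h a (app j x)

instance : Category (GrMod 𝒜) where
  Hom := Hom
  id M := ⟨fun _ => LinearMap.id, fun _ _ _ => rfl⟩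
  comp f g := ⟨fun j => g.app j ∘ₗ f.app j, fun h a x => by simp [f.comm, g.comm]⟩

@[ext]
theorem hom_ext {M N : GrMod 𝒜} {f g : M ⟶ N} (h : ∀ j x, f.app j x = g.app j x) : f = g :=
  Hom.ext (funext fun j => LinearMap.ext (h j))

@[simp] theorem id_app (M : GrMod 𝒜) (j : ℤ) (x : M.obj j) : Hom.app (𝟙 M) j x = x := rfl

@[simp] theorem comp_app {M N P : GrMod 𝒜} (f : M ⟶ N) (g : N ⟶ P) (j : ℤ) (x : M.obj j) :
    (f ≫ g).app j x = g.app j (f.app j x) := rfl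

section Additive

variable {M N : GrMod 𝒜}

instance : Zero (M ⟶ N) := ⟨⟨fun _ => 0, by simp⟩⟩
instance : Add (M ⟶ N) := ⟨fun f g => ⟨fun j => f.app j + g.app j, by simp [f.comm, g.comm]⟩⟩
instance : Neg (M ⟶ N) := ⟨fun f => ⟨fun j => -f.app j, by simp [f.comm]⟩⟩
instance : Sub (M ⟶ N) := ⟨fun f g => ⟨fun j => f.app j - g.app j, by simp [f.comm, g.comm]⟩⟩
instance : SMul ℕ (M ⟶ N) := ⟨fun n f => ⟨fun j => n • f.app j, by simp [f.comm]⟩⟩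
instance : SMul ℤ (M ⟶ N) := ⟨fun n f => ⟨fun j => n • f.app j, by simp [f.comm]⟩⟩
instance : SMul K (M ⟶ N) := ⟨fun r f => ⟨fun j => r • f.app j, by simp [f.comm]⟩⟩

@[simp] theorem zero_app (j : ℤ) : Hom.app (0 : M ⟶ N) j = 0 := rfl
@[simp] theorem add_app (f g : M ⟶ N) (j : ℤ) : (f + g).app j = f.app j + g.app j := rfl
@[simp] theorem smul_app (r : K) (f : M ⟶ N) (j : ℤ) : (r • f).app j = r • f.app j := rfl

theorem app_injective : Function.Injective (fun f : M ⟶ N => f.app) := fun _ _ h => Hom.ext h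

instance : AddCommGroup (M ⟶ N) :=
  app_injective.addCommGroup _ rfl (fun _ _ => rfl) (fun _ => rfl) (fun _ _ => rfl)
    (fun _ _ => rfl) (fun _ _ => rfl)

instance : Module K (M ⟶ N) :=
  app_injective.module K ⟨⟨fun f : M ⟶ N => f.app, rfl⟩, fun _ _ => rfl⟩ (fun _ _ => rfl)

end Additive

instance : Preadditive (GrMod 𝒜) where
  add_comp _ _ _ _ _ _ := by ext; simp
  comp_add _ _ _ _ _ _ := by ext; simp

instance : Linear K (GrMod 𝒜) where
  smul_comp _ _ _ _ _ _ := by ext; simp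
  comp_smul _ _ _ _ _ _ := by ext; simp

/-! #### The category of graded modules is abelian -/

/-- The product of a family of graded modules. -/
def pi {J : Type} (M : J → GrMod 𝒜) : GrMod 𝒜 where
  obj j := ∀ t, (M t).obj j
  act h := LinearMap.mk₂ K (fun a x t => (M t).act h a (x t))
    (by intros; funext; simp) (by intros; funext; simp) (by intros; funext; simp)
    (by intros; funext; simp)
  one_act h e he x := by funext t; exact (M t).one_act h e he (x t)
  mul_act h h' h'' a b c hc x := by funext t; exact (M t).mul_act h h' h'' a b c hc (x t)

instance : HasFiniteProducts (GrMod 𝒜) :=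
  have : HasProducts.{0} (GrMod 𝒜) := hasProducts_of_limit_fans
    (fun {_} M => Fan.mk (pi M) fun t =>
      (⟨fun _ => LinearMap.proj t, fun _ _ _ => rfl⟩ : Hom (pi M) (M t)))
    (fun {J} M => Fan.IsLimit.mk _
      (fun s => (⟨fun j => LinearMap.pi fun t => (s.proj t).app j, fun h a x => by
        funext t; exact (s.proj t).comm h a x⟩ : Hom s.pt (pi M)))
      (fun _ _ => rfl)
      (fun s m h => by
        ext j x
        funext t
        exact congrArg (fun q : s.pt ⟶ M t => q.app j x) (h t)))
  hasFiniteProducts_of_hasProducts _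

variable {M N : GrMod 𝒜} (f : M ⟶ N)

/-- The kernel of a morphism of graded modules. -/
def ker : GrMod 𝒜 where
  obj j := LinearMap.ker (f.app j)
  act {i j k} h := LinearMap.mk₂ K
    (fun a x => ⟨M.act h a x, by
      have := x.2
      rw [LinearMap.mem_ker] at this ⊢
      rw [f.comm, this, map_zero]⟩)
    (by intros; ext; simp) (by intros; ext; simp) (by intros; ext; simp) (by intros; ext; simp)
  one_act h e he x := Subtype.ext (M.one_act h e he x)
  mul_act h h' h'' a b c hc x := Subtype.ext (M.mul_act h h' h'' a b c hc x)

/-- The inclusion of the kernel. -/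
def kerι : ker f ⟶ M := (⟨fun j => (LinearMap.ker (f.app j)).subtype, fun _ _ _ => rfl⟩ : Hom _ _)

theorem kerι_comp : kerι f ≫ f = 0 := by
  ext j x; exact x.2

/-- The universal property of the kernel. -/
def kerIsLimit : IsLimit (KernelFork.ofι (kerι f) (kerι_comp f)) :=
  KernelFork.IsLimit.ofι _ _
    (fun {W} g hg => (⟨fun j => (g.app j).codRestrict _ (fun x => by
        rw [LinearMap.mem_ker, ← comp_app, hg]; rfl),
      fun h a x => Subtype.ext (g.comm h a x)⟩ : Hom W (ker f)))
    (fun _ _ => rfl)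
    (fun g hg m hm => by
      ext j x
      apply Subtype.ext
      subst hm
      rfl)

/-- The cokernel of a morphism of graded modules. -/
def coker : GrMod 𝒜 where
  obj j := N.obj j ⧸ LinearMap.range (f.app j)
  act {i j k} h := LinearMap.mk₂ K
    (fun a => Submodule.mapQ (LinearMap.range (f.app j)) (LinearMap.range (f.app k)) (N.act h a)
      (by rintro _ ⟨x, rfl⟩; exact ⟨M.act h a x, f.comm h a x⟩))
    (by intro a b x; induction x using Submodule.Quotient.induction_on; simp)
    (by intro a b x; induction x using Submodule.Quotient.induction_on; simp)
    (by intros; simp) (by intros; simp)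
  one_act h e he x := by
    induction x using Submodule.Quotient.induction_on with
    | H x => exact congrArg _ (N.one_act h e he x)
  mul_act h h' h'' a b c hc x := by
    induction x using Submodule.Quotient.induction_on with
    | H x => exact congrArg _ (N.mul_act h h' h'' a b c hc x)

/-- The projection onto the cokernel. -/
def cokerπ : N ⟶ coker f := (⟨fun j => (LinearMap.range (f.app j)).mkQ, fun _ _ _ => rfl⟩ : Hom _ _)

theorem comp_cokerπ : f ≫ cokerπ f = 0 := by
  ext j x
  exact (Submodule.Quotient.mk_eq_zero _).2 ⟨x, rfl⟩

/-- The universal property of the cokernel. -/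
def cokerIsColimit : IsColimit (CokernelCofork.ofπ (cokerπ f) (comp_cokerπ f)) :=
  CokernelCofork.IsColimit.ofπ _ _
    (fun {W} g hg => (⟨fun j => (LinearMap.range (f.app j)).liftQ (g.app j) (by
        rintro _ ⟨x, rfl⟩
        rw [LinearMap.mem_ker, ← comp_app, hg]; rfl),
      fun h a x => by
        induction x using Submodule.Quotient.induction_on with
        | H x => exact g.comm h a x⟩ : Hom (coker f) W))
    (fun _ _ => rfl)
    (fun g hg m hm => by
      ext j x
      induction x using Submodule.Quotient.induction_on with
      | H x => subst hm; rfl)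

theorem app_injective_of_mono [Mono f] (j : ℤ) : Function.Injective (f.app j) := by
  rw [← LinearMap.ker_eq_bot, LinearMap.ker_eq_bot']
  intro x hx
  have h : kerι f = 0 := by rw [← cancel_mono f, kerι_comp, zero_comp]
  exact congrArg (fun g : ker f ⟶ M => g.app j ⟨x, hx⟩) h

theorem app_surjective_of_epi [Epi f] (j : ℤ) : Function.Surjective (f.app j) := by
  rw [← LinearMap.range_eq_top, Submodule.eq_top_iff']
  intro x
  have h : cokerπ f = 0 := by rw [← cancel_epi f, comp_cokerπ, comp_zero]
  exact (Submodule.Quotient.mk_eq_zero _).1 (congrArg (fun g : N ⟶ coker f => g.app j x) h)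

theorem epi_of_surjective (h : ∀ j, Function.Surjective (f.app j)) : Epi f := by
  refine ⟨fun g g' hg => ?_⟩
  ext j y
  obtain ⟨x, rfl⟩ := h j y
  rw [← comp_app, hg, comp_app]

/-- Every monomorphism is the kernel of its cokernel. -/
@[reducible]
noncomputable def normalMono [Mono f] : NormalMono f where
  Z := coker f
  g := cokerπ f
  w := comp_cokerπ f
  isLimit := KernelFork.IsLimit.ofι _ _
    (fun {W} g hg => (⟨fun j =>
        (LinearEquiv.ofInjective (f.app j) (app_injective_of_mono f j)).symm.toLinearMap ∘ₗ
          (g.app j).codRestrict (LinearMap.range (f.app j)) (fun x =>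
            (Submodule.Quotient.mk_eq_zero _).1
              (congrArg (fun q : W ⟶ coker f => q.app j x) hg)),
      fun {i j k} h a x => by
        apply app_injective_of_mono f
        rw [f.comm]
        have key : ∀ (j : ℤ) (y : LinearMap.range (f.app j)), f.app j
            ((LinearEquiv.ofInjective (f.app j) (app_injective_of_mono f j)).symm y) = y :=
          fun j y => congrArg Subtype.val
            ((LinearEquiv.ofInjective (f.app j) (app_injective_of_mono f j)).apply_symm_apply y)
        simp only [LinearMap.comp_apply, LinearEquiv.coe_coe]
        rw [key, key]
        exact g.comm h a x⟩ : Hom W M))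
    (fun {W} g hg => by
      ext j x
      exact congrArg Subtype.val
        ((LinearEquiv.ofInjective (f.app j) (app_injective_of_mono f j)).apply_symm_apply _))
    (fun {W} g hg m hm => by
      rw [← cancel_mono f, hm]
      ext j x
      symm
      exact congrArg Subtype.val
        ((LinearEquiv.ofInjective (f.app j) (app_injective_of_mono f j)).apply_symm_apply _))

/-- Every epimorphism is the cokernel of its kernel. -/
@[reducible]
noncomputable def normalEpi [Epi f] : NormalEpi f where
  W := ker f
  g := kerι f
  w := kerι_comp f
  isColimit :=
    have key {W : GrMod 𝒜} (g : M ⟶ W) (hg : kerι f ≫ g = 0) (j : ℤ) (x y : M.obj j)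
        (h : f.app j x = f.app j y) : g.app j x = g.app j y := by
      rw [← sub_eq_zero, ← map_sub] at h ⊢
      exact congrArg (fun q : ker f ⟶ W => q.app j ⟨x - y, h⟩) hg
    have hs (j : ℤ) (y : N.obj j) :
        f.app j (Function.surjInv (app_surjective_of_epi f j) y) = y :=
      Function.surjInv_eq (app_surjective_of_epi f j) y
    CokernelCofork.IsColimit.ofπ _ _
      (fun {W} g hg => (⟨fun j =>
        { toFun := fun y => g.app j (Function.surjInv (app_surjective_of_epi f j) y)
          map_add' := fun y z => by
            rw [← map_add]; apply key g hg; rw [map_add, hs, hs, hs]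
          map_smul' := fun r y => by
            rw [RingHom.id_apply, ← map_smul]; apply key g hg; rw [map_smul, hs, hs] },
        fun h a y => by
          change g.app _ _ = W.act h a (g.app _ _)
          rw [← g.comm]; apply key g hg; rw [f.comm, hs, hs]⟩ : Hom N W))
      (fun g hg => by
        ext j x
        exact key g hg j _ _ (hs j _))
      (fun {W} g hg m hm => by
        ext j y
        subst hm
        exact congrArg (m.app j) (hs j y).symm)

noncomputable instance : Abelian (GrMod 𝒜) where
  has_kernels := ⟨fun f => ⟨⟨⟨_, kerIsLimit f⟩⟩⟩⟩
  has_cokernels := ⟨fun f => ⟨⟨⟨_, cokerIsColimit f⟩⟩⟩⟩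
  normalMonoOfMono f _ := ⟨normalMono f⟩
  normalEpiOfEpi f _ := ⟨normalEpi f⟩

/-! #### Enough projectives, so that the groups `Ext` are small -/

/-- The multiplication `Λ_i × Λ_j → Λ_k`, where `i + j = k`. -/
def mulₗ (𝒜 : ℤ → Submodule K Λ) [SetLike.GradedMonoid 𝒜] {i j k : ℤ} (h : i + j = k) :
    𝒜 i →ₗ[K] 𝒜 j →ₗ[K] 𝒜 k :=
  LinearMap.mk₂ K (fun a b => ⟨a * b, h ▸ SetLike.GradedMul.mul_mem a.2 b.2⟩)
    (by intros; ext; simp [add_mul]) (by intros; ext; simp)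
    (by intros; ext; simp [mul_add]) (by intros; ext; simp)

@[simp] theorem coe_mulₗ {i j k : ℤ} (h : i + j = k) (a : 𝒜 i) (b : 𝒜 j) :
    (mulₗ 𝒜 h a b : Λ) = a * b := rfl

/-- The graded free module on a family of homogeneous generators, `t` having degree `d t`. -/
noncomputable def free (𝒜 : ℤ → Submodule K Λ) [SetLike.GradedMonoid 𝒜] {T : Type u} (d : T → ℤ) :
    GrMod 𝒜 where
  obj j := Π₀ t, 𝒜 (j - d t)
  act {i j k} h := LinearMap.mk₂ K
    (fun a x => DFinsupp.mapRange.linearMap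
      (fun t => mulₗ 𝒜 (show i + (j - d t) = k - d t by omega) a) x)
    (by intros; ext; simp) (by intros; ext; simp) (by intros; ext; simp) (by intros; ext; simp)
  one_act h e he x := by ext; simp [he]
  mul_act h h' h'' a b c hc x := by ext; simp [hc, mul_assoc]

/-- A morphism out of a graded free module is given by the images of the generators. -/
noncomputable def freeLift {T : Type u} (d : T → ℤ) (m : ∀ t, M.obj (d t)) : free 𝒜 d ⟶ M := by
  classical
  exact (⟨fun j => DFinsupp.lsum K fun t =>
      (M.act (show j - d t + d t = j by omega)).flip (m t),
    fun {i j k} h a x => by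
      have key : (DFinsupp.lsum K fun t =>
            (M.act (show k - d t + d t = k by omega)).flip (m t)) ∘ₗ
          DFinsupp.mapRange.linearMap
            (fun t => mulₗ 𝒜 (show i + (j - d t) = k - d t by omega) a) =
          M.act h a ∘ₗ DFinsupp.lsum K fun t =>
            (M.act (show j - d t + d t = j by omega)).flip (m t) := by
        refine DFinsupp.lhom_ext fun t b => ?_
        simp only [LinearMap.comp_apply, DFinsupp.mapRange.linearMap_apply,
          DFinsupp.mapRange_single, DFinsupp.lsum_single, LinearMap.flip_apply]
        exact M.mul_act _ _ _ a b _ rfl (m t)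
      exact LinearMap.congr_fun key x⟩ : Hom (free 𝒜 d) M)

/-- The homogeneous generator of degree `d t` of a graded free module. -/
noncomputable def freeGen {T : Type u} (d : T → ℤ) (t : T) : (free 𝒜 d).obj (d t) := by
  classical
  exact (DFinsupp.single t ⟨1, by rw [sub_self]; exact SetLike.GradedOne.one_mem⟩ :
    Π₀ s, 𝒜 (d t - d s))

theorem freeLift_gen {T : Type u} (d : T → ℤ) (m : ∀ t, M.obj (d t)) (t : T) :
    (freeLift d m).app (d t) (freeGen d t) = m t := by
  classical
  have key := DFinsupp.lsum_single K (fun s =>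
    (M.act (show d t - d s + d s = d t by omega)).flip (m s)) t
      ⟨1, by rw [sub_self]; exact SetLike.GradedOne.one_mem⟩
  refine (key : _ = _).trans ?_
  rw [LinearMap.flip_apply]
  have aux : ∀ (i : ℤ) (h : i + d t = d t) (e : 𝒜 i), (e : Λ) = 1 → M.act h e (m t) = m t := by
    intro i h e he
    obtain rfl : i = 0 := by omega
    exact M.one_act h e he _
  exact aux _ _ _ rfl

theorem free_hom_ext {T : Type u} (d : T → ℤ) {f g : free 𝒜 d ⟶ M}
    (h : ∀ t, f.app (d t) (freeGen d t) = g.app (d t) (freeGen d t)) : f = g := by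
  classical
  refine Hom.ext (funext fun j => ?_)
  refine DFinsupp.lhom_ext fun t b => ?_
  have e : (DFinsupp.single t b : Π₀ s, 𝒜 (j - d s)) =
      (free 𝒜 d).act (show j - d t + d t = j by omega) b (freeGen d t) := by
    refine Eq.trans ?_ (DFinsupp.mapRange_single (hf := by intro; simp)).symm
    congr 1
    ext
    simp
  rw [e]
  exact (f.comm _ b _).trans ((congrArg _ (h t)).trans (g.comm _ b _).symm)

instance {T : Type u} (d : T → ℤ) : Projective (free 𝒜 d) where
  factors {P N} f e _ := by
    choose m hm using fun t => app_surjective_of_epi e (d t) (f.app (d t) (freeGen d t))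
    refine ⟨freeLift d m, free_hom_ext d fun t => ?_⟩
    rw [comp_app, freeLift_gen, hm]

theorem freeLift_epi (M : GrMod 𝒜) :
    Epi (freeLift (fun t : Σ j, M.obj j => t.1) (fun t => t.2)) := by
  apply epi_of_surjective
  intro j x
  exact ⟨freeGen (fun t : Σ j, M.obj j => t.1) ⟨j, x⟩,
    freeLift_gen (fun t : Σ j, M.obj j => t.1) (fun t => t.2) ⟨j, x⟩⟩

instance : EnoughProjectives (GrMod 𝒜) where
  presentation M := ⟨{ p := _, f := _, epi := freeLift_epi M }⟩

instance : HasExt.{u} (GrMod 𝒜) := hasExt_of_enoughProjectives _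

end GrMod

/-! #### Right modules, the functors `tr` and `D` for graded modules -/

/-- The opposite grading on `Λᵐᵒᵖ`; graded right `Λ`-modules are graded left modules over it. -/
def opGrading (𝒜 : ℤ → Submodule K Λ) (i : ℤ) : Submodule K Λᵐᵒᵖ :=
  (𝒜 i).comap (MulOpposite.opLinearEquiv K).symm.toLinearMap

instance (𝒜 : ℤ → Submodule K Λ) [SetLike.GradedMonoid 𝒜] :
    SetLike.GradedMonoid (opGrading 𝒜) where
  one_mem := (SetLike.GradedOne.one_mem : (1 : Λ) ∈ 𝒜 0)
  mul_mem i j a b ha hb := by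
    change b.unop * a.unop ∈ 𝒜 (i + j)
    rw [add_comm]
    exact SetLike.GradedMul.mul_mem hb ha

namespace GrMod

variable {𝒜 : ℤ → Submodule K Λ} [SetLike.GradedMonoid 𝒜]

/-- An element of the opposite algebra, viewed in the algebra. -/
def unopₗ (𝒜 : ℤ → Submodule K Λ) (i : ℤ) : opGrading 𝒜 i →ₗ[K] 𝒜 i where
  toFun a := ⟨a.1.unop, a.2⟩
  map_add' _ _ := rfl
  map_smul' _ _ := rfl

/-- An element of the algebra, viewed in the opposite of the opposite algebra. -/
def opopₗ (𝒜 : ℤ → Submodule K Λ) (i : ℤ) : 𝒜 i →ₗ[K] opGrading (opGrading 𝒜) i where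
  toFun a := ⟨.op (.op a.1), a.2⟩
  map_add' _ _ := rfl
  map_smul' _ _ := rfl

@[simp] theorem coe_unopₗ (𝒜 : ℤ → Submodule K Λ) (i : ℤ) (a : opGrading 𝒜 i) : (unopₗ 𝒜 i a : Λ) = a.1.unop := rfl
@[simp] theorem coe_opopₗ (𝒜 : ℤ → Submodule K Λ) (i : ℤ) (a : 𝒜 i) :
    (opopₗ 𝒜 i a : Λᵐᵒᵖᵐᵒᵖ) = .op (.op a.1) := rfl

/-- `Λ(j)`: the left module `Λ`, with `Λ(j)_m = Λ_{m+j}`. -/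
def shift (𝒜 : ℤ → Submodule K Λ) [SetLike.GradedMonoid 𝒜] (j : ℤ) : GrMod 𝒜 where
  obj m := 𝒜 (m + j)
  act {i m k} h := mulₗ 𝒜 (show i + (m + j) = k + j by omega)
  one_act h e he x := by ext; simp [he]
  mul_act h h' h'' a b c hc x := by ext; simp [hc, mul_assoc]

/-- Right multiplication by an element of degree `i`, as a morphism `Λ(j) ⟶ Λ(i + j)`. -/
def rmul (𝒜 : ℤ → Submodule K Λ) [SetLike.GradedMonoid 𝒜] {i j k : ℤ} (h : i + j = k) :
    opGrading 𝒜 i →ₗ[K] (shift 𝒜 j ⟶ shift 𝒜 k) where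
  toFun a := (⟨fun m => (mulₗ 𝒜 (show m + j + i = m + k by omega)).flip (unopₗ 𝒜 i a),
    fun _ _ _ => Subtype.ext (mul_assoc _ _ _)⟩ : Hom (shift 𝒜 j) (shift 𝒜 k))
  map_add' a b := by ext m x; exact Subtype.ext (mul_add (x : 𝒜 (m + j)).1 _ _)
  map_smul' r a := by ext m x; exact Subtype.ext (mul_smul_comm r (x : 𝒜 (m + j)).1 _)

open Abelian in
/-- `tr^n M = Ext^n(M, Λ)`, a graded right module: its component of degree `j` is
`Ext^n(M, Λ(j))`, and `Λ` acts by functoriality through right multiplication on `Λ`. -/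
noncomputable def tr (n : ℕ) (M : GrMod 𝒜) : GrMod (opGrading 𝒜) where
  obj j := Ext M (shift 𝒜 j) n
  act {i j k} h := LinearMap.mk₂ K
    (fun a α => Ext.comp α (Ext.mk₀ (rmul 𝒜 h a)) (add_zero n))
    (by intros; simp [Ext.mk₀_add]) (by intros; simp [Ext.mk₀_smul])
    (by intros; simp) (by intros; simp)
  one_act {j} h e he α := by
    have : rmul 𝒜 h e = 𝟙 _ := by
      ext m x
      have : (x : 𝒜 (m + j)).1 * e.1.unop = (x : 𝒜 (m + j)).1 := by simp [he]
      exact Subtype.ext this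
    simp [this]
  mul_act {i i' s j k l} h h' h'' a b c hc α := by
    have : rmul 𝒜 h'' c = rmul 𝒜 h b ≫ rmul 𝒜 h' a := by
      ext m x
      have : (x : 𝒜 (m + j)).1 * c.1.unop = (x : 𝒜 (m + j)).1 * b.1.unop * a.1.unop := by
        simp [hc, mul_assoc]
      exact Subtype.ext this
    simp [this]

/-- The graded dual `D M = Hom_K(M, K)`, with `(D M)_j = Hom_K(M_{-j}, K)`. -/
def dual (M : GrMod 𝒜) : GrMod (opGrading 𝒜) where
  obj j := M.obj (-j) →ₗ[K] K
  act {i j k} h := LinearMap.mk₂ K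
    (fun a φ => φ ∘ₗ M.act (show i + -k = -j by omega) (unopₗ 𝒜 i a))
    (by intros; ext; simp) (by intros; ext; simp) (by intros; rfl) (by intros; rfl)
  one_act {j} h e he φ := by
    ext x
    exact congrArg φ (M.one_act _ _ (by simp [he]) x)
  mul_act h h' h'' a b c hc φ := by
    ext x
    exact congrArg φ (M.mul_act _ _ _ _ _ _ (by simp [hc]) x)

/-- A graded module over `Λᵐᵒᵖᵐᵒᵖ`, viewed as a graded `Λ`-module. -/
def ofOpOp (M : GrMod (opGrading (opGrading 𝒜))) : GrMod 𝒜 where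
  obj := M.obj
  act {i j k} h := M.act h ∘ₗ opopₗ 𝒜 i
  one_act h e he x := M.one_act h _ (by simp [he]) x
  mul_act h h' h'' a b c hc x := M.mul_act h h' h'' _ _ _ (by simp [hc]) x

end GrMod

end GradedModules

/-! ### Right modules, `tr` and `D` for ungraded modules -/

section UngradedModules

variable {Λ : Type u} [Ring Λ]

open Abelian in
/-- The right module structure on `Ext^n(M, Λ)` by functoriality through right multiplication
on `Λ`. -/
@[reducible]
noncomputable def extRightModule (n : ℕ) (M : ModuleCat.{u} Λ) :
    Module Λᵐᵒᵖ (Ext M (ModuleCat.of Λ Λ) n) where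
  smul a α := α.comp (Ext.mk₀ (ModuleCat.ofHom (LinearMap.toSpanSingleton Λ Λ a.unop)))
    (add_zero n)
  one_smul α := by
    have : LinearMap.toSpanSingleton Λ Λ (1 : Λ) = LinearMap.id := by ext; simp
    change α.comp (Ext.mk₀ (ModuleCat.ofHom (LinearMap.toSpanSingleton Λ Λ (1 : Λ)))) _ = α
    rw [this]
    exact Ext.comp_mk₀_id α
  mul_smul a b α := by
    change α.comp (Ext.mk₀ (ModuleCat.ofHom (LinearMap.toSpanSingleton Λ Λ (b.unop * a.unop)))) _
      = Ext.comp (α.comp _ _) _ _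
    rw [Ext.comp_assoc_of_third_deg_zero, Ext.mk₀_comp_mk₀, ← ModuleCat.ofHom_comp]
    congr 3
    ext; simp
  smul_zero a := Ext.zero_comp _ _ _ _ (add_zero n)
  smul_add a α β := Ext.add_comp _ _ _ (add_zero n)
  add_smul a b α := by
    change α.comp (Ext.mk₀ (ModuleCat.ofHom (LinearMap.toSpanSingleton Λ Λ (a.unop + b.unop)))) _
      = α.comp _ _ + α.comp _ _
    rw [LinearMap.toSpanSingleton_add, ModuleCat.ofHom_add, Ext.mk₀_add, Ext.comp_add]
  zero_smul α := by
    change α.comp (Ext.mk₀ (ModuleCat.ofHom (LinearMap.toSpanSingleton Λ Λ (0 : Λ)))) _ = 0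
    rw [LinearMap.toSpanSingleton_zero, ModuleCat.ofHom_zero, Ext.mk₀_zero, Ext.comp_zero]

/-- `tr^n M = Ext^n(M, Λ)`, a right `Λ`-module, that is, a left `Λᵐᵒᵖ`-module. -/
noncomputable def ModuleCat.tr (n : ℕ) (M : ModuleCat.{u} Λ) : ModuleCat.{u} Λᵐᵒᵖ :=
  letI := extRightModule n M
  ModuleCat.of Λᵐᵒᵖ (Abelian.Ext M (ModuleCat.of Λ Λ) n)

/-- A module over `Λᵐᵒᵖᵐᵒᵖ`, viewed as a `Λ`-module. -/
noncomputable def ModuleCat.ofOpOp (M : ModuleCat.{u} Λᵐᵒᵖᵐᵒᵖ) : ModuleCat.{u} Λ :=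
  (ModuleCat.restrictScalars (RingEquiv.opOp Λ).toRingHom).obj M

variable (K : Type u) [Field K] [Algebra K Λ]

open scoped ModuleCat in
/-- The right module structure on `Hom_K(M, K)`: `(φ a)(x) = φ(a x)`. -/
@[reducible]
def dualRightModule (M : ModuleCat.{u} Λ) : Module Λᵐᵒᵖ (M →ₗ[K] K) where
  smul a φ := φ ∘ₗ Algebra.lsmul K K M a.unop
  one_smul φ := by
    refine LinearMap.ext fun x => ?_
    change φ ((1 : Λ) • x) = φ x
    rw [one_smul]
  mul_smul a b φ := by
    refine LinearMap.ext fun x => ?_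
    change φ ((b.unop * a.unop) • x) = φ (b.unop • a.unop • x)
    rw [mul_smul]
  smul_zero a := rfl
  smul_add a φ ψ := rfl
  add_smul a b φ := by
    refine LinearMap.ext fun x => ?_
    change φ ((a.unop + b.unop) • x) = φ (a.unop • x) + φ (b.unop • x)
    rw [add_smul, map_add]
  zero_smul φ := by
    refine LinearMap.ext fun x => ?_
    change φ ((0 : Λ) • x) = 0
    rw [zero_smul, map_zero]

open scoped ModuleCat in
/-- The dual `D M = Hom_K(M, K)`, a right `Λ`-module. -/
def ModuleCat.dual (M : ModuleCat.{u} Λ) : ModuleCat.{u} Λᵐᵒᵖ :=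
  letI := dualRightModule K M
  ModuleCat.of Λᵐᵒᵖ (M →ₗ[K] K)

end UngradedModules

/-! ### The subcategory `H^n` and generalized Artin-Schelter regularity

`C` is the category of (graded) left modules, `C'` the category of (graded) right modules, and
`R`, `R'` are the families of objects `Λ` (one object in the ungraded case, all `Λ(j)` in the
graded case). -/

section Regular

attribute [local instance] Abelian.hasFiniteBiproducts

variable {C C' : Type*} [Category C] [Abelian C] [HasExt.{u} C]
  [Category C'] [Abelian C'] [HasExt.{u} C'] {ι ι' : Type}

/-- Finitely generated modules: quotients of finite direct sums of objects of the family `R`. -/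
def IsFinGen (R : ι → C) (M : C) : Prop :=
  ∃ (m : ℕ) (t : Fin m → ι) (p : (⨁ fun s => R (t s)) ⟶ M), Epi p

/-- The full subcategory `H^n` of the modules `M` of projective dimension `n` with
`Ext^i(M, Λ) = 0` for `i ≠ n` which have a projective resolution by finitely generated modules. -/
def HCat (R : ι → C) (n : ℕ) : ObjectProperty C := fun M =>
  projectiveDimension M = n ∧
  (∀ i, i ≠ n → ∀ t, Subsingleton (Abelian.Ext M (R t) i)) ∧
  ∃ P : ProjectiveResolution M, ∀ i, IsFinGen R (P.complex.X i)

/-- The global dimension: the supremum of all projective dimensions. -/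
noncomputable def globalDim (C : Type*) [Category C] [Abelian C] : WithBot ℕ∞ :=
  ⨆ M : C, projectiveDimension M

/-- The homological conditions in the definition of generalized Artin-Schelter regularity, where
`tr'` is the functor `Ext^n(-, Λ)` from right modules to left modules. -/
structure IsGenASRegular (R : ι → C) (R' : ι' → C') (tr' : C' → C) (n : ℕ) : Prop where
  globalDim_eq : globalDim C = n
  simple_mem : ∀ S : C, Simple S → projectiveDimension S = n → HCat R n S
  simple_mem' : ∀ S : C', Simple S → projectiveDimension S = n → HCat R' n S
  simple_sub : ∀ S : C', Simple S → projectiveDimension S = n →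
    ∃ T : C, Simple T ∧ HCat R n T ∧ ∃ f : T ⟶ tr' S, Mono f

end Regular

/-! ### Krull-Schmidt categories, almost split sequences, almost split extensions -/

section AlmostSplit

attribute [local instance] Abelian.hasFiniteBiproducts

variable {C C' : Type*} [Category C] [Abelian C] [HasExt.{u} C]

/-- The full subcategory `H` is a Krull-Schmidt category: every object is a finite direct sum
of objects with local endomorphism rings. -/
def IsKrullSchmidt (H : ObjectProperty C) : Prop :=
  ∀ M, H M → ∃ (m : ℕ) (X : Fin m → C),
    (∀ s, H (X s) ∧ IsLocalRing (End (X s))) ∧ Nonempty (M ≅ ⨁ X)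

/-- `0 → X₁ → X₂ → X₃ → 0` is an almost split sequence in the full subcategory `H`. -/
structure IsAlmostSplitSequence (H : ObjectProperty C) (S : ShortComplex C) : Prop where
  shortExact : S.ShortExact
  mem₁ : H S.X₁
  mem₂ : H S.X₂
  mem₃ : H S.X₃
  indecomposable₁ : Indecomposable S.X₁
  indecomposable₃ : Indecomposable S.X₃
  not_split : IsEmpty S.Splitting
  right : ∀ (X : C) (f : X ⟶ S.X₃), H X → ¬ IsSplitEpi f → ∃ f' : X ⟶ S.X₂, f' ≫ S.g = f
  left : ∀ (Y : C) (g : S.X₁ ⟶ Y), H Y → ¬ IsSplitMono g → ∃ g' : S.X₂ ⟶ Y, S.f ≫ g' = g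

/-- `H` has almost split sequences: every indecomposable object of `H` which is not projective
(relative to the exact sequences in `H`) is the end of one, and every indecomposable object which
is not injective is the start of one. -/
structure HasAlmostSplitSequences (H : ObjectProperty C) : Prop where
  ending : ∀ Z, H Z → Indecomposable Z → (∃ L, H L ∧ Nontrivial (Abelian.Ext Z L 1)) →
    ∃ S, IsAlmostSplitSequence H S ∧ Nonempty (S.X₃ ≅ Z)
  starting : ∀ A, H A → Indecomposable A → (∃ L, H L ∧ Nontrivial (Abelian.Ext L A 1)) →
    ∃ S, IsAlmostSplitSequence H S ∧ Nonempty (S.X₁ ≅ A)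

/-- `η ∈ Ext^n(Z, A)` is an `n`-fold almost split extension: it is nonzero, and its pullbacks along
nonsplit epimorphisms to `Z` and its pushouts along nonsplit monomorphisms from `A` vanish. -/
structure IsAlmostSplitExt {n : ℕ} {Z A : C} (η : Abelian.Ext Z A n) : Prop where
  ne_zero : η ≠ 0
  pullback : ∀ (X : C) (f : X ⟶ Z), Epi f → ¬ IsSplitEpi f →
    (Abelian.Ext.mk₀ f).comp η (zero_add n) = 0
  pushout : ∀ (Y : C) (g : A ⟶ Y), Mono g → ¬ IsSplitMono g →
    η.comp (Abelian.Ext.mk₀ g) (add_zero n) = 0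

/-- `H` has `n`-fold almost split extensions, governed by `τ = D tr^n`: every indecomposable `Z`
in `H` is the end of one which starts in `τ Z`, and every indecomposable `A` in `H` whose dual
lies in `H'` (the category `H^n` on the other side) is the start of one which ends in `H`. -/
structure HasAlmostSplitExts (H : ObjectProperty C) (H' : C' → Prop) (D : C → C') (τ : C → C)
    (n : ℕ) : Prop where
  ending : ∀ Z, H Z → Indecomposable Z → ∃ η : Abelian.Ext Z (τ Z) n, IsAlmostSplitExt η
  starting : ∀ A, H A → Indecomposable A → H' (D A) →
    ∃ Z, H Z ∧ Indecomposable Z ∧ ∃ η : Abelian.Ext Z A n, IsAlmostSplitExt η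

end AlmostSplit

/-! ### The ungraded and the graded case -/

/-- A ring is semiperfect if it is semisimple modulo its Jacobson radical, and idempotents lift
modulo the Jacobson radical. -/
def IsSemiperfectRing (Λ : Type*) [Ring Λ] : Prop :=
  IsSemisimpleRing (Λ ⧸ Ring.jacobson Λ) ∧
  ∀ x : Λ, x * x - x ∈ Ring.jacobson Λ → ∃ e : Λ, e * e = e ∧ e - x ∈ Ring.jacobson Λ

namespace ModuleCat

variable (Λ : Type u) [Ring Λ]

/-- The subcategory `H^n` of the category of `Λ`-modules. -/
def H (n : ℕ) : ObjectProperty (ModuleCat.{u} Λ) := HCat (fun _ : Unit => ModuleCat.of Λ Λ) n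

/-- A `K`-algebra `Λ` is generalized Artin-Schelter regular of dimension `n` with duality
`D = Hom_K(-, K)`, ungraded case. -/
structure IsGenASRegularWithDuality (K : Type u) [Field K] [Algebra K Λ] (n : ℕ) : Prop where
  semiperfect : IsSemiperfectRing Λ
  noetherian_left : IsNoetherianRing Λ
  noetherian_right : IsNoetherianRing Λᵐᵒᵖ
  regular : IsGenASRegular (fun _ : Unit => ModuleCat.of Λ Λ)
    (fun _ : Unit => ModuleCat.of Λᵐᵒᵖ Λᵐᵒᵖ) (fun M => ofOpOp (tr n M)) n
  finite_simple : ∀ S : ModuleCat.{u} Λ, Simple S →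
    @Module.Finite K S _ _ (moduleOfAlgebraModule S)

variable {Λ}

/-- The functor `D tr^n` on objects. -/
noncomputable def dualTr (K : Type u) [Field K] [Algebra K Λ] (n : ℕ) (M : ModuleCat.{u} Λ) :
    ModuleCat.{u} Λ :=
  ofOpOp (dual K (tr n M))

end ModuleCat

namespace GrMod

variable {K Λ : Type u} [Field K] [Ring Λ] [Algebra K Λ]

/-- The subcategory `H^n` of the category of graded modules. -/
def H (𝒜 : ℤ → Submodule K Λ) [SetLike.GradedMonoid 𝒜] (n : ℕ) : ObjectProperty (GrMod 𝒜) :=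
  HCat (shift 𝒜) n

/-- A graded `K`-algebra is (graded) generalized Artin-Schelter regular of dimension `n`. In the
graded case the graded dual is always available. The left and the right ideal `Λ_{≥ 1}` are
generated by the elements of positive degree. -/
structure IsGenASRegularWithDuality (𝒜 : ℤ → Submodule K Λ) [GradedAlgebra 𝒜] (n : ℕ) :
    Prop where
  positive : ∀ i < 0, 𝒜 i = ⊥
  zero_part : ∃ t : ℕ, Nonempty (𝒜 0 ≃ₐ[K] (Fin t → K))
  finite : ∀ i, Module.Finite K (𝒜 i)
  fg_left : (Submodule.span Λ (⋃ i > 0, (𝒜 i : Set Λ))).FG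
  fg_right : (Submodule.span Λᵐᵒᵖ (⋃ i > 0, (𝒜 i : Set Λ))).FG
  regular : IsGenASRegular (shift 𝒜) (shift (opGrading 𝒜)) (fun M => ofOpOp (tr n M)) n

/-- The functor `D tr^n` on objects. -/
noncomputable def dualTr {𝒜 : ℤ → Submodule K Λ} [SetLike.GradedMonoid 𝒜] (n : ℕ) (M : GrMod 𝒜) :
    GrMod 𝒜 :=
  ofOpOp (dual (tr n M))

end GrMod

/-! The engine is a Serre duality. If M has a resolution of length n by finitely generated
projectives, then Ext^n(M, X) behaves like Ext^n(M, Λ) ⊗ X, so D Ext^n(M, X) ≅ Hom(X, T) for T = D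
tr^n M, naturally in X (`HasFPRes.exists_functional`, `HasFPRes.hasSerreDual`). If moreover Ext^i(M,
Λ) = 0 for i < n, then Ext^i(M, -) kills all free modules for i < n, and dimension shifting in X
gives D Ext^i(M, X) ≅ Ext^{n-i}(X, T) (`IsSerreTrace.existsUnique_class`). The case i = 0 identifies
Ext^n(M, T) with the dual of End M. When End M is finite dimensional it is isomorphic to End T; when
it is also local, a functional on End M which kills the non-isomorphisms but not the identity is an
almost split class (`IsPerfectTrace.exists_almostSplit`).

Finite dimensionality of End M is where Artin–Schelter regularity enters. An M in H^n has Ext^n(M,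
W) ≠ 0 for some simple W. The simple right module S = DW then has projective dimension n, so tr^n S
contains a simple T in H^n. The Serre dual of tr^n S is DS = W, and right exactness of Ext^n embeds
the Serre dual of T into W; hence W is the Serre dual of T
(`IsDualizing.exists_simple_hasSerreDual`). Since Ext^n(M, W) ≅ D Hom(T, M) is nonzero, T embeds in
M, and the quotient is zero or again in H^n (`IsDualizing.exists_filtration_step`). Iterating shows
that M and Ext^n(M, Λ) are finite dimensional. The iteration stops by Noetherianity in the ungraded
case, and in the graded case because a finite sum of dimensions of Ext^n(M, Λ(c)) drops.

The second existence statement needs the transpose: dualizing a projective resolution of a right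
module N with Ext^i(N, Λ) = 0 for i < n yields a resolution of V = Ext^n(N, Λ), and V has Serre dual
DN (`HasFPRes.transpose`). With N = DA this gives an object of H^n whose Serre dual is A.

For n = 1 both ends must lie in H^1. If τZ = D tr^1 Z had a nonzero map to Λ, its image would be
projective and split off, so τZ would embed in Λ. This is impossible if Hom(L, τZ) ≠ 0 for some L in
H^1, which is what Ext^1(Z, L) ≠ 0 gives. Dually, a nonzero map DA → Λ would make A a summand of a
quotient of an injective, hence injective.

All of this takes place in two abelian categories with families R and R' of projective generators.
Objects are probed by morphisms from the R i, and D and Ext^k(-, Λ) enter only through their values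
on these probes (`DualPairing`, `ExtDual`). The two cases of the theorem differ only in the proof of
`IsDualizing` and in the termination argument. -/

/-! ### Yoneda composition with morphisms -/

namespace CategoryTheory.Abelian.Ext

variable {C : Type*} [Category C] [Abelian C] [HasExt.{u} C] {X Y Z T : C} {n : ℕ}

/-- The pushout of an extension class along a morphism of the target. -/
noncomputable def push (α : Ext X Y n) (f : Y ⟶ Z) : Ext X Z n := α.comp (mk₀ f) (add_zero n)

/-- The pullback of an extension class along a morphism to the source. -/
noncomputable def pull (f : X ⟶ Y) (α : Ext Y Z n) : Ext X Z n := (mk₀ f).comp α (zero_add n)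

theorem pull_def (f : X ⟶ Y) (α : Ext Y Z n) : pull f α = (mk₀ f).comp α (zero_add n) := rfl

@[simp] theorem push_push (α : Ext X Y n) (f : Y ⟶ Z) (g : Z ⟶ T) :
    (α.push f).push g = α.push (f ≫ g) := by
  simp [push]

@[simp] theorem pull_pull (f : X ⟶ Y) (g : Y ⟶ Z) (α : Ext Z T n) :
    pull f (pull g α) = pull (f ≫ g) α := by
  simp [pull]

@[simp] theorem pull_push (f : X ⟶ Y) (α : Ext Y Z n) (g : Z ⟶ T) :
    (pull f α).push g = pull f (α.push g) := by
  simp [pull, push, comp_assoc_of_third_deg_zero]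

@[simp] theorem push_id (α : Ext X Y n) : α.push (𝟙 Y) = α := by simp [push]

@[simp] theorem pull_id (α : Ext X Y n) : pull (𝟙 X) α = α := by simp [pull]

@[simp] theorem push_zero (α : Ext X Y n) : α.push (0 : Y ⟶ Z) = 0 := by simp [push]

@[simp] theorem zero_push (f : Y ⟶ Z) : (0 : Ext X Y n).push f = 0 := by simp [push]

@[simp] theorem pull_zero (f : X ⟶ Y) : pull f (0 : Ext Y Z n) = 0 := by simp [pull]

@[simp] theorem zero_pull (α : Ext Y Z n) : pull (0 : X ⟶ Y) α = 0 := by simp [pull]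

@[simp] theorem push_add (α : Ext X Y n) (f g : Y ⟶ Z) :
    α.push (f + g) = α.push f + α.push g := by simp [push, mk₀_add]

@[simp] theorem add_push (α β : Ext X Y n) (f : Y ⟶ Z) :
    (α + β).push f = α.push f + β.push f := by simp [push]

@[simp] theorem pull_add (f : X ⟶ Y) (α β : Ext Y Z n) :
    pull f (α + β) = pull f α + pull f β := by simp [pull]

@[simp] theorem add_pull (f g : X ⟶ Y) (α : Ext Y Z n) :
    pull (f + g) α = pull f α + pull g α := by simp [pull, mk₀_add]

theorem push_sum {ι : Type*} (s : Finset ι) (α : Ext X Y n) (f : ι → (Y ⟶ Z)) :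
    α.push (∑ i ∈ s, f i) = ∑ i ∈ s, α.push (f i) := by
  classical
  induction s using Finset.induction_on with
  | empty => simp
  | insert a s h ih => simp [Finset.sum_insert h, ih]

theorem sum_push {ι : Type*} (s : Finset ι) (α : ι → Ext X Y n) (f : Y ⟶ Z) :
    (∑ i ∈ s, α i).push f = ∑ i ∈ s, (α i).push f := by
  classical
  induction s using Finset.induction_on with
  | empty => simp
  | insert a s h ih => simp [Finset.sum_insert h, ih]

theorem comp_push {a b c : ℕ} (α : Ext X Y a) (β : Ext Y Z b) (h : a + b = c) (f : Z ⟶ T) :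
    (α.comp β h).push f = α.comp (β.push f) h := by
  simp [push, comp_assoc_of_third_deg_zero]

theorem push_comp {a b c : ℕ} (α : Ext X Y a) (f : Y ⟶ Z) (β : Ext Z T b) (h : a + b = c) :
    (α.push f).comp β h = α.comp (pull f β) h := by
  simp [push, pull]

@[simp] theorem mk₀_push (f : X ⟶ Y) (g : Y ⟶ Z) : (mk₀ f).push g = mk₀ (f ≫ g) := by simp [push]

theorem comp_mk₀_eq_push (α : Ext X Y n) (f : Y ⟶ Z) (h : n + 0 = n) :
    α.comp (mk₀ f) h = α.push f := rfl

theorem mk₀_comp_eq_pull (f : X ⟶ Y) (α : Ext Y Z n) (h : 0 + n = n) :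
    (mk₀ f).comp α h = pull f α := rfl

section Linear

variable {K : Type*} [Field K] [Linear K C]

@[simp] theorem smul_push (r : K) (α : Ext X Y n) (f : Y ⟶ Z) :
    (r • α).push f = r • α.push f := by simp [push]

@[simp] theorem push_smul (r : K) (α : Ext X Y n) (f : Y ⟶ Z) :
    α.push (r • f) = r • α.push f := by simp [push, mk₀_smul]

@[simp] theorem pull_smul (r : K) (f : X ⟶ Y) (α : Ext Y Z n) :
    pull f (r • α) = r • pull f α := by simp [pull]

@[simp] theorem smul_pull (r : K) (f : X ⟶ Y) (α : Ext Y Z n) :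
    pull (r • f) α = r • pull f α := by simp [pull, mk₀_smul]

variable (K)

/-- `push` as a linear map of the class. -/
noncomputable def pushₗ (X : C) (n : ℕ) (f : Y ⟶ Z) : Ext X Y n →ₗ[K] Ext X Z n where
  toFun α := α.push f
  map_add' := by simp
  map_smul' := by simp

/-- `pull` as a linear map of the class. -/
noncomputable def pullₗ (Z : C) (n : ℕ) (f : X ⟶ Y) : Ext Y Z n →ₗ[K] Ext X Z n where
  toFun α := pull f α
  map_add' := by simp
  map_smul' := by simp

/-- Composition with a fixed class on the left, as a linear map. -/
noncomputable def precompₗ {a b c : ℕ} (α : Ext X Y a) (Z : C) (h : a + b = c) :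
    Ext Y Z b →ₗ[K] Ext X Z c where
  toFun β := α.comp β h
  map_add' := by simp
  map_smul' := by simp

/-- Composition with a fixed class on the right, as a linear map. -/
noncomputable def postcompₗ {a b c : ℕ} (X : C) (β : Ext Y Z b) (h : a + b = c) :
    Ext X Y a →ₗ[K] Ext X Z c where
  toFun α := α.comp β h
  map_add' := by simp
  map_smul' := by simp

@[simp] theorem pushₗ_apply (X : C) (n : ℕ) (f : Y ⟶ Z) (α : Ext X Y n) :
    pushₗ K X n f α = α.push f := rfl

@[simp] theorem pullₗ_apply (Z : C) (n : ℕ) (f : X ⟶ Y) (α : Ext Y Z n) :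
    pullₗ K Z n f α = pull f α := rfl

@[simp] theorem precompₗ_apply {a b c : ℕ} (α : Ext X Y a) (Z : C) (h : a + b = c)
    (β : Ext Y Z b) : precompₗ K α Z h β = α.comp β h := rfl

@[simp] theorem postcompₗ_apply {a b c : ℕ} (X : C) (β : Ext Y Z b) (h : a + b = c)
    (α : Ext X Y a) : postcompₗ K X β h α = α.comp β h := rfl

end Linear

theorem eq_zero_of_pd {X Y : C} {n k : ℕ} (h : HasProjectiveDimensionLT X n) (hk : n ≤ k)
    (α : Ext X Y k) : α = 0 :=
  eq_zero_of_hasProjectiveDimensionLT α n hk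

end CategoryTheory.Abelian.Ext

/-! ### Linear algebra: extending and separating functionals -/

/-- A functional vanishing on the kernel of a linear map factors through the map. -/
theorem LinearMap.exists_dual_comp_eq {K V W : Type*} [Field K] [AddCommGroup V] [Module K V]
    [AddCommGroup W] [Module K W] (q : V →ₗ[K] W) (ψ : V →ₗ[K] K)
    (h : ∀ v, q v = 0 → ψ v = 0) : ∃ χ : W →ₗ[K] K, ∀ v, χ (q v) = ψ v := by
  have : ψ ∈ LinearMap.range q.dualMap := by
    rw [LinearMap.range_dualMap_eq_dualAnnihilator_ker, Submodule.mem_dualAnnihilator]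
    exact fun w hw => h w hw
  obtain ⟨χ, hχ⟩ := this
  exact ⟨χ, fun v => LinearMap.congr_fun hχ v⟩

/-- Functionals separate the elements of a vector space. -/
theorem exists_dual_apply_ne_zero (K : Type*) {V : Type*} [Field K] [AddCommGroup V] [Module K V]
    {v : V} (hv : v ≠ 0) : ∃ χ : V →ₗ[K] K, χ v ≠ 0 := by
  by_contra! h
  exact hv ((Module.forall_dual_apply_eq_zero_iff K v).1 h)

open CategoryTheory.Abelian

/-! ### Finitely generated projective objects and finite resolutions by them -/

section FiniteResolutions

variable {C : Type*} [Category C] [Abelian C] {ι : Type}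

/-- `R` is a family of projective generators from which all morphisms can be glued. -/
structure IsDenseFamily (R : ι → C) : Prop where
  proj : ∀ i, Projective (R i)
  glue : ∀ {X Y : C} (c : ∀ i, (R i ⟶ X) → (R i ⟶ Y)),
    (∀ i x y, c i (x + y) = c i x + c i y) →
    (∀ i j (a : R i ⟶ R j) (x : R j ⟶ X), c i (a ≫ x) = a ≫ c j x) →
    ∃ f : X ⟶ Y, ∀ i (x : R i ⟶ X), x ≫ f = c i x
  sep : ∀ {X Y : C} (f : X ⟶ Y), (∀ i (x : R i ⟶ X), x ≫ f = 0) → f = 0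

/-- Direct summands of finite direct sums of members of `R`, given by a finite dual basis. -/
def IsFGProj (R : ι → C) (P : C) : Prop :=
  ∃ (m : ℕ) (t : Fin m → ι) (e : ∀ s, P ⟶ R (t s)) (p : ∀ s, R (t s) ⟶ P),
    ∑ s, e s ≫ p s = 𝟙 P

/-- `M` has a resolution of length `k` by finitely generated projective objects. -/
def HasFPRes (R : ι → C) : ℕ → C → Prop
  | 0, M => IsFGProj R M
  | k + 1, M => ∃ S : ShortComplex C, S.ShortExact ∧ S.X₃ = M ∧ IsFGProj R S.X₂ ∧
      HasFPRes R k S.X₁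

variable {R : ι → C}

theorem IsFGProj.projective (hR : ∀ i, Projective (R i)) {P : C} (h : IsFGProj R P) :
    Projective P := by
  obtain ⟨m, t, e, p, hep⟩ := h
  refine ⟨fun {E X} f g _ => ?_⟩
  have := hR
  refine ⟨∑ s, e s ≫ Projective.factorThru (p s ≫ f) g, ?_⟩
  rw [Preadditive.sum_comp]
  simp only [Category.assoc, Projective.factorThru_comp]
  simp only [← Category.assoc, ← Preadditive.sum_comp, hep, Category.id_comp]

theorem isFGProj_self (i : ι) : IsFGProj R (R i) :=
  ⟨1, fun _ => i, fun _ => 𝟙 _, fun _ => 𝟙 _, by simp⟩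

theorem isFGProj_of_retract {P Q : C} (h : IsFGProj R P) (i : Q ⟶ P) (r : P ⟶ Q)
    (hir : i ≫ r = 𝟙 Q) : IsFGProj R Q := by
  obtain ⟨m, t, e, p, hep⟩ := h
  refine ⟨m, t, fun s => i ≫ e s, fun s => p s ≫ r, ?_⟩
  have : ∑ s, (i ≫ e s) ≫ p s ≫ r = i ≫ (∑ s, e s ≫ p s) ≫ r := by
    simp [Preadditive.comp_sum, Preadditive.sum_comp]
  rw [this, hep, Category.id_comp, hir]

theorem isFGProj_of_isZero {P : C} (h : IsZero P) : IsFGProj R P :=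
  ⟨0, Fin.elim0, fun s => s.elim0, fun s => s.elim0, h.eq_of_src _ _⟩

theorem isFGProj_biprod {P Q : C} (hP : IsFGProj R P) (hQ : IsFGProj R Q) :
    IsFGProj R (P ⊞ Q) := by
  obtain ⟨m, t, e, p, hep⟩ := hP
  obtain ⟨m', t', e', p', hep'⟩ := hQ
  refine ⟨m + m', Fin.append t t',
    Fin.addCases (fun s => biprod.fst ≫ e s ≫ eqToHom (by simp))
      (fun s => biprod.snd ≫ e' s ≫ eqToHom (by simp)),
    Fin.addCases (fun s => eqToHom (by simp) ≫ p s ≫ biprod.inl)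
      (fun s => eqToHom (by simp) ≫ p' s ≫ biprod.inr), ?_⟩
  rw [Fin.sum_univ_add]
  simp only [Fin.addCases_left, Fin.addCases_right, Category.assoc, eqToHom_trans_assoc,
    eqToHom_refl, Category.id_comp]
  have h1 : ∑ s, (biprod.fst : P ⊞ Q ⟶ P) ≫ e s ≫ p s ≫ (biprod.inl : P ⟶ P ⊞ Q) =
      biprod.fst ≫ (∑ s, e s ≫ p s) ≫ biprod.inl := by
    simp [Preadditive.comp_sum, Preadditive.sum_comp]
  have h2 : ∑ s, (biprod.snd : P ⊞ Q ⟶ Q) ≫ e' s ≫ p' s ≫ (biprod.inr : Q ⟶ P ⊞ Q) =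
      biprod.snd ≫ (∑ s, e' s ≫ p' s) ≫ biprod.inr := by
    simp [Preadditive.comp_sum, Preadditive.sum_comp]
  rw [h1, h2, hep, hep', Category.id_comp, Category.id_comp, biprod.total]

theorem isFGProj_of_iso {P Q : C} (h : IsFGProj R P) (e : P ≅ Q) : IsFGProj R Q :=
  isFGProj_of_retract h e.inv e.hom e.inv_hom_id

theorem hasFPRes_of_iso {k : ℕ} {M N : C} (h : HasFPRes R k M) (e : M ≅ N) : HasFPRes R k N := by
  cases k with
  | zero => exact isFGProj_of_iso h e
  | succ k =>
    obtain ⟨S, hS, rfl, h2, h1⟩ := h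
    exact ⟨ShortComplex.mk S.f (S.g ≫ e.hom) (by simp),
      ShortComplex.shortExact_of_iso
        (ShortComplex.isoMk (S₁ := S) (S₂ := ShortComplex.mk S.f (S.g ≫ e.hom) (by simp))
          (Iso.refl _) (Iso.refl _) e) hS, rfl, h2, h1⟩

variable [HasExt.{u} C]

/-- The groups `Ext^k(M, X)` are generated by finitely many classes in the groups
`Ext^k(M, R i)`. -/
theorem HasFPRes.exists_generators (hR : ∀ i, Projective (R i)) {k : ℕ} {M : C}
    (hM : HasFPRes R k M) : ∃ (m : ℕ) (t : Fin m → ι) (α : ∀ s, Ext M (R (t s)) k),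
      ∀ (X : C) (η : Ext M X k), ∃ x : ∀ s, R (t s) ⟶ X, η = ∑ s, (α s).push (x s) := by
  induction k generalizing M with
  | zero =>
    obtain ⟨m, t, e, p, hep⟩ := hM
    refine ⟨m, t, fun s => Ext.mk₀ (e s), fun X η => ?_⟩
    obtain ⟨g, rfl⟩ := Ext.addEquiv₀.symm.surjective η
    refine ⟨fun s => p s ≫ g, ?_⟩
    simp only [Ext.mk₀_push]
    rw [← Ext.mk₀_sum]
    simp only [← Category.assoc]
    rw [← Preadditive.sum_comp, hep, Category.id_comp]
    rfl
  | succ k ih =>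
    obtain ⟨S, hS, rfl, h2, h1⟩ := hM
    have := h2.projective hR
    obtain ⟨m, t, α, h⟩ := ih h1
    -- Dimension shifting: the middle term is projective, so the connecting map from Ext^k of the
    -- syzygy is onto Ext^{k+1} and carries generators to generators.
    refine ⟨m, t, fun s => hS.extClass.comp (α s) (add_comm 1 k), fun X η => ?_⟩
    obtain ⟨η', rfl⟩ := Ext.contravariant_sequence_exact₃ hS _ η (Ext.eq_zero_of_projective _)
      (add_comm 1 k)
    obtain ⟨x, rfl⟩ := h X η'
    refine ⟨x, ?_⟩
    simp only [Ext.comp_push, Ext.comp_sum]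

theorem HasFPRes.exists_sum (hR : ∀ i, Projective (R i)) {k : ℕ} {M : C} (hM : HasFPRes R k M)
    {X : C} (η : Ext M X k) : ∃ (m : ℕ) (t : Fin m → ι) (α : ∀ s, Ext M (R (t s)) k)
      (x : ∀ s, R (t s) ⟶ X), η = ∑ s, (α s).push (x s) := by
  obtain ⟨m, t, α, h⟩ := hM.exists_generators hR
  obtain ⟨x, hx⟩ := h X η
  exact ⟨m, t, α, x, hx⟩

/-- In the top degree of a resolution, Ext^k(M, X) plays the role of Ext^k(M, Λ) ⊗ X, with `α.push
x` as pure tensor. This is the uniqueness half of the universal property;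
`HasFPRes.exists_functional` is the existence half. -/
theorem HasFPRes.ext_hom_ext (hR : ∀ i, Projective (R i)) {k : ℕ} {M : C} (hM : HasFPRes R k M)
    {X : C} {A : Type*} [AddCommGroup A] (φ ψ : Ext M X k →+ A)
    (h : ∀ i (α : Ext M (R i) k) (x : R i ⟶ X), φ (α.push x) = ψ (α.push x)) : φ = ψ := by
  ext η
  obtain ⟨m, t, α, x, rfl⟩ := hM.exists_sum hR η
  simp [h]

variable (K : Type*) [Field K] [Linear K C]

/-- Functionals on `Ext^k(M, X)` are glued from their restrictions to the groups `Ext^k(M, R i)`. -/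
theorem HasFPRes.exists_functional (hR : ∀ i, Projective (R i)) {k : ℕ} {M : C}
    (hM : HasFPRes R k M) {X : C}
    (c : ∀ i, (R i ⟶ X) → (Ext M (R i) k →ₗ[K] K))
    (hadd : ∀ i x y, c i (x + y) = c i x + c i y)
    (hc : ∀ i j (a : R i ⟶ R j) (x : R j ⟶ X) (α : Ext M (R i) k),
      c i (a ≫ x) α = c j x (α.push a)) :
    ∃ ψ : Ext M X k →ₗ[K] K, ∀ i (x : R i ⟶ X) (α : Ext M (R i) k), ψ (α.push x) = c i x α := by
  induction k generalizing M with
  | zero =>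
    obtain ⟨m, t, e, p, hep⟩ := hM
    -- Only additivity in `x` is assumed; homogeneity is balancedness along the endomorphism `r •
    -- 𝟙`.
    have hsmul : ∀ i (r : K) (x : R i ⟶ X), c i (r • x) = r • c i x := by
      intro i r x
      ext α
      have := hc i i (r • 𝟙 _) x α
      simpa using this
    have hsum : ∀ i (s : Finset (Fin m)) (x : Fin m → (R i ⟶ X)) α,
        c i (∑ a ∈ s, x a) α = ∑ a ∈ s, c i (x a) α := by
      intro i s x α
      have h0 : c i 0 = 0 := by simpa using hsmul i 0 0
      classical
      induction s using Finset.induction_on with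
      | empty => simp [h0]
      | insert a s h ih => simp [Finset.sum_insert h, hadd, ih]
    -- The dual basis writes `g` as the sum of the pure tensors of `e s` and `p s ≫ g`, which forces
    -- this formula.
    refine ⟨∑ s, ({ toFun := fun g => c (t s) (p s ≫ g) (Ext.mk₀ (e s))
                    map_add' := by simp [hadd]
                    map_smul' := by simp [hsmul] } : (M ⟶ X) →ₗ[K] K) ∘ₗ
      (Ext.linearEquiv₀ (R := K)).toLinearMap, ?_⟩
    intro i x α
    obtain ⟨h, rfl⟩ := (Ext.linearEquiv₀ (R := K)).symm.surjective α
    have e1 : (Ext.linearEquiv₀ (R := K) ((Ext.linearEquiv₀ (R := K)).symm h |>.push x)) = h ≫ x := by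
      apply (Ext.linearEquiv₀ (R := K)).symm.injective
      simp
    simp only [LinearMap.coe_sum, LinearMap.coe_comp, Finset.sum_apply, Function.comp_apply,
      LinearEquiv.coe_coe, e1, LinearMap.coe_mk, AddHom.coe_mk]
    simp only [← Category.assoc]
    simp only [hc (j := i), Ext.mk₀_push]
    rw [← map_sum, ← Ext.mk₀_sum]
    simp only [← Category.assoc]
    rw [← Preadditive.sum_comp, hep, Category.id_comp]
    rfl
  | succ k ih =>
    obtain ⟨S, hS, rfl, h2, h1⟩ := hM
    have := h2.projective hR
    obtain ⟨ψ', hψ'⟩ := ih h1 (fun i x => c i x ∘ₗ Ext.precompₗ K hS.extClass (R i) (add_comm 1 k))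
      (fun i x y => by ext; simp [hadd]) (fun i j a x α => by simp [hc, Ext.comp_push])
    -- The functional on the syzygy descends along the connecting map once it kills the classes
    -- restricted from the projective middle term. Those vanish in positive degree; in degree zero
    -- they are sums of pure tensors, whose left factors the connecting map kills.
    obtain ⟨ψ, hψ⟩ := LinearMap.exists_dual_comp_eq
      (Ext.precompₗ K hS.extClass X (add_comm 1 k)) ψ' (fun β hβ => by
        obtain ⟨γ, rfl⟩ := Ext.contravariant_sequence_exact₁ hS _ β (add_comm 1 k) hβ
        rw [Ext.mk₀_comp_eq_pull]
        cases k with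
        | succ k => rw [Ext.eq_zero_of_projective γ]; simp
        | zero =>
          obtain ⟨m, t, α, x, rfl⟩ := HasFPRes.exists_sum (k := 0) hR h2 γ
          rw [← Ext.pullₗ_apply K, map_sum, map_sum]
          refine Finset.sum_eq_zero fun s _ => ?_
          rw [Ext.pullₗ_apply, ← Ext.pull_push, hψ']
          simp [Ext.pull_def])
    refine ⟨ψ, fun i x α => ?_⟩
    obtain ⟨β, rfl⟩ := Ext.contravariant_sequence_exact₃ hS _ α (Ext.eq_zero_of_projective _)
      (add_comm 1 k)
    have := hψ (β.push x)
    rw [hψ'] at this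
    simpa [Ext.comp_push] using this

end FiniteResolutions

/-! ### Serre duality -/

section SerreDuality

variable {C : Type*} [Category C] [Abelian C] [HasExt.{u} C] {ι : Type} {R : ι → C}
  (K : Type*) [Field K] [Linear K C]

/-- The object `T` represents the functor `X ↦ Hom_K(Ext^n(M, X), K)`; the trace `t` is the
universal element. -/
def IsSerreTrace {n : ℕ} {M T : C} (t : Ext M T n →ₗ[K] K) : Prop :=
  ∀ (X : C) (ψ : Ext M X n →ₗ[K] K), ∃! f : X ⟶ T, ∀ η : Ext M X n, t (η.push f) = ψ η

/-- The object `T` represents the functor `X ↦ Hom_K(Ext^n(M, X), K)`. -/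
def HasSerreDual (n : ℕ) (M T : C) : Prop := ∃ t : Ext M T n →ₗ[K] K, IsSerreTrace K t

variable {K}

theorem IsSerreTrace.eq_of_forall {n : ℕ} {M T X : C} {t : Ext M T n →ₗ[K] K}
    (ht : IsSerreTrace K t) {f g : X ⟶ T} (h : ∀ η : Ext M X n, t (η.push f) = t (η.push g)) : f = g := by
  obtain ⟨k, -, hk⟩ := ht X ((t ∘ₗ Ext.pushₗ K M n g))
  rw [hk f h, hk g fun _ => rfl]

theorem IsSerreTrace.eq_zero_of_forall {n : ℕ} {M T X : C} {t : Ext M T n →ₗ[K] K}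
    (ht : IsSerreTrace K t) {f : X ⟶ T} (h : ∀ η : Ext M X n, t (η.push f) = 0) : f = 0 :=
  ht.eq_of_forall fun η => by simp [h]

/-- A class is zero if all its pairings with morphisms to `T` are zero. -/
theorem IsSerreTrace.class_eq_zero {n : ℕ} {M T X : C} {t : Ext M T n →ₗ[K] K}
    (ht : IsSerreTrace K t) {η : Ext M X n} (h : ∀ f : X ⟶ T, t (η.push f) = 0) : η = 0 := by
  by_contra hη
  obtain ⟨χ, hχ⟩ := exists_dual_apply_ne_zero K hη
  obtain ⟨f, hf, -⟩ := ht X χ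
  exact hχ ((hf η).symm.trans (h f))

theorem HasSerreDual.of_iso {n : ℕ} {M T T' : C} (h : HasSerreDual K n M T) (e : T ≅ T') :
    HasSerreDual K n M T' := by
  obtain ⟨t, ht⟩ := h
  refine ⟨t ∘ₗ Ext.pushₗ K M n e.inv, fun X ψ => ?_⟩
  obtain ⟨f, hf, hu⟩ := ht X ψ
  refine ⟨f ≫ e.hom, by simpa using hf, fun g hg => ?_⟩
  rw [← hu (g ≫ e.inv) (by simpa using hg)]
  simp

/-- Serre duality can be tested on the members of a dense family. -/
theorem HasFPRes.hasSerreDual (hR : IsDenseFamily R) {n : ℕ} {M T : C} (hM : HasFPRes R n M)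
    (φ : ∀ i, (R i ⟶ T) ≃+ (Ext M (R i) n →ₗ[K] K))
    (hφ : ∀ i j (a : R i ⟶ R j) (x : R j ⟶ T) (α : Ext M (R i) n),
      φ i (a ≫ x) α = φ j x (α.push a)) : HasSerreDual K n M T := by
  obtain ⟨t, ht⟩ := hM.exists_functional K hR.proj (fun i => φ i) (by simp) hφ
  refine ⟨t, fun X ψ => ?_⟩
  -- The representing morphism is prescribed on each probe `x` by transporting the restriction of
  -- `ψ` along `x` through `φ`.
  obtain ⟨f, hf⟩ := hR.glue (X := X) (Y := T)
    (fun i x => (φ i).symm (ψ ∘ₗ Ext.pushₗ K M n x))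
    (fun i x y => by
      rw [← map_add]; congr 1; ext; simp)
    (fun i j a x => by
      apply (φ i).injective
      ext α
      rw [hφ]
      simp)
  -- Both sides of the duality are determined by pure tensors, so representing `ψ` is the same as
  -- having the prescribed values on probes. Existence and uniqueness follow together.
  have key : ∀ (g : X ⟶ T), (∀ η, t (η.push g) = ψ η) ↔
      ∀ i (x : R i ⟶ X), x ≫ g = (φ i).symm (ψ ∘ₗ Ext.pushₗ K M n x) := by
    intro g
    constructor
    · intro h i x
      apply (φ i).injective
      ext α
      rw [← ht]
      simp [← h]
    · intro h η
      have := hM.ext_hom_ext hR.proj ((t ∘ₗ Ext.pushₗ K M n g).toAddMonoidHom) ψ.toAddMonoidHom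
        (fun i α x => by
          have := ht i (x ≫ g) α
          rw [h] at this
          simpa [h] using this)
      exact DFunLike.congr_fun this η
  refine ⟨f, (key f).2 hf, fun g hg => ?_⟩
  rw [← sub_eq_zero]
  apply hR.sep
  intro i x
  rw [Preadditive.comp_sub, (key g).1 hg, hf, sub_self]

/-- Every object is a quotient of a projective object `F` such that finitely many
morphisms `R i ⟶ F` factor through a finite direct sum of members of `R`. -/
def HasFreeCovers (R : ι → C) : Prop :=
  ∀ X : C, ∃ (F : C) (p : F ⟶ X), Epi p ∧ Projective F ∧
    ∀ (m : ℕ) (t : Fin m → ι) (g : ∀ s, R (t s) ⟶ F), ∃ (m' : ℕ) (r : Fin m' → ι)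
      (a : ∀ k, F ⟶ R (r k)) (b : ∀ k, R (r k) ⟶ F), ∀ s, g s ≫ ∑ k, a k ≫ b k = g s

/-- Vanishing of `Ext^i(M, -)` on the family `R` extends to free objects. -/
theorem HasFPRes.ext_eq_zero_of_free (hR : ∀ i, Projective (R i)) {k : ℕ} {M : C}
    (hM : HasFPRes R k M) {F : C}
    (hF : ∀ (m : ℕ) (t : Fin m → ι) (g : ∀ s, R (t s) ⟶ F), ∃ (m' : ℕ) (r : Fin m' → ι)
      (a : ∀ k, F ⟶ R (r k)) (b : ∀ k, R (r k) ⟶ F), ∀ s, g s ≫ ∑ k, a k ≫ b k = g s)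
    {i : ℕ} (h0 : ∀ t, Subsingleton (Ext M (R t) i)) (η : Ext M F i) : η = 0 := by
  -- Each class has finite support: any endomorphism of `F` fixing finitely many probes fixes the
  -- class. Choosing one which factors through a finite sum of members of `R` reduces the vanishing
  -- to these members.
  suffices H : ∀ {k : ℕ} {M : C} (_ : HasFPRes R k M) (i : ℕ) (η : Ext M F i),
      ∃ (m : ℕ) (t : Fin m → ι) (g : ∀ s, R (t s) ⟶ F), ∀ e : F ⟶ F,
        (∀ s, g s ≫ e = g s) → η.push e = η by
    obtain ⟨m, t, g, hg⟩ := H hM i η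
    obtain ⟨m', r, a, b, hab⟩ := hF m t g
    rw [← hg _ hab, Ext.push_sum]
    refine Finset.sum_eq_zero fun s _ => ?_
    rw [← Ext.push_push, (h0 _).elim (η.push (a s)) 0, Ext.zero_push]
  clear hM h0 η
  intro k M hM i η
  induction k generalizing M i with
  | zero =>
    cases i with
    | succ i =>
      have := IsFGProj.projective hR hM
      rw [Ext.eq_zero_of_projective η]
      exact ⟨0, Fin.elim0, fun s => s.elim0, by simp⟩
    | zero =>
      obtain ⟨m, t, α, x, rfl⟩ := HasFPRes.exists_sum hR hM η
      refine ⟨m, t, x, fun e he => ?_⟩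
      simp [Ext.sum_push, he]
  | succ k ih =>
    obtain ⟨S, hS, rfl, h2, h1⟩ := hM
    have := h2.projective hR
    cases i with
    | zero =>
      obtain ⟨f, rfl⟩ := Ext.addEquiv₀.symm.surjective η
      obtain ⟨m, t, α, x, hx⟩ := HasFPRes.exists_sum (k := 0) hR h2 (Ext.mk₀ (S.g ≫ f))
      refine ⟨m, t, x, fun e he => ?_⟩
      change (Ext.mk₀ f).push e = Ext.mk₀ f
      have := hS.epi_g
      rw [Ext.mk₀_push]
      congr 1
      rw [← cancel_epi S.g]
      apply Ext.addEquiv₀.symm.injective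
      change Ext.mk₀ _ = Ext.mk₀ _
      rw [← Category.assoc, ← Ext.mk₀_push, hx]
      simp [Ext.sum_push, he]
    | succ i =>
      obtain ⟨η', rfl⟩ := Ext.contravariant_sequence_exact₃ hS _ η (Ext.eq_zero_of_projective _)
        (add_comm 1 i)
      obtain ⟨m, t, g, hg⟩ := ih h1 i η'
      refine ⟨m, t, g, fun e he => ?_⟩
      rw [Ext.comp_push, hg e he]

theorem HasFreeCovers.exists_shortExact (hF : HasFreeCovers R) (X : C) :
    ∃ S : ShortComplex C, S.ShortExact ∧ S.X₃ = X ∧ Projective S.X₂ ∧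
      ∀ (m : ℕ) (t : Fin m → ι) (g : ∀ s, R (t s) ⟶ S.X₂), ∃ (m' : ℕ) (r : Fin m' → ι)
      (a : ∀ k, S.X₂ ⟶ R (r k)) (b : ∀ k, R (r k) ⟶ S.X₂), ∀ s, g s ≫ ∑ k, a k ≫ b k = g s := by
  obtain ⟨F, p, hp, hpr, h⟩ := hF X
  exact ⟨ShortComplex.mk (kernel.ι p) p (kernel.condition p),
    { exact := ShortComplex.exact_kernel p }, rfl, hpr, h⟩

/-- If `Ext^i(M, -)` is effaceable for `i < n`, then Serre duality in degree `n` extends to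
perfect pairings between `Ext^i(M, X)` and `Ext^j(X, T)` for `i + j = n`. -/
theorem IsSerreTrace.existsUnique_class (hR : ∀ i, Projective (R i)) (hF : HasFreeCovers R)
    {n l : ℕ} {M T : C} (hM : HasFPRes R l M)
    (h0 : ∀ i < n, ∀ t, Subsingleton (Ext M (R t) i))
    {t : Ext M T n →ₗ[K] K} (ht : IsSerreTrace K t) {i j : ℕ} (hij : i + j = n) (X : C)
    (ψ : Ext M X i →ₗ[K] K) : ∃! β : Ext X T j, ∀ α : Ext M X i, t (α.comp β hij) = ψ α := by
  induction j generalizing i X with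
  | zero =>
    obtain rfl : i = n := by omega
    obtain ⟨f, hf, hu⟩ := ht X ψ
    refine ⟨Ext.mk₀ f, hf, fun β hβ => ?_⟩
    obtain ⟨g, rfl⟩ := Ext.addEquiv₀.symm.surjective β
    exact congrArg _ (hu g hβ)
  | succ j ih =>
    -- A free presentation of `X` raises `i` and lowers `j`. Since `i < n`, Ext^i(M, -) vanishes on
    -- the free term, so Ext^i(M, X) embeds by the connecting map into Ext^{i+1}(M, S.X₁), and
    -- functionals extend along this embedding.
    obtain ⟨S, hS, rfl, hp, hfree⟩ := hF.exists_shortExact X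
    have h1 : ∀ x : Ext M S.X₂ i, x = 0 := fun x =>
      hM.ext_eq_zero_of_free hR hfree (h0 i (by omega)) x
    have hi : i + 1 + j = n := by omega
    refine existsUnique_of_exists_of_unique ?_ ?_
    · obtain ⟨ψ', hψ'⟩ := LinearMap.exists_dual_comp_eq
        (Ext.postcompₗ K M hS.extClass (rfl : i + 1 = i + 1)) ψ (fun α hα => by
          obtain ⟨x, rfl⟩ := Ext.covariant_sequence_exact₃ M hS α rfl hα
          rw [h1 x, Ext.zero_comp, map_zero])
      obtain ⟨β', hβ', -⟩ := ih hi S.X₁ ψ'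
      refine ⟨hS.extClass.comp β' (add_comm 1 j), fun α => ?_⟩
      rw [← hψ', ← hβ', Ext.postcompₗ_apply, Ext.comp_assoc _ _ _ rfl (add_comm 1 j) (by omega)]
    · suffices H : ∀ β : Ext S.X₃ T (j + 1), (∀ α : Ext M S.X₃ i, t (α.comp β hij) = 0) → β = 0 by
        intro β γ hβ hγ
        rw [← sub_eq_zero]
        apply H
        intro α
        rw [sub_eq_add_neg, Ext.comp_add, Ext.comp_neg, map_add, map_neg, hβ, hγ, add_neg_cancel]
      intro β hβ
      obtain ⟨β', rfl⟩ := Ext.contravariant_sequence_exact₃ hS _ β (Ext.eq_zero_of_projective _)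
        (add_comm 1 j)
      -- Pairing with `β'` kills the image of the connecting map, so it factors through Ext^{i+1}(M,
      -- S.X₂) and is represented there by some `γ`. By uniqueness one degree lower, `β'` is the
      -- restriction of `γ`, and its image under the connecting map is zero.
      obtain ⟨χ, hχ⟩ := LinearMap.exists_dual_comp_eq (Ext.pushₗ K M (i + 1) S.f)
        (t ∘ₗ Ext.postcompₗ K M β' hi) (fun α hα => by
          obtain ⟨x, rfl⟩ := Ext.covariant_sequence_exact₁ M hS α hα rfl
          have := hβ x
          rw [← Ext.comp_assoc _ _ _ rfl (add_comm 1 j) (by omega)] at this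
          exact this)
      obtain ⟨γ, hγ, -⟩ := ih hi S.X₂ χ
      have e1 : Ext.pull S.f γ = β' :=
        (ih hi S.X₁ (t ∘ₗ Ext.postcompₗ K M β' hi)).unique
          (fun α => by rw [← Ext.push_comp, hγ]; exact hχ α) fun α => rfl
      rw [← e1, Ext.pull_def]
      simp

end SerreDuality

/-! ### Objects with local endomorphism rings -/

section LocalEnd

variable {C : Type*} [Category C] [Abelian C]

/-- The endomorphism ring of `X` is local. -/
def HasLocalEnd (X : C) : Prop :=
  𝟙 X ≠ 0 ∧ ∀ f g : X ⟶ X, IsIso (f + g) → IsIso f ∨ IsIso g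

theorem hasLocalEnd_of_isLocalRing (X : C) (h : IsLocalRing (End X)) : HasLocalEnd X := by
  refine ⟨fun h0 => one_ne_zero (α := End X) h0, fun f g hfg => ?_⟩
  let a : End X := f ≫ inv (f + g)
  let b : End X := g ≫ inv (f + g)
  have key : a + b = 1 := by
    change f ≫ inv (f + g) + g ≫ inv (f + g) = 𝟙 X
    rw [← Preadditive.add_comp, IsIso.hom_inv_id]
  rcases h.isUnit_or_isUnit_of_add_one key with h | h
  · left
    have : IsIso (f ≫ inv (f + g)) := (isUnit_iff_isIso _).1 h
    exact IsIso.of_isIso_comp_right f (inv (f + g))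
  · right
    have : IsIso (g ≫ inv (f + g)) := (isUnit_iff_isIso _).1 h
    exact IsIso.of_isIso_comp_right g (inv (f + g))

theorem HasLocalEnd.not_isZero {X : C} (h : HasLocalEnd X) : ¬ IsZero X :=
  fun h0 => h.1 (h0.eq_of_src _ _)

/-- The idempotent `p ≫ s` and its complement add up to the identity, so one of them is invertible.
Invertibility of the complement would force `Y` to be zero. -/
theorem HasLocalEnd.isIso_of_retract {X Y : C} (h : HasLocalEnd X) (p : X ⟶ Y) (s : Y ⟶ X)
    (hs : s ≫ p = 𝟙 Y) (hY : ¬ IsZero Y) : IsIso p := by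
  have : IsSplitEpi p := ⟨⟨s, hs⟩⟩
  have hadd : p ≫ s + (𝟙 X - p ≫ s) = 𝟙 X := by abel
  rcases h.2 (p ≫ s) (𝟙 X - p ≫ s) (by rw [hadd]; infer_instance) with h | h
  · have : Mono p := mono_of_mono p s
    exact isIso_of_mono_of_epi p
  · exfalso
    apply hY
    rw [IsZero.iff_id_eq_zero]
    have : (p ≫ s) ≫ (𝟙 X - p ≫ s) = 0 := by
      rw [Preadditive.comp_sub, Category.comp_id, Category.assoc, reassoc_of% hs, sub_self]
    rw [Preadditive.IsIso.comp_right_eq_zero] at this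
    rw [← Category.id_comp (𝟙 Y), ← hs]
    simp only [Category.assoc]
    rw [← Category.assoc p s p, this]
    simp

theorem HasLocalEnd.indecomposable {X : C} (h : HasLocalEnd X) : Indecomposable X := by
  refine ⟨h.not_isZero, fun Y Z e => ?_⟩
  by_contra! hYZ
  have h1 := h.isIso_of_retract (e.hom ≫ biprod.fst) (biprod.inl ≫ e.inv) (by simp) hYZ.1
  apply hYZ.2
  have : IsIso (biprod.fst : Y ⊞ Z ⟶ Y) := IsIso.of_isIso_comp_left e.hom _
  rw [IsZero.iff_id_eq_zero]
  have h2 : (biprod.inr : Z ⟶ Y ⊞ Z) = 0 := by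
    rw [← cancel_mono (biprod.fst : Y ⊞ Z ⟶ Y)]; simp
  rw [← biprod.inr_snd (X := Y) (Y := Z), h2, zero_comp]

-- The first summand of a Krull–Schmidt decomposition splits off; indecomposability kills its
-- complement, so the inclusion of this summand is an isomorphism and locality transfers.
attribute [local instance] Abelian.hasFiniteBiproducts in
theorem IsKrullSchmidt.hasLocalEnd [HasExt.{u} C] {H : ObjectProperty C} (h : IsKrullSchmidt H)
    {M : C} (hM : H M) (hi : Indecomposable M) : HasLocalEnd M := by
  obtain ⟨m, X, hX, ⟨e⟩⟩ := h M hM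
  cases m with
  | zero =>
    exact (hi.1 (IsZero.of_iso (by
      rw [IsZero.iff_id_eq_zero]; ext j; exact j.elim0) e)).elim
  | succ m =>
    have h0 := hasLocalEnd_of_isLocalRing _ (hX 0).2
    let i : X 0 ⟶ M := biproduct.ι X 0 ≫ e.inv
    let r : M ⟶ X 0 := e.hom ≫ biproduct.π X 0
    have hir : i ≫ r = 𝟙 _ := by simp [i, r]
    have : Mono i := mono_of_mono_fac hir
    let S := ShortComplex.mk i (cokernel.π i) (cokernel.condition i)
    have hS : S.ShortExact := { exact := ShortComplex.exact_cokernel i }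
    let s : S.Splitting := ShortComplex.Splitting.ofExactOfRetraction S hS.exact r hir hS.epi_g
    have hz : IsZero (cokernel i) := (hi.2 _ _ s.isoBinaryBiproduct).resolve_left h0.not_isZero
    have : Epi i := Preadditive.epi_of_cokernel_zero (hz.eq_of_tgt _ _)
    have hiso : IsIso i := isIso_of_mono_of_epi i
    refine ⟨fun h => hi.1 ((IsZero.iff_id_eq_zero _).2 h), fun f g hfg => ?_⟩
    have e1 : (i ≫ f ≫ inv i) + (i ≫ g ≫ inv i) = i ≫ (f + g) ≫ inv i := by simp
    rcases h0.2 (i ≫ f ≫ inv i) (i ≫ g ≫ inv i) (by rw [e1]; infer_instance) with h | h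
    · left
      have := IsIso.of_isIso_comp_left i (f ≫ inv i)
      exact IsIso.of_isIso_comp_right f (inv i)
    · right
      have := IsIso.of_isIso_comp_left i (g ≫ inv i)
      exact IsIso.of_isIso_comp_right g (inv i)

end LocalEnd

/-! ### Almost split extensions from Serre duality -/

section AlmostSplitExt

variable {C : Type*} [Category C] [Abelian C] [HasExt.{u} C] {ι : Type} {R : ι → C}
  {K : Type*} [Field K] [Linear K C]

/-- A Serre trace which also pairs `Hom(M, X)` and `Ext^n(X, T)` perfectly, for all `X`. -/
def IsPerfectTrace {n : ℕ} {M T : C} (t : Ext M T n →ₗ[K] K) : Prop :=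
  IsSerreTrace K t ∧ ∀ (X : C) (ψ : (M ⟶ X) →ₗ[K] K),
    ∃! β : Ext X T n, ∀ f, t (Ext.pull f β) = ψ f

/-- This is `IsSerreTrace.existsUnique_class` at the other extreme i = 0, with Ext^0 rewritten as
Hom. -/
theorem IsSerreTrace.isPerfectTrace (hR : ∀ i, Projective (R i)) (hF : HasFreeCovers R)
    {n l : ℕ} {M T : C} (hM : HasFPRes R l M)
    (h0 : ∀ i < n, ∀ t, Subsingleton (Ext M (R t) i))
    {t : Ext M T n →ₗ[K] K} (ht : IsSerreTrace K t) : IsPerfectTrace t := by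
  refine ⟨ht, fun X ψ => ?_⟩
  obtain ⟨β, hβ, hu⟩ := ht.existsUnique_class hR hF hM h0 (zero_add n) X
    (ψ ∘ₗ (Ext.linearEquiv₀ (R := K)).toLinearMap)
  refine ⟨β, fun f => ?_, fun γ hγ => hu γ fun α => ?_⟩
  · have := hβ (Ext.mk₀ f)
    simp only [LinearMap.coe_comp, Function.comp_apply, LinearEquiv.coe_coe] at this
    rw [Ext.mk₀_comp_eq_pull] at this
    rw [this]
    congr 1
    exact (Ext.linearEquiv₀ (R := K)).symm.injective (by simp)
  · obtain ⟨f, rfl⟩ := (Ext.linearEquiv₀ (R := K)).symm.surjective α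
    simp only [LinearMap.coe_comp, Function.comp_apply, LinearEquiv.coe_coe,
      LinearEquiv.apply_symm_apply]
    exact hγ f

theorem IsPerfectTrace.class_eq_zero {n : ℕ} {M T X : C} {t : Ext M T n →ₗ[K] K}
    (ht : IsPerfectTrace t) {β : Ext X T n} (h : ∀ f : M ⟶ X, t (Ext.pull f β) = 0) : β = 0 :=
  (ht.2 X 0).unique (by simpa using h) (by simp)

/-- The isomorphism between the endomorphism rings of `M` and of its Serre dual. -/
theorem IsPerfectTrace.exists_end_equiv {n : ℕ} {M T : C} {t : Ext M T n →ₗ[K] K}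
    (ht : IsPerfectTrace t) [Module.Finite K (M ⟶ M)] :
    ∃ σ : (M ⟶ M) ≃+ (T ⟶ T), σ (𝟙 M) = 𝟙 T ∧ (∀ e e', σ (e ≫ e') = σ e ≫ σ e') ∧
      ∀ e (β : Ext M T n), t (β.push (σ e)) = t (Ext.pull e β) := by
  -- The endomorphism `σ e` represents the functional `β ↦ t (Ext.pull e β)`; pushing by `σ e` is
  -- adjoint to pulling by `e` under the trace.
  choose σ hσ using fun e : M ⟶ M => (ht.1 T (t ∘ₗ Ext.pullₗ K T n e)).exists
  replace hσ : ∀ e (β : Ext M T n), t (β.push (σ e)) = t (Ext.pull e β) := hσ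
  have hinj : Function.Injective σ := by
    intro e e' he
    by_contra hne
    obtain ⟨χ, hχ⟩ := exists_dual_apply_ne_zero K (sub_ne_zero.2 hne)
    obtain ⟨β, hβ, -⟩ := ht.2 M χ
    apply hχ
    rw [map_sub, ← hβ, ← hβ, ← hσ, ← hσ, he, sub_self]
  have hsurj : Function.Surjective σ := by
    intro w
    -- Ext^n(M, T) is the dual of End M, so the functional attached to `w` lies in the double dual
    -- of End M. Finite dimensionality makes it evaluation at some `e`.
    let B : Ext M T n →ₗ[K] Module.Dual K (M ⟶ M) :=
      LinearMap.mk₂ K (fun β e => t (Ext.pull e β)) (by simp) (by simp) (by simp) (by simp)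
    have hB : Function.Bijective B := by
      rw [Function.bijective_iff_existsUnique]
      intro ψ
      obtain ⟨β, hβ, hu⟩ := ht.2 M ψ
      exact ⟨β, LinearMap.ext hβ, fun γ hγ => hu γ fun f => LinearMap.congr_fun hγ f⟩
    let B' := LinearEquiv.ofBijective B hB
    let e := (Module.evalEquiv K (M ⟶ M)).symm
      (t ∘ₗ Ext.pushₗ K M n w ∘ₗ B'.symm.toLinearMap)
    refine ⟨e, ht.1.eq_of_forall fun β => ?_⟩
    rw [hσ]
    have h1 : (Module.evalEquiv K (M ⟶ M)) e (B β) = t (Ext.pull e β) := rfl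
    rw [← h1, LinearEquiv.apply_symm_apply]
    have : B'.symm (B β) = β := B'.symm_apply_apply β
    simp [this]
  refine ⟨AddEquiv.mk' (Equiv.ofBijective σ ⟨hinj, hsurj⟩) (fun e e' => ?_), ?_, ?_, hσ⟩
  · apply ht.1.eq_of_forall
    intro η
    change t (η.push (σ (e + e'))) = t (η.push (σ e + σ e'))
    simp [hσ]
  · apply ht.1.eq_of_forall
    intro η
    change t (η.push (σ (𝟙 M))) = _
    simp [hσ]
  · intro e e'
    apply ht.1.eq_of_forall
    intro η
    change t (η.push (σ (e ≫ e'))) = t (η.push (σ e ≫ σ e'))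
    rw [hσ, ← Ext.push_push, hσ, ← Ext.pull_push, hσ, Ext.pull_pull]

/-- Locality is a statement about sums and invertibility, both of which are respected in each
direction by the isomorphism of endomorphism rings. -/
theorem IsPerfectTrace.hasLocalEnd {n : ℕ} {M T : C} {t : Ext M T n →ₗ[K] K}
    (ht : IsPerfectTrace t) [Module.Finite K (M ⟶ M)] :
    HasLocalEnd M ↔ HasLocalEnd T := by
  obtain ⟨σ, h1, hmul, -⟩ := ht.exists_end_equiv
  have hiso : ∀ e, IsIso e ↔ IsIso (σ e) := by
    intro e
    constructor
    · intro h
      exact ⟨σ (inv e), by rw [← hmul, IsIso.hom_inv_id, h1], by rw [← hmul, IsIso.inv_hom_id, h1]⟩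
    · intro h
      obtain ⟨e', he'⟩ := σ.surjective (inv (σ e))
      exact ⟨e', σ.injective (by rw [hmul, he', IsIso.hom_inv_id, h1]),
        σ.injective (by rw [hmul, he', IsIso.inv_hom_id, h1])⟩
  unfold HasLocalEnd
  rw [← h1, ← map_zero σ, Ne, Ne, σ.injective.eq_iff]
  refine and_congr Iff.rfl ⟨fun h f g hfg => ?_, fun h f g hfg => ?_⟩
  · obtain ⟨e, rfl⟩ := σ.surjective f
    obtain ⟨e', rfl⟩ := σ.surjective g
    rw [← map_add] at hfg
    rw [← hiso, ← hiso]
    exact h e e' ((hiso _).2 hfg)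
  · rw [hiso, hiso]
    apply h
    rw [← map_add]
    exact (hiso _).1 hfg

/-- A perfect trace on an object with local endomorphism ring yields an almost split
extension, whose pullbacks along all morphisms which are not split epimorphisms vanish, and dually. -/
theorem IsPerfectTrace.exists_almostSplit {n : ℕ} {M T : C} {t : Ext M T n →ₗ[K] K}
    (ht : IsPerfectTrace t) [Module.Finite K (M ⟶ M)] (hM : HasLocalEnd M) :
    ∃ η : Ext M T n, η ≠ 0 ∧ (∀ (X : C) (f : X ⟶ M), ¬ IsSplitEpi f → Ext.pull f η = 0) ∧
      ∀ (Y : C) (g : T ⟶ Y), ¬ IsSplitMono g → η.push g = 0 := by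
  obtain ⟨σ, h1, hmul, hσ⟩ := ht.exists_end_equiv
  -- Locality makes the non-isomorphisms a proper subspace. The class corresponding to a functional
  -- that kills it and not the identity is the required `η`.
  let N : Submodule K (M ⟶ M) :=
    { carrier := {f | ¬ IsIso f}
      zero_mem' := fun h => hM.1 (by
        have h : IsIso (0 : M ⟶ M) := h
        rw [← IsIso.hom_inv_id (0 : M ⟶ M), zero_comp])
      add_mem' := fun {f g} hf hg h => (hM.2 f g h).elim hf hg
      smul_mem' := fun r f hf h => hf (by
        have h : IsIso (r • f) := h
        refine ⟨r • inv (r • f), ?_, ?_⟩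
        · rw [Linear.comp_smul, ← Linear.smul_comp, IsIso.hom_inv_id]
        · rw [Linear.smul_comp, ← Linear.comp_smul, IsIso.inv_hom_id]) }
  have hN : (𝟙 M) ∉ N := fun h => h inferInstance
  obtain ⟨χ, hχ1, hχN⟩ := Submodule.exists_dual_map_eq_bot_of_notMem hN inferInstance
  have hχN : ∀ f : M ⟶ M, ¬ IsIso f → χ f = 0 := fun f hf => by
    have : χ f ∈ N.map χ := ⟨f, hf, rfl⟩
    rw [hχN] at this
    simpa using this
  obtain ⟨η, hη, -⟩ := ht.2 M χ
  refine ⟨η, ?_, ?_, ?_⟩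
  · rintro rfl
    apply hχ1
    rw [← hη]
    simp
  · intro X f hf
    apply ht.class_eq_zero
    -- The pairing of `Ext.pull f η` with `h` is `χ (h ≫ f)`. It vanishes, because an isomorphism `h
    -- ≫ f` would split `f`.
    intro h
    rw [Ext.pull_pull, hη]
    apply hχN
    intro hiso
    exact hf ⟨⟨inv (h ≫ f) ≫ h, by rw [Category.assoc, IsIso.inv_hom_id]⟩⟩
  · intro Y g hg
    apply ht.1.class_eq_zero
    intro h
    -- The same argument on the other side: `g ≫ h` is an endomorphism of `T`, and `σ` turns its
    -- pairing with `η` into a value of `χ` at an endomorphism of `M`.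
    obtain ⟨e, he⟩ := σ.surjective (g ≫ h)
    rw [Ext.push_push, ← he, hσ, hη]
    apply hχN
    intro hiso
    have : IsIso (g ≫ h) := by
      rw [← he]
      exact ⟨σ (inv e), by rw [← hmul, IsIso.hom_inv_id, h1], by rw [← hmul, IsIso.inv_hom_id, h1]⟩
    exact hg ⟨⟨h ≫ inv (g ≫ h), by rw [← Category.assoc, IsIso.hom_inv_id]⟩⟩

end AlmostSplitExt

/-! ### Testing exactness on a dense family -/

section Testing

variable {C : Type*} [Category C] [Abelian C] {ι : Type} {R : ι → C}

theorem IsDenseFamily.epi_of (hR : IsDenseFamily R) {X Y : C} (f : X ⟶ Y)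
    (h : ∀ i (y : R i ⟶ Y), ∃ x : R i ⟶ X, x ≫ f = y) : Epi f := by
  apply Preadditive.epi_of_cokernel_zero
  apply hR.sep
  intro i y
  obtain ⟨x, rfl⟩ := h i y
  simp

theorem IsDenseFamily.mono_of (hR : IsDenseFamily R) {X Y : C} (f : X ⟶ Y)
    (h : ∀ i (x : R i ⟶ X), x ≫ f = 0 → x = 0) : Mono f := by
  apply Preadditive.mono_of_kernel_zero
  apply hR.sep
  intro i x
  exact h i _ (by simp)

theorem IsDenseFamily.exact_of (hR : IsDenseFamily R) (S : ShortComplex C)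
    (h : ∀ i (y : R i ⟶ S.X₂), y ≫ S.g = 0 → ∃ x : R i ⟶ S.X₁, x ≫ S.f = y) : S.Exact := by
  rw [S.exact_iff_epi_kernel_lift]
  apply hR.epi_of
  intro i y
  obtain ⟨x, hx⟩ := h i (y ≫ kernel.ι S.g) (by simp)
  exact ⟨x, by rw [← cancel_mono (kernel.ι S.g)]; simpa using hx⟩

theorem IsDenseFamily.isZero_of (hR : IsDenseFamily R) {X : C}
    (h : ∀ i (x : R i ⟶ X), x = 0) : IsZero X := by
  rw [IsZero.iff_id_eq_zero]
  exact hR.sep _ fun i x => by rw [h i x, zero_comp]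

theorem exists_lift_of_epi (hR : ∀ i, Projective (R i)) {X Y : C} (f : X ⟶ Y) (hf : Epi f) {i : ι}
    (y : R i ⟶ Y) : ∃ x : R i ⟶ X, x ≫ f = y :=
  have := hR i
  ⟨Projective.factorThru y f, Projective.factorThru_comp y f⟩

theorem CategoryTheory.ShortComplex.ShortExact.exists_lift {S : ShortComplex C} (hS : S.ShortExact)
    {X : C} (x : X ⟶ S.X₂) (h : x ≫ S.g = 0) : ∃ y : X ⟶ S.X₁, y ≫ S.f = x :=
  have := hS.mono_f
  ⟨hS.exact.lift x h, hS.exact.lift_f x h⟩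

theorem CategoryTheory.ShortComplex.ShortExact.exists_desc {S : ShortComplex C} (hS : S.ShortExact)
    {X : C} (x : S.X₂ ⟶ X) (h : S.f ≫ x = 0) : ∃ y : S.X₃ ⟶ X, S.g ≫ y = x :=
  have := hS.epi_g
  ⟨hS.exact.desc x h, hS.exact.g_desc x h⟩

/-- The kernels in a horseshoe form a short exact sequence. -/
theorem exists_horseshoe (hR : IsDenseFamily R) {S S₁ S₃ : ShortComplex C} (hS : S.ShortExact)
    (h1 : S₁.ShortExact) (h3 : S₃.ShortExact) (e1 : S₁.X₃ = S.X₁) (e3 : S₃.X₃ = S.X₃)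
    (hp : Projective S₃.X₂) :
    ∃ S₂ S' : ShortComplex C, S₂.ShortExact ∧ S'.ShortExact ∧ S₂.X₃ = S.X₂ ∧
      S₂.X₂ = (S₁.X₂ ⊞ S₃.X₂) ∧ S'.X₁ = S₁.X₁ ∧ S'.X₂ = S₂.X₁ ∧ S'.X₃ = S₃.X₁ := by
  obtain @⟨A, B, D, f, g, w⟩ := S
  obtain @⟨A₁, B₁, D₁, f₁, g₁, w₁⟩ := S₁
  obtain @⟨A₃, B₃, D₃, f₃, g₃, w₃⟩ := S₃
  dsimp only at e1 e3 hp ⊢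
  subst e1 e3
  have := hS.epi_g
  have := h1.epi_g
  have := h3.epi_g
  have := hS.mono_f
  have := h1.mono_f
  have := h3.mono_f
  dsimp only at *
  let l : B₃ ⟶ B := Projective.factorThru g₃ g
  have hl : l ≫ g = g₃ := Projective.factorThru_comp g₃ g
  let q : B₁ ⊞ B₃ ⟶ B := biprod.desc (g₁ ≫ f) l
  have hq : Epi q := by
    apply hR.epi_of
    intro i y
    obtain ⟨z, hz⟩ := exists_lift_of_epi hR.proj g₃ inferInstance (y ≫ g)
    obtain ⟨x, hx⟩ := hS.exists_lift (y - z ≫ l) (by simp [hl, hz])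
    obtain ⟨x', rfl⟩ := exists_lift_of_epi hR.proj g₁ inferInstance x
    refine ⟨biprod.lift x' z, ?_⟩
    dsimp only at hx
    simp only [q, biprod.lift_desc]
    rw [← Category.assoc, hx, sub_add_cancel]
  let a : A₁ ⟶ kernel q := kernel.lift q (f₁ ≫ biprod.inl) (by simp [q, reassoc_of% w₁])
  obtain ⟨b, hb⟩ := h3.exists_lift (kernel.ι q ≫ biprod.snd) (by
    dsimp only
    have h : kernel.ι q ≫ q ≫ g = 0 := by rw [← Category.assoc, kernel.condition, zero_comp]
    have h' : q ≫ g = biprod.snd ≫ g₃ := by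
      ext <;> simp [q, hl, w]
    rw [Category.assoc, ← h', h])
  dsimp only at hb
  have hab : a ≫ b = 0 := by
    rw [← cancel_mono f₃, Category.assoc, hb]
    simp [a]
  refine ⟨ShortComplex.mk (kernel.ι q) q (kernel.condition q), ShortComplex.mk a b hab,
    { exact := ShortComplex.exact_kernel q }, ?_, rfl, rfl, rfl, rfl, rfl⟩
  have ha : Mono a := by
    have : Mono (a ≫ kernel.ι q) := by
      simp only [a, kernel.lift_ι]
      exact mono_comp _ _
    exact mono_of_mono a (kernel.ι q)
  have hbe : Epi b := by
    apply hR.epi_of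
    intro i y
    obtain ⟨x, hx⟩ := hS.exists_lift (y ≫ f₃ ≫ l) (by simp [hl, w₃])
    obtain ⟨x', rfl⟩ := exists_lift_of_epi hR.proj g₁ inferInstance x
    dsimp only at hx
    -- The element `y ≫ f₃` of `B₃` has image in `A`, viewed inside `B`; subtracting a lift of this
    -- image to `B₁` produces an element of the kernel of `q`.
    refine ⟨kernel.lift q (biprod.lift (-x') (y ≫ f₃)) ?_, ?_⟩
    · simp only [q, biprod.lift_desc, Preadditive.neg_comp]
      rw [← Category.assoc, hx]
      simp
    · rw [← cancel_mono f₃, Category.assoc, hb]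
      simp
  refine { exact := ?_ }
  apply hR.exact_of
  intro i y hy
  dsimp only at y hy ⊢
  have h1' : y ≫ kernel.ι q ≫ biprod.snd = 0 := by rw [← hb, ← Category.assoc, hy, zero_comp]
  have h2' : (y ≫ kernel.ι q ≫ biprod.fst) ≫ biprod.inl = y ≫ kernel.ι q := by
    ext
    · simp
    · simp [h1']
  obtain ⟨x, hx⟩ := h1.exists_lift (y ≫ kernel.ι q ≫ biprod.fst) (by
    dsimp only
    rw [← cancel_mono f, zero_comp, Category.assoc]
    have : (biprod.inl : B₁ ⟶ B₁ ⊞ B₃) ≫ q = g₁ ≫ f := by simp [q]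
    rw [← this, ← Category.assoc, h2', Category.assoc, kernel.condition, comp_zero])
  dsimp only at hx
  refine ⟨x, ?_⟩
  rw [← cancel_mono (kernel.ι q)]
  simp only [a, Category.assoc, kernel.lift_ι]
  rw [← Category.assoc, hx, h2']

end Testing

/-! ### Resolutions by finitely generated projective objects -/

section Resolutions

variable {C : Type*} [Category C] [Abelian C] {ι : Type} {R : ι → C}

attribute [local instance] Abelian.hasFiniteBiproducts in
theorem isFinGen_iff (M : C) :
    IsFinGen R M ↔ ∃ (P : C) (p : P ⟶ M), IsFGProj R P ∧ Epi p := by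
  constructor
  · rintro ⟨m, t, p, hp⟩
    refine ⟨_, p, ⟨m, t, fun s => biproduct.π (fun s => R (t s)) s,
      fun s => biproduct.ι (fun s => R (t s)) s, ?_⟩, hp⟩
    exact biproduct.total
  · rintro ⟨P, p, ⟨m, t, e, q, heq⟩, hp⟩
    refine ⟨m, t, biproduct.desc q ≫ p, ?_⟩
    have h : biproduct.lift e ≫ biproduct.desc q = 𝟙 P := by rw [biproduct.lift_desc, heq]
    have : Epi (biproduct.desc q) := epi_of_epi_fac h
    exact epi_comp _ _

theorem IsFGProj.isFinGen {P : C} (h : IsFGProj R P) : IsFinGen R P :=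
  (isFinGen_iff P).2 ⟨P, 𝟙 P, h, inferInstance⟩

theorem IsFinGen.of_epi {M N : C} (h : IsFinGen R M) (f : M ⟶ N) (hf : Epi f) : IsFinGen R N := by
  obtain ⟨m, t, p, hp⟩ := h
  exact ⟨m, t, p ≫ f, epi_comp _ _⟩

theorem IsFinGen.isFGProj {P : C} (h : IsFinGen R P) (hP : Projective P) : IsFGProj R P := by
  obtain ⟨Q, p, hQ, hp⟩ := (isFinGen_iff P).1 h
  exact isFGProj_of_retract hQ (Projective.factorThru (𝟙 P) p) p (Projective.factorThru_comp _ _)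

/-- `M` has a resolution by finitely generated projective objects. -/
def HasFPResInf (R : ι → C) (M : C) : Prop :=
  ∃ 𝒬 : C → Prop, 𝒬 M ∧ ∀ X, 𝒬 X → ∃ S : ShortComplex C, S.ShortExact ∧ S.X₃ = X ∧
    IsFGProj R S.X₂ ∧ 𝒬 S.X₁

theorem HasFPResInf.exists_shortExact {M : C} (h : HasFPResInf R M) :
    ∃ S : ShortComplex C, S.ShortExact ∧ S.X₃ = M ∧ IsFGProj R S.X₂ ∧ HasFPResInf R S.X₁ := by
  obtain ⟨𝒬, hM, h⟩ := h
  obtain ⟨S, hS, h3, h2, h1⟩ := h M hM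
  exact ⟨S, hS, h3, h2, 𝒬, h1, h⟩

/-- Infinite resolvability is a greatest fixed point. This is coinduction in the form where a syzygy
may also leave the class `𝒬` for an object already known to be resolved. -/
theorem hasFPResInf_of_coinduction (𝒬 : C → Prop) (h : ∀ X, 𝒬 X → ∃ S : ShortComplex C,
    S.ShortExact ∧ S.X₃ = X ∧ IsFGProj R S.X₂ ∧ (𝒬 S.X₁ ∨ HasFPResInf R S.X₁)) {M : C} (hM : 𝒬 M) :
    HasFPResInf R M := by
  refine ⟨fun X => 𝒬 X ∨ HasFPResInf R X, .inl hM, ?_⟩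
  rintro X (hX | hX)
  · exact h X hX
  · obtain ⟨S, hS, h3, h2, h1⟩ := hX.exists_shortExact
    exact ⟨S, hS, h3, h2, .inr h1⟩

-- A finite resolution is continued by zeros: the last projective covers itself.
open scoped ZeroObject in
theorem HasFPRes.hasFPResInf {k : ℕ} {M : C} (h : HasFPRes R k M) : HasFPResInf R M := by
  refine hasFPResInf_of_coinduction (fun X => ∃ k, HasFPRes R k X) ?_ ⟨k, h⟩
  rintro X ⟨k, hX⟩
  cases k with
  | zero =>
    refine ⟨ShortComplex.mk (0 : (0 : C) ⟶ X) (𝟙 X) (by simp), ?_, rfl, hX,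
      .inl ⟨0, isFGProj_of_isZero (isZero_zero C)⟩⟩
    exact (ShortComplex.Splitting.mk (S := ShortComplex.mk (0 : (0 : C) ⟶ X) (𝟙 X) (by simp)) 0
      (𝟙 X) ((isZero_zero C).eq_of_src _ _) (by simp) (by simp)).shortExact
  | succ k =>
    obtain ⟨S, hS, h3, h2, h1⟩ := hX
    exact ⟨S, hS, h3, h2, .inl ⟨k, h1⟩⟩

/-- The k-th syzygy is projective by the dimension bound and finitely generated, so the resolution
may be cut off there. -/
theorem HasFPResInf.hasFPRes (hR : ∀ i, Projective (R i)) {k : ℕ} {M : C} (h : HasFPResInf R M)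
    (hM : HasProjectiveDimensionLT M (k + 1)) : HasFPRes R k M := by
  induction k generalizing M with
  | zero =>
    obtain ⟨S, hS, rfl, h2, -⟩ := h.exists_shortExact
    exact (h2.isFinGen.of_epi S.g hS.epi_g).isFGProj inferInstance
  | succ k ih =>
    obtain ⟨S, hS, rfl, h2, h1⟩ := h.exists_shortExact
    have := h2.projective hR
    exact ⟨S, hS, rfl, h2, ih h1 (hS.hasProjectiveDimensionLT_X₁ (k + 1) inferInstance hM)⟩

/-- By the horseshoe, the class of extensions of two resolved objects is stable under taking a
suitable syzygy, so coinduction applies. -/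
theorem HasFPResInf.of_shortExact (hR : IsDenseFamily R) {S : ShortComplex C} (hS : S.ShortExact)
    (h1 : HasFPResInf R S.X₁) (h3 : HasFPResInf R S.X₃) : HasFPResInf R S.X₂ := by
  refine hasFPResInf_of_coinduction (fun X => ∃ S : ShortComplex C, S.ShortExact ∧ S.X₂ = X ∧
    HasFPResInf R S.X₁ ∧ HasFPResInf R S.X₃) ?_ ⟨S, hS, rfl, h1, h3⟩
  rintro X ⟨S, hS, rfl, h1, h3⟩
  obtain ⟨S₁, hS₁, e1, hp1, hk1⟩ := h1.exists_shortExact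
  obtain ⟨S₃, hS₃, e3, hp3, hk3⟩ := h3.exists_shortExact
  obtain ⟨S₂, S', hS₂, hS', e, e2, a, b, c⟩ :=
    exists_horseshoe hR hS hS₁ hS₃ e1 e3 (hp3.projective hR.proj)
  refine ⟨S₂, hS₂, e, ?_, .inl ⟨S', hS', b, ?_, ?_⟩⟩
  · rw [e2]; exact isFGProj_biprod hp1 hp3
  · rw [a]; exact hk1
  · rw [c]; exact hk3

theorem hasFPResInf_of_step {S : ShortComplex C} (hS : S.ShortExact)
    (h2 : IsFGProj R S.X₂) (h1 : HasFPResInf R S.X₁) : HasFPResInf R S.X₃ :=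
  hasFPResInf_of_coinduction (fun X => X = S.X₃)
    (by rintro _ rfl; exact ⟨S, hS, rfl, h2, .inr h1⟩) rfl

/-- The kernel `L` of a composition `P ⟶ M ⟶ U` of epimorphisms is an extension. -/
theorem exists_shortExact_comp (hR : IsDenseFamily R) {S S' : ShortComplex C} (hS : S.ShortExact)
    (hS' : S'.ShortExact) (e : S.X₃ = S'.X₂) :
    ∃ T T' : ShortComplex C, T.ShortExact ∧ T'.ShortExact ∧ T.X₂ = S.X₂ ∧ T.X₃ = S'.X₃ ∧
      T'.X₁ = S.X₁ ∧ T'.X₂ = T.X₁ ∧ T'.X₃ = S'.X₁ := by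
  obtain @⟨K, P, M, f, g, w⟩ := S
  obtain @⟨A, B, U, f', g', w'⟩ := S'
  dsimp only at e ⊢
  subst e
  have := hS.epi_g
  have := hS.mono_f
  have := hS'.epi_g
  have := hS'.mono_f
  dsimp only at *
  let a : K ⟶ kernel (g ≫ g') := kernel.lift _ f (by rw [reassoc_of% w, zero_comp])
  obtain ⟨b, hb⟩ := hS'.exists_lift (kernel.ι (g ≫ g') ≫ g)
    (by dsimp only; rw [Category.assoc, kernel.condition])
  dsimp only at hb
  have hab : a ≫ b = 0 := by
    rw [← cancel_mono f', Category.assoc, hb]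
    simp [a, w]
  refine ⟨ShortComplex.mk _ _ (kernel.condition (g ≫ g')), ShortComplex.mk a b hab,
    { exact := ShortComplex.exact_kernel _, epi_g := epi_comp _ _ }, ?_, rfl, rfl, rfl, rfl, rfl⟩
  have ha : Mono a := by
    have : Mono (a ≫ kernel.ι (g ≫ g')) := by
      simp only [a, kernel.lift_ι]
      infer_instance
    exact mono_of_mono a (kernel.ι _)
  have hbe : Epi b := by
    apply hR.epi_of
    intro i y
    obtain ⟨x, hx⟩ := exists_lift_of_epi hR.proj g inferInstance (y ≫ f')
    refine ⟨kernel.lift _ x (by rw [← Category.assoc, hx, Category.assoc, w', comp_zero]), ?_⟩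
    rw [← cancel_mono f', Category.assoc, hb]
    simpa using hx
  refine { exact := ?_ }
  apply hR.exact_of
  intro i y hy
  dsimp only at y hy ⊢
  obtain ⟨x, hx⟩ := hS.exists_lift (y ≫ kernel.ι (g ≫ g')) (by
    dsimp only
    rw [Category.assoc, ← hb, ← Category.assoc, hy, zero_comp])
  refine ⟨x, ?_⟩
  rw [← cancel_mono (kernel.ι (g ≫ g'))]
  simpa [a] using hx

/-- Compose a finitely generated projective cover of the middle term with the projection. The kernel
of the composite is an extension of `S.X₁` by a syzygy of `S.X₂`, hence resolved. -/
theorem HasFPResInf.of_cokernel (hR : IsDenseFamily R) {S : ShortComplex C} (hS : S.ShortExact)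
    (h1 : HasFPResInf R S.X₁) (h2 : HasFPResInf R S.X₂) : HasFPResInf R S.X₃ := by
  obtain ⟨S₀, hS₀, e0, hp, hk⟩ := h2.exists_shortExact
  obtain ⟨T, T', hT, hT', a, b, c, d, e⟩ := exists_shortExact_comp hR hS₀ hS e0
  rw [← b]
  refine hasFPResInf_of_step hT (by rw [a]; exact hp) ?_
  rw [← d]
  exact HasFPResInf.of_shortExact hR hT' (by rw [c]; exact hk) (by rw [e]; exact h1)

/-- Objects resolved by the terms of an exact sequence of finitely generated projectives. -/
theorem hasFPResInf_of_exact {X : C} (P : ℕ → C) (d : ∀ k, P (k + 1) ⟶ P k) (ε : P 0 ⟶ X)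
    (hP : ∀ k, IsFGProj R (P k)) (hε : Epi ε) (w0 : d 0 ≫ ε = 0)
    (h0 : (ShortComplex.mk _ _ w0).Exact) (w : ∀ k, d (k + 1) ≫ d k = 0)
    (h : ∀ k, (ShortComplex.mk _ _ (w k)).Exact) : HasFPResInf R X := by
  refine hasFPResInf_of_coinduction (fun X => ∃ (P : ℕ → C) (d : ∀ k, P (k + 1) ⟶ P k)
    (ε : P 0 ⟶ X), (∀ k, IsFGProj R (P k)) ∧ Epi ε ∧ (∃ w0 : d 0 ≫ ε = 0,
    (ShortComplex.mk _ _ w0).Exact) ∧ ∀ k, ∃ w : d (k + 1) ≫ d k = 0,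
    (ShortComplex.mk _ _ w).Exact) ?_ ⟨P, d, ε, hP, hε, ⟨w0, h0⟩, fun k => ⟨w k, h k⟩⟩
  rintro X ⟨P, d, ε, hP, hε, ⟨w0, h0⟩, h⟩
  refine ⟨ShortComplex.mk (kernel.ι ε) ε (kernel.condition ε),
    { exact := ShortComplex.exact_kernel ε }, rfl, hP 0, .inl
    ⟨fun k => P (k + 1), fun k => d (k + 1), kernel.lift ε (d 0) w0, fun k => hP (k + 1),
      (ShortComplex.exact_iff_epi_kernel_lift _).1 h0, ?_, fun k => h (k + 1)⟩⟩
  obtain ⟨w, h⟩ := h 0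
  have w' : d 1 ≫ kernel.lift ε (d 0) w0 = 0 := by
    rw [← cancel_mono (kernel.ι ε)]
    simpa using w
  refine ⟨w', ?_⟩
  let φ : ShortComplex.mk _ _ w' ⟶ ShortComplex.mk _ _ w :=
    { τ₁ := 𝟙 _, τ₂ := 𝟙 _, τ₃ := kernel.ι ε }
  have : Epi φ.τ₁ := by dsimp [φ]; infer_instance
  have : IsIso φ.τ₂ := by dsimp [φ]; infer_instance
  have : Mono φ.τ₃ := by dsimp [φ]; infer_instance
  exact (ShortComplex.exact_iff_of_epi_of_isIso_of_mono φ).2 h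

theorem hasFPResInf_of_projectiveResolution {M : C} (P : ProjectiveResolution M)
    (hP : ∀ i, IsFinGen R (P.complex.X i)) : HasFPResInf R M := by
  let ε : P.complex.X 0 ⟶ M := P.π.f 0
  have hε : Epi ε := by
    have : Epi (P.π.f 0) := inferInstance
    exact this
  have w0 : P.complex.d 1 0 ≫ ε = 0 := P.complex_d_comp_π_f_zero
  refine hasFPResInf_of_exact (fun k => P.complex.X k) (fun k => P.complex.d (k + 1) k) ε
    (fun k => (hP k).isFGProj (P.projective k)) hε w0 P.exact₀ (fun k => P.complex.d_comp_d _ _ _)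
    (fun k => P.exact_succ k)

end Resolutions

/-! ### Splicing resolutions, and a working description of `HCat` -/

section ToResolution

variable {C : Type*} [Category C] [Abelian C] {ι : Type} {R : ι → C}

theorem HasFPResInf.exists_sequence {M : C} (h : HasFPResInf R M) :
    ∃ (X P : ℕ → C) (f : ∀ k, X (k + 1) ⟶ P k) (g : ∀ k, P k ⟶ X k) (w : ∀ k, f k ≫ g k = 0),
      X 0 = M ∧ ∀ k, (ShortComplex.mk _ _ (w k)).ShortExact ∧ IsFGProj R (P k) := by
  obtain ⟨𝒬, hM, h⟩ := h
  have h' : ∀ X : {X // 𝒬 X}, ∃ (L : {X // 𝒬 X}) (P : C) (f : L.1 ⟶ P) (g : P ⟶ X.1)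
      (w : f ≫ g = 0), (ShortComplex.mk _ _ w).ShortExact ∧ IsFGProj R P := by
    rintro ⟨X, hX⟩
    obtain ⟨S, hS, rfl, h2, h1⟩ := h X hX
    exact ⟨⟨S.X₁, h1⟩, S.X₂, S.f, S.g, S.zero, hS, h2⟩
  choose L P f g w hw using h'
  let X : ℕ → {X // 𝒬 X} := fun k => Nat.rec ⟨M, hM⟩ (fun _ X => L X) k
  exact ⟨fun k => (X k).1, fun k => P (X k), fun k => f (X k), fun k => g (X k), fun k => w (X k),
    rfl, fun k => hw (X k)⟩

/-- Precomposing with an epimorphism does not change the image, and postcomposing with a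
monomorphism does not change the kernel. -/
theorem exact_splice {X Y Z : C} {A B : C} (p : X ⟶ A) (i : A ⟶ Y) (q : Y ⟶ B) (j : B ⟶ Z)
    (hp : Epi p) (hj : Mono j) (w : i ≫ q = 0) (h : (ShortComplex.mk i q w).Exact)
    (w' : (p ≫ i) ≫ q ≫ j = 0) : (ShortComplex.mk (p ≫ i) (q ≫ j) w').Exact := by
  have w1 : i ≫ q ≫ j = 0 := by rw [reassoc_of% w, zero_comp]
  let φ : ShortComplex.mk (p ≫ i) (q ≫ j) w' ⟶ ShortComplex.mk i (q ≫ j) w1 :=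
    { τ₁ := p, τ₂ := 𝟙 _, τ₃ := 𝟙 _ }
  have : Epi φ.τ₁ := hp
  have : IsIso φ.τ₂ := by dsimp [φ]; infer_instance
  have : Mono φ.τ₃ := by dsimp [φ]; infer_instance
  rw [ShortComplex.exact_iff_of_epi_of_isIso_of_mono φ]
  let ψ : ShortComplex.mk i q w ⟶ ShortComplex.mk i (q ≫ j) w1 :=
    { τ₁ := 𝟙 _, τ₂ := 𝟙 _, τ₃ := j }
  have : Epi ψ.τ₁ := by dsimp [ψ]; infer_instance
  have : IsIso ψ.τ₂ := by dsimp [ψ]; infer_instance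
  have : Mono ψ.τ₃ := hj
  exact (ShortComplex.exact_iff_of_epi_of_isIso_of_mono ψ).1 h

/-- The differentials are the composites through consecutive syzygies, and exactness is
`exact_splice` in every degree. -/
theorem HasFPResInf.exists_projectiveResolution (hR : ∀ i, Projective (R i)) {M : C}
    (h₀ : HasFPResInf R M) :
    ∃ P : ProjectiveResolution M, ∀ i, IsFinGen R (P.complex.X i) := by
  obtain ⟨X, P, f, g, w, rfl, h⟩ := h₀.exists_sequence
  have := fun k => (h k).1.mono_f
  have := fun k => (h k).1.epi_g
  dsimp only at *
  have sq : ∀ k, (g (k + 2) ≫ f (k + 1)) ≫ g (k + 1) ≫ f k = 0 := fun k => by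
    rw [Category.assoc, reassoc_of% w (k + 1), zero_comp, comp_zero]
  let Q : ChainComplex C ℕ := ChainComplex.of P (fun k => g (k + 1) ≫ f k) sq
  have hd : ∀ k, Q.d (k + 1) k = g (k + 1) ≫ f k := fun k => ChainComplex.of_d (X := P) (d := fun k => g (k + 1) ≫ f k) k
  have hex : ∀ n, Q.ExactAt (n + 1) := by
    intro n
    rw [HomologicalComplex.exactAt_iff' _ (n + 1 + 1) (n + 1) n (by simp) (by simp)]
    have := exact_splice (g (n + 2)) (f (n + 1)) (g (n + 1)) (f n) inferInstance inferInstance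
      (w (n + 1)) (h (n + 1)).1.exact (sq n)
    refine (ShortComplex.exact_iff_of_iso ?_).2 this
    exact ShortComplex.isoMk (Iso.refl _) (Iso.refl _) (Iso.refl _)
      ((Category.id_comp _).trans ((hd (n + 1)).symm.trans (Category.comp_id _).symm))
      ((Category.id_comp _).trans ((hd n).symm.trans (Category.comp_id _).symm))
  have hg0 : Q.d 1 0 ≫ g 0 = 0 := by rw [hd, Category.assoc, w, comp_zero]
  have hex0 : (ShortComplex.mk _ _ hg0).Exact := by
    have := exact_splice (g 1) (f 0) (g 0) (𝟙 _) inferInstance inferInstance (w 0) (h 0).1.exact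
      (by simp [w])
    refine (ShortComplex.exact_iff_of_iso ?_).2 this
    exact ShortComplex.isoMk (Iso.refl _) (Iso.refl _) (Iso.refl _)
      (by simpa using (hd 0).symm) (by simp)
  have h0 := fun hg : Q.d 1 0 ≫ g 0 = 0 =>
    ChainComplex.toSingle₀Equiv_symm_apply_f_zero (C := Q) (X := X 0) (g 0) hg
  refine ⟨{ complex := Q
            projective := fun n => (h n).2.projective hR
            π := (ChainComplex.toSingle₀Equiv _ _).symm ⟨g 0, hg0⟩
            quasiIso := ⟨fun n => ?_⟩ }, fun i => (h i).2.isFinGen⟩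
  cases n
  · rw [ChainComplex.quasiIsoAt₀_iff, ShortComplex.quasiIso_iff_of_zeros']
    · refine (ShortComplex.exact_and_epi_g_iff_of_iso ?_).2
          ⟨hex0, by dsimp; infer_instance⟩
      exact ShortComplex.isoMk (Iso.refl _) (Iso.refl _) (Iso.refl _)
          ((Category.id_comp _).trans (Category.comp_id _).symm)
          ((Category.id_comp _).trans (Eq.trans (h0 _).symm (Category.comp_id _).symm))
    all_goals rfl
  · rw [quasiIsoAt_iff_exactAt']
    · apply hex
    · apply ChainComplex.exactAt_succ_single_obj

variable [HasExt.{u} C]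

theorem HasFPRes.hasProjectiveDimensionLT (hR : ∀ i, Projective (R i)) {k : ℕ} {M : C}
    (h : HasFPRes R k M) : HasProjectiveDimensionLT M (k + 1) := by
  induction k generalizing M with
  | zero =>
    have := IsFGProj.projective hR h
    infer_instance
  | succ k ih =>
    obtain ⟨S, hS, rfl, h2, h1⟩ := h
    have := h2.projective hR
    exact hS.hasProjectiveDimensionLT_X₃ (k + 1) (ih h1) inferInstance

theorem HasFPRes.ext_eq_zero (hR : ∀ i, Projective (R i)) {k : ℕ} {M : C} (h : HasFPRes R k M)
    (h0 : ∀ t, Subsingleton (Ext M (R t) k)) {X : C} (η : Ext M X k) : η = 0 := by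
  obtain ⟨m, t, α, x, rfl⟩ := h.exists_sum hR η
  refine Finset.sum_eq_zero fun s _ => ?_
  rw [(h0 _).elim (α s) 0, Ext.zero_push]

/-- An object with a finite resolution by finitely generated projectives is zero if all its
extension groups with values in `R` vanish. -/
theorem HasFPRes.isZero (hR : ∀ i, Projective (R i)) {k : ℕ} {M : C} (h : HasFPRes R k M)
    (h0 : ∀ i ≤ k, ∀ t, Subsingleton (Ext M (R t) i)) : IsZero M := by
  induction k generalizing M with
  | zero =>
    rw [IsZero.iff_id_eq_zero]
    apply Ext.addEquiv₀.symm.injective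
    rw [h.ext_eq_zero hR (h0 0 le_rfl) (Ext.addEquiv₀.symm (𝟙 M)), map_zero]
  | succ k ih =>
    -- Vanishing of the top Ext on `R` gives its vanishing on every object, since classes valued in
    -- `R` generate. The projective dimension drops and the resolution can be shortened.
    refine ih (h.hasFPResInf.hasFPRes hR ?_) fun i hi => h0 i (by omega)
    refine HasProjectiveDimensionLT.mk fun i hi Y e => ?_
    rcases hi.eq_or_lt with rfl | hi
    · exact h.ext_eq_zero hR (h0 _ le_rfl) e
    · have := h.hasProjectiveDimensionLT hR
      exact e.eq_zero_of_hasProjectiveDimensionLT (k + 2) hi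

/-- The objects of `H^n`, if all projective dimensions are at most `n`. -/
theorem hCat_iff (hR : ∀ i, Projective (R i)) {n : ℕ} (hn : ∀ X : C, HasProjectiveDimensionLT X (n + 1))
    (M : C) : HCat R n M ↔ HasFPRes R n M ∧ (∀ i < n, ∀ t, Subsingleton (Ext M (R t) i)) ∧
      ¬ IsZero M := by
  constructor
  · rintro ⟨hpd, hext, P, hP⟩
    refine ⟨(hasFPResInf_of_projectiveResolution P hP).hasFPRes hR (hn M),
      fun i hi t => hext i hi.ne t, fun h => ?_⟩
    rw [(projectiveDimension_eq_bot_iff M).2 h] at hpd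
    exact absurd hpd (WithBot.bot_ne_coe)
  · rintro ⟨hres, hext, hM⟩
    refine ⟨le_antisymm ((projectiveDimension_le_iff M n).2 (hn M))
      ((projectiveDimension_ge_iff M n).2 fun h => hM ?_), fun i hi t => ?_,
      hres.hasFPResInf.exists_projectiveResolution hR⟩
    · refine hres.isZero hR fun i hi t => ?_
      rcases hi.lt_or_eq with hi | rfl
      · exact hext i hi t
      · exact HasProjectiveDimensionLT.subsingleton M i i le_rfl _
    · rcases hi.lt_or_gt with hi | hi
      · exact hext i hi t
      · have := hn M
        exact HasProjectiveDimensionLT.subsingleton M (n + 1) i hi _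

theorem hasProjectiveDimensionLT_of_globalDim {n : ℕ} (h : globalDim C = n) (X : C) :
    HasProjectiveDimensionLT X (n + 1) := by
  rw [← HasProjectiveDimensionLE, ← projectiveDimension_le_iff, ← h]
  exact le_iSup projectiveDimension X

/-- `Ext^n` is right exact if all projective dimensions are at most `n`. -/
theorem exists_pull_eq {n : ℕ} (hn : ∀ X : C, HasProjectiveDimensionLT X (n + 1))
    {S : ShortComplex C} (hS : S.ShortExact) {Y : C} (β : Ext S.X₁ Y n) :
    ∃ α : Ext S.X₂ Y n, Ext.pull S.f α = β :=
  Ext.contravariant_sequence_exact₁ hS Y β (add_comm 1 n)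
    ((hS.extClass.comp β _).eq_zero_of_pd (hn _) le_rfl)

end ToResolution

/-! ### Opposite families and dual objects -/

section Opposite

variable (K : Type*) [Field K] {C C' : Type*} [Category C] [Abelian C] [Linear K C]
  [Category C'] [Abelian C'] [Linear K C'] {ι : Type}

/-- An identification of the full subcategory on the family `R'` with the opposite of the full
subcategory on `R`. -/
structure OppositeFamilies (R : ι → C) (R' : ι → C') where
  op (i j : ι) : (R i ⟶ R j) ≃ₗ[K] (R' j ⟶ R' i)
  op_comp {i j k : ι} (a : R i ⟶ R j) (b : R j ⟶ R k) : op i k (a ≫ b) = op j k b ≫ op i j a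

variable {K} {R : ι → C} {R' : ι → C'}

/-- The roles of the two families are symmetric. -/
def OppositeFamilies.symm (o : OppositeFamilies K R R') : OppositeFamilies K R' R where
  op i j := (o.op j i).symm
  op_comp a b := (o.op _ _).injective (by simp [o.op_comp])

@[simp] theorem OppositeFamilies.symm_op (o : OppositeFamilies K R R') (i j : ι) :
    o.symm.op i j = (o.op j i).symm := rfl

/-- `X` is the dual of `N`, tested on the families `R` and `R'`. -/
structure DualPairing (o : OppositeFamilies K R R') (X : C) (N : C') where
  w (i : ι) : (R i ⟶ X) ≃ₗ[K] ((R' i ⟶ N) →ₗ[K] K)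
  nat {i j : ι} (a : R i ⟶ R j) (x : R j ⟶ X) (y : R' i ⟶ N) :
    w i (a ≫ x) y = w j x (o.op i j a ≫ y)

/-- Finite dimensional objects. -/
structure IsFinDim (K : Type*) [Field K] {C : Type*} [Category C] [Abelian C] [Linear K C]
    (R : ι → C) (X : C) : Prop where
  finite : ∀ i, Module.Finite K (R i ⟶ X)
  support : ∃ s : Finset ι, ∀ i ∉ s, ∀ x : R i ⟶ X, x = 0

namespace DualPairing

variable {o : OppositeFamilies K R R'}

theorem ext_of {X : C} {N : C'} (p : DualPairing o X N) {i : ι} {x x' : R i ⟶ X}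
    (h : ∀ y, p.w i x y = p.w i x' y) : x = x' :=
  (p.w i).injective (LinearMap.ext h)

theorem eq_zero_of {X : C} {N : C'} (p : DualPairing o X N) {i : ι} {y : R' i ⟶ N}
    (h : ∀ x, p.w i x y = 0) : y = 0 := by
  by_contra hy
  obtain ⟨χ, hχ⟩ := exists_dual_apply_ne_zero K hy
  obtain ⟨x, rfl⟩ := (p.w i).surjective χ
  exact hχ (h x)

/-- Locally finite objects are reflexive. -/
noncomputable def symm {X : C} {N : C'} (p : DualPairing o X N)
    (h : ∀ i, Module.Finite K (R' i ⟶ N)) : DualPairing o.symm N X where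
  w i := (have := h i; Module.evalEquiv K (R' i ⟶ N)).trans (p.w i).dualMap
  nat {i j} a y x := by
    have := p.nat (o.symm.op i j a) x y
    simp only [OppositeFamilies.symm_op, LinearEquiv.apply_symm_apply] at this
    exact this.symm

theorem finite {X : C} {N : C'} (p : DualPairing o X N) (i : ι) :
    Module.Finite K (R' i ⟶ N) ↔ Module.Finite K (R i ⟶ X) := by
  constructor
  · intro h
    exact Module.Finite.equiv (p.w i).symm
  · intro h
    have : Module.Finite K (Module.Dual K (R' i ⟶ N)) := Module.Finite.equiv (p.w i)
    exact Module.finite_dual_iff K |>.1 this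

theorem isFinDim_iff {X : C} {N : C'} (p : DualPairing o X N) :
    IsFinDim K R' N ↔ IsFinDim K R X := by
  constructor
  · rintro ⟨h, s, hs⟩
    exact ⟨fun i => (p.finite i).1 (h i), s, fun i hi x => p.ext_of fun y => by simp [hs i hi y]⟩
  · rintro ⟨h, s, hs⟩
    exact ⟨fun i => (p.finite i).2 (h i), s, fun i hi x => p.eq_zero_of fun y => by simp [hs i hi y]⟩

theorem isZero_iff (hR : IsDenseFamily R) (hR' : IsDenseFamily R') {X : C} {N : C'}
    (p : DualPairing o X N) : IsZero X ↔ IsZero N :=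
  ⟨fun h => hR'.isZero_of fun i y => p.eq_zero_of fun x => by simp [h.eq_of_tgt x 0],
    fun h => hR.isZero_of fun i x => p.ext_of fun y => by simp [h.eq_of_tgt y 0]⟩

/-- Duality is functorial. -/
theorem exists_map (hR : IsDenseFamily R) {X X₁ : C} {N N₁ : C'} (p : DualPairing o X N)
    (p₁ : DualPairing o X₁ N₁) (g : N ⟶ N₁) :
    ∃ f : X₁ ⟶ X, ∀ i (x : R i ⟶ X₁) y, p.w i (x ≫ f) y = p₁.w i x (y ≫ g) := by
  let c : ∀ i, (R i ⟶ X₁) → (R i ⟶ X) := fun i x =>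
    (p.w i).symm (p₁.w i x ∘ₗ Linear.rightComp K (R' i) g)
  have hc : ∀ i x y, p.w i (c i x) y = p₁.w i x (y ≫ g) := fun i x y => by simp [c]
  obtain ⟨f, hf⟩ := hR.glue c (fun i x y => p.ext_of fun z => by simp [hc]) (fun i j a x =>
    p.ext_of fun z => by simp [hc, nat])
  exact ⟨f, fun i x y => by rw [hf, hc]⟩

/-- Morphisms into a dual are balanced pairings, hence correspond to morphisms into the other
dual. -/
theorem exists_adjoint (hR' : IsDenseFamily R') {X M : C} {N L : C'} (p : DualPairing o X N)
    (q : DualPairing o.symm L M) (f : M ⟶ X) :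
    ∃ g : N ⟶ L, ∀ i (m : R i ⟶ M) y, q.w i (y ≫ g) m = p.w i (m ≫ f) y := by
  let c : ∀ i, (R' i ⟶ N) → (R' i ⟶ L) := fun i y =>
    (q.w i).symm ((p.w i).toLinearMap.flip y ∘ₗ Linear.rightComp K (R i) f)
  have hc : ∀ i m y, q.w i (c i y) m = p.w i (m ≫ f) y := fun i x y => by simp [c]
  obtain ⟨g, hg⟩ := hR'.glue c (fun i x y => q.ext_of fun z => by simp [hc])
    (fun i j a x => q.ext_of fun z => by
      rw [hc, nat, hc, Category.assoc, nat]
      simp)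
  exact ⟨g, fun i x y => by rw [hg, hc]⟩

theorem exists_adjoint_symm (hR : IsDenseFamily R) {X M : C} {N L : C'} (p : DualPairing o X N)
    (q : DualPairing o.symm L M) (g : N ⟶ L) :
    ∃ f : M ⟶ X, ∀ i (m : R i ⟶ M) y, q.w i (y ≫ g) m = p.w i (m ≫ f) y := by
  obtain ⟨f, hf⟩ := exists_adjoint (o := o.symm) hR q p g
  exact ⟨f, fun i m y => (hf i y m).symm⟩

section Exact

variable {X X₁ : C} {N N₁ : C'} (p : DualPairing o X N) (p₁ : DualPairing o X₁ N₁) {g : N ⟶ N₁}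
  {f : X₁ ⟶ X} (h : ∀ i (x : R i ⟶ X₁) y, p.w i (x ≫ f) y = p₁.w i x (y ≫ g))

include h

theorem mono_of_epi (hR : IsDenseFamily R) (hR' : IsDenseFamily R') (hg : Epi g) : Mono f := by
  apply hR.mono_of
  intro i x hx
  apply p₁.ext_of
  intro y
  obtain ⟨z, rfl⟩ := exists_lift_of_epi hR'.proj g hg y
  rw [← h, hx]
  simp

theorem epi_of_mono (hR : IsDenseFamily R) (hg : Mono g) : Epi f := by
  apply hR.epi_of
  intro i x
  -- Probing with `R' i` keeps `g` injective, and functionals extend along injections of vector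
  -- spaces.
  obtain ⟨χ, hχ⟩ := LinearMap.exists_dual_comp_eq (Linear.rightComp K (R' i) g) (p.w i x)
    (fun y hy => by
      have : y = 0 := by rw [← cancel_mono g]; simpa using hy
      simp [this])
  refine ⟨(p₁.w i).symm χ, p.ext_of fun y => ?_⟩
  rw [h, LinearEquiv.apply_symm_apply]
  exact hχ y

end Exact

/-- Duality is exact. -/
theorem exists_shortExact (hR : IsDenseFamily R) (hR' : IsDenseFamily R') {S : ShortComplex C'}
    (hS : S.ShortExact) {X₁ X₂ X₃ : C} (p₁ : DualPairing o X₁ S.X₁) (p₂ : DualPairing o X₂ S.X₂)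
    (p₃ : DualPairing o X₃ S.X₃) :
    ∃ (f : X₃ ⟶ X₂) (g : X₂ ⟶ X₁) (w : f ≫ g = 0), (ShortComplex.mk f g w).ShortExact ∧
      (∀ i (x : R i ⟶ X₃) y, p₂.w i (x ≫ f) y = p₃.w i x (y ≫ S.g)) ∧
      ∀ i (x : R i ⟶ X₂) y, p₁.w i (x ≫ g) y = p₂.w i x (y ≫ S.f) := by
  obtain ⟨f, hf⟩ := exists_map hR p₂ p₃ S.g
  obtain ⟨g, hg⟩ := exists_map hR p₁ p₂ S.f
  have w : f ≫ g = 0 := hR.sep _ fun i x => p₁.ext_of fun y => by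
    rw [← Category.assoc, hg, hf, Category.assoc, S.zero]
    simp
  refine ⟨f, g, w, ShortComplex.ShortExact.mk' (hR.exact_of _ fun i x hx => ?_)
    (mono_of_epi p₂ p₃ hf hR hR' hS.epi_g) (epi_of_mono p₁ p₂ hg hR hS.mono_f), hf, hg⟩
  dsimp only at x hx ⊢
  obtain ⟨χ, hχ⟩ := LinearMap.exists_dual_comp_eq (Linear.rightComp K (R' i) S.g) (p₂.w i x)
    (fun y hy => by
      obtain ⟨z, rfl⟩ := hS.exists_lift y hy
      rw [← hg, hx]
      simp)
  refine ⟨(p₃.w i).symm χ, p₂.ext_of fun y => ?_⟩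
  rw [hf, LinearEquiv.apply_symm_apply]
  exact hχ y

/-- The dual of a projective object is injective. -/
theorem injective (hR : IsDenseFamily R) (hR' : IsDenseFamily R')
    (hD : ∀ N : C', ∃ X, Nonempty (DualPairing o X N)) {L : C'} {P : C}
    (q : DualPairing o.symm L P) (hP : Projective P) : Injective L := by
  refine ⟨fun {N N₁} g i _ => ?_⟩
  obtain ⟨X, ⟨p⟩⟩ := hD N
  obtain ⟨X₁, ⟨p₁⟩⟩ := hD N₁
  obtain ⟨j, hj⟩ := exists_map hR p p₁ i
  have : Epi j := epi_of_mono p p₁ hj hR inferInstance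
  -- Morphisms N → DP correspond to morphisms P → DN. The transposed morphism lifts along the
  -- epimorphism DN₁ → DN because `P` is projective; transposing back extends `g`.
  obtain ⟨f, hf⟩ := exists_adjoint_symm hR p q g
  obtain ⟨g', hg'⟩ := exists_adjoint hR' p₁ q (Projective.factorThru f j)
  refine ⟨g', hR'.sep _ ?_ |> sub_eq_zero.1⟩
  intro k y
  apply q.ext_of
  intro m
  rw [Preadditive.comp_sub, map_sub, LinearMap.sub_apply, map_zero, LinearMap.zero_apply,
    ← Category.assoc, hg', hf, ← hj, Category.assoc, Projective.factorThru_comp, sub_self]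

end DualPairing

variable [HasExt.{u} C] [HasExt.{u} C']

theorem subsingleton_ext_one_iff {C : Type*} [Category C] [Abelian C] [HasExt.{u} C]
    {S : ShortComplex C} (hS : S.ShortExact) (hP : Projective S.X₂) (Y : C) :
    Subsingleton (Ext S.X₃ Y 1) ↔ ∀ f : S.X₁ ⟶ Y, ∃ g : S.X₂ ⟶ Y, S.f ≫ g = f := by
  constructor
  · intro h f
    obtain ⟨g, hg⟩ := Ext.contravariant_sequence_exact₁ hS Y (Ext.mk₀ f) (add_comm 1 0)
      (Subsingleton.elim _ _)
    obtain ⟨g, rfl⟩ := Ext.addEquiv₀.symm.surjective g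
    refine ⟨g, Ext.addEquiv₀.symm.injective ?_⟩
    simpa using hg
  · intro h
    refine subsingleton_of_forall_eq 0 fun e => ?_
    obtain ⟨f, rfl⟩ := Ext.contravariant_sequence_exact₃ hS Y e (Ext.eq_zero_of_projective _)
      (add_comm 1 0)
    obtain ⟨f, rfl⟩ := Ext.addEquiv₀.symm.surjective f
    obtain ⟨g, rfl⟩ := h f
    have h1 : Ext.mk₀ (S.f ≫ g) = (Ext.mk₀ S.f).comp (Ext.mk₀ g) (zero_add 0) := by simp
    exact (congrArg (fun z => hS.extClass.comp z (add_comm 1 0)) h1).trans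
      (hS.extClass_comp_assoc (Ext.mk₀ g) (h := add_comm 1 0))

theorem subsingleton_ext_one_iff_of_injective {C : Type*} [Category C] [Abelian C] [HasExt.{u} C]
    {S : ShortComplex C} (hS : S.ShortExact) (hP : Injective S.X₂) (Y : C) :
    Subsingleton (Ext Y S.X₁ 1) ↔ ∀ f : Y ⟶ S.X₃, ∃ g : Y ⟶ S.X₂, g ≫ S.g = f := by
  constructor
  · intro h f
    obtain ⟨g, hg⟩ := Ext.covariant_sequence_exact₃ Y hS (Ext.mk₀ f) (zero_add 1)
      (Subsingleton.elim _ _)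
    obtain ⟨g, rfl⟩ := Ext.addEquiv₀.symm.surjective g
    refine ⟨g, Ext.addEquiv₀.symm.injective ?_⟩
    simpa using hg
  · intro h
    refine subsingleton_of_forall_eq 0 fun e => ?_
    obtain ⟨f, rfl⟩ := Ext.covariant_sequence_exact₁ Y hS e (Ext.eq_zero_of_injective _)
      (zero_add 1)
    obtain ⟨f, rfl⟩ := Ext.addEquiv₀.symm.surjective f
    obtain ⟨g, rfl⟩ := h f
    have h1 : Ext.mk₀ (g ≫ S.g) = (Ext.mk₀ g).comp (Ext.mk₀ S.g) (zero_add 0) := by simp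
    refine (congrArg (fun z => Ext.comp z hS.extClass (zero_add 1)) h1).trans ?_
    rw [Ext.comp_assoc_of_second_deg_zero, hS.comp_extClass, Ext.comp_zero]

theorem subsingleton_ext_succ_iff {C : Type*} [Category C] [Abelian C] [HasExt.{u} C]
    {S : ShortComplex C} (hS : S.ShortExact) (hP : Projective S.X₂) (Y : C) (k : ℕ) :
    Subsingleton (Ext S.X₃ Y (k + 2)) ↔ Subsingleton (Ext S.X₁ Y (k + 1)) := by
  constructor
  · refine fun h => subsingleton_of_forall_eq 0 fun e => ?_
    obtain ⟨g, rfl⟩ := Ext.contravariant_sequence_exact₁ hS Y e (add_comm 1 (k + 1))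
      (Subsingleton.elim _ _)
    rw [Ext.eq_zero_of_projective g]
    simp
  · refine fun h => subsingleton_of_forall_eq 0 fun e => ?_
    obtain ⟨f, rfl⟩ := Ext.contravariant_sequence_exact₃ hS Y e (Ext.eq_zero_of_projective _)
      (add_comm 1 (k + 1))
    rw [Subsingleton.elim f 0]
    simp

theorem subsingleton_ext_succ_iff_of_injective {C : Type*} [Category C] [Abelian C] [HasExt.{u} C]
    {S : ShortComplex C} (hS : S.ShortExact) (hP : Injective S.X₂) (Y : C) (k : ℕ) :
    Subsingleton (Ext Y S.X₁ (k + 2)) ↔ Subsingleton (Ext Y S.X₃ (k + 1)) := by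
  constructor
  · refine fun h => subsingleton_of_forall_eq 0 fun e => ?_
    obtain ⟨g, rfl⟩ := Ext.covariant_sequence_exact₃ Y hS e rfl
      (Subsingleton.elim _ _)
    rw [Ext.eq_zero_of_injective g]
    simp
  · refine fun h => subsingleton_of_forall_eq 0 fun e => ?_
    obtain ⟨f, rfl⟩ := Ext.covariant_sequence_exact₁ Y hS e (Ext.eq_zero_of_injective _)
      rfl
    rw [Subsingleton.elim f 0]
    simp

/-- `Ext^k(N, D M)` and `Ext^k(M, D N)` vanish simultaneously. -/
theorem DualPairing.subsingleton_ext_iff {o : OppositeFamilies K R R'} (hR : IsDenseFamily R)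
    (hR' : IsDenseFamily R') [EnoughProjectives C]
    (hD : ∀ N : C', ∃ X, Nonempty (DualPairing o X N))
    (hD' : ∀ M : C, ∃ L, Nonempty (DualPairing o.symm L M)) {X M : C} {N L : C'}
    (p : DualPairing o X N) (q : DualPairing o.symm L M) (k : ℕ) :
    Subsingleton (Ext N L (k + 1)) ↔ Subsingleton (Ext M X (k + 1)) := by
  induction k generalizing M L with
  | zero =>
    obtain ⟨P, e⟩ := (EnoughProjectives.presentation M).some
    rename_i hP he
    let S : ShortComplex C := ShortComplex.mk (kernel.ι e) e (kernel.condition e)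
    have hS : S.ShortExact := { exact := ShortComplex.exact_kernel e }
    obtain ⟨L₁, ⟨q₁⟩⟩ := hD' (kernel e)
    obtain ⟨L₂, ⟨q₂⟩⟩ := hD' P
    obtain ⟨f, g, w, hT, hf, hg⟩ := DualPairing.exists_shortExact hR' hR hS q₁ q₂ q
    -- Dualizing a projective presentation of `M` gives an injective copresentation of `L`. Now one
    -- group obstructs extending morphisms into `X`, the other lifting morphisms from `N`, and the
    -- adjunction between Hom(N, DM) and Hom(M, DN) exchanges these problems.
    rw [subsingleton_ext_one_iff_of_injective hT (q₂.injective hR hR' hD hP),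
      subsingleton_ext_one_iff hS hP]
    dsimp only [S] at hg ⊢
    constructor
    · intro h a
      obtain ⟨b, hb⟩ := exists_adjoint hR' p q₁ a
      obtain ⟨c, rfl⟩ := h b
      obtain ⟨d, hd⟩ := exists_adjoint_symm hR p q₂ c
      refine ⟨d, sub_eq_zero.1 (hR.sep _ fun i m => p.ext_of fun y => ?_)⟩
      rw [Preadditive.comp_sub, map_sub, LinearMap.sub_apply, ← hb, ← Category.assoc, ← hd,
        ← Category.assoc, hg, sub_self]
      simp
    · intro h b
      obtain ⟨a, ha⟩ := exists_adjoint_symm hR p q₁ b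
      obtain ⟨d, rfl⟩ := h a
      obtain ⟨c, hc⟩ := exists_adjoint hR' p q₂ d
      refine ⟨c, sub_eq_zero.1 (hR'.sep _ fun i y => q₁.ext_of fun m => ?_)⟩
      rw [Preadditive.comp_sub, map_sub, LinearMap.sub_apply, ha, ← Category.assoc, hg, hc,
        Category.assoc, sub_self]
      simp
  | succ k ih =>
    obtain ⟨P, e⟩ := (EnoughProjectives.presentation M).some
    rename_i hP he
    let S : ShortComplex C := ShortComplex.mk (kernel.ι e) e (kernel.condition e)
    have hS : S.ShortExact := { exact := ShortComplex.exact_kernel e }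
    obtain ⟨L₁, ⟨q₁⟩⟩ := hD' (kernel e)
    obtain ⟨L₂, ⟨q₂⟩⟩ := hD' P
    obtain ⟨f, g, w, hT, hf, hg⟩ := DualPairing.exists_shortExact hR' hR hS q₁ q₂ q
    rw [subsingleton_ext_succ_iff_of_injective hT (q₂.injective hR hR' hD hP) N k,
      subsingleton_ext_succ_iff hS hP X k]
    exact ih q₁

end Opposite

/-! ### Duality of finitely generated projective objects -/

section Transpose

variable {K : Type*} [Field K] {C C' : Type*} [Category C] [Abelian C] [Linear K C]
  [Category C'] [Abelian C'] [Linear K C'] {ι : Type} {R : ι → C} {R' : ι → C'}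

/-- `X` is `Hom(N, Λ)`, tested on the families `R` and `R'`. -/
structure HomDual (o : OppositeFamilies K R R') (X : C) (N : C') where
  v (i : ι) : (R i ⟶ X) ≃ₗ[K] (N ⟶ R' i)
  nat {i j : ι} (a : R i ⟶ R j) (x : R j ⟶ X) : v i (a ≫ x) = v j x ≫ o.op i j a

namespace HomDual

variable {o : OppositeFamilies K R R'} {X X₁ : C} {N N₁ : C'}

theorem exists_map (hR : IsDenseFamily R) (p : HomDual o X N) (p₁ : HomDual o X₁ N₁)
    (g : N ⟶ N₁) : ∃ f : X₁ ⟶ X, ∀ i (x : R i ⟶ X₁), p.v i (x ≫ f) = g ≫ p₁.v i x := by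
  obtain ⟨f, hf⟩ := hR.glue (fun i x => (p.v i).symm (g ≫ p₁.v i x)) (fun i x y => by simp)
    (fun i j a x => (p.v i).injective (by simp [nat]))
  exact ⟨f, fun i x => by simp [hf]⟩

/-- The evaluation at a generalized element of `N`. -/
theorem exists_ev (hR : IsDenseFamily R) (p : HomDual o X N) {t : ι} (y : R' t ⟶ N) :
    ∃ f : X ⟶ R t, ∀ i (x : R i ⟶ X), o.op i t (x ≫ f) = y ≫ p.v i x := by
  obtain ⟨f, hf⟩ := hR.glue (fun i x => (o.op i t).symm (y ≫ p.v i x)) (fun i x y => by simp)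
    (fun i j a x => (o.op i t).injective (by simp [nat, o.op_comp]))
  exact ⟨f, fun i x => by simp [hf]⟩

/-- The evaluation at a generalized element of `N`. -/
noncomputable def ev (hR : IsDenseFamily R) (p : HomDual o X N) {t : ι} (y : R' t ⟶ N) :
    X ⟶ R t := (p.exists_ev hR y).choose

theorem comp_ev (hR : IsDenseFamily R) (p : HomDual o X N) {t : ι} (y : R' t ⟶ N) {i : ι}
    (x : R i ⟶ X) : o.op i t (x ≫ p.ev hR y) = y ≫ p.v i x := (p.exists_ev hR y).choose_spec i x

theorem hom_ext (hR : IsDenseFamily R) (o : OppositeFamilies K R R') {t : ι} {f g : X ⟶ R t}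
    (h : ∀ i (x : R i ⟶ X), o.op i t (x ≫ f) = o.op i t (x ≫ g)) : f = g :=
  sub_eq_zero.1 (hR.sep _ fun i x => by
    rw [Preadditive.comp_sub, (o.op i t).injective (h i x), sub_self])

theorem ev_comp_op (hR : IsDenseFamily R) (p : HomDual o X N) {s t : ι} (a : R s ⟶ R t)
    (y : R' s ⟶ N) : p.ev hR (o.op s t a ≫ y) = p.ev hR y ≫ a := hom_ext hR o fun i x => by
  rw [comp_ev, ← Category.assoc x, o.op_comp, comp_ev, Category.assoc]

theorem map_ev (hR : IsDenseFamily R) (p : HomDual o X N) (p₁ : HomDual o X₁ N₁)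
    {g : N ⟶ N₁} {f : X₁ ⟶ X} (h : ∀ i (x : R i ⟶ X₁), p.v i (x ≫ f) = g ≫ p₁.v i x) {t : ι}
    (y : R' t ⟶ N) : f ≫ p.ev hR y = p₁.ev hR (y ≫ g) := hom_ext hR o fun i x => by
  rw [comp_ev, ← Category.assoc, comp_ev, h, Category.assoc]

theorem ev_add (hR : IsDenseFamily R) (p : HomDual o X N) {t : ι} (y z : R' t ⟶ N) :
    p.ev hR (y + z) = p.ev hR y + p.ev hR z := hom_ext hR o fun i x => by
  rw [comp_ev, Preadditive.comp_add, map_add, comp_ev, comp_ev, Preadditive.add_comp]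

theorem ev_smul (hR : IsDenseFamily R) (p : HomDual o X N) {t : ι} (r : K) (y : R' t ⟶ N) :
    p.ev hR (r • y) = r • p.ev hR y := hom_ext hR o fun i x => by
  rw [comp_ev, Linear.comp_smul, map_smul, comp_ev, Linear.smul_comp]

/-- With `ev_surjective` this is reflexivity of finitely generated projectives: an element of N is
recovered from its coordinates `y ≫ e s` in a dual basis. -/
theorem ev_injective (hR : IsDenseFamily R) (p : HomDual o X N) (hN : IsFGProj R' N) {t : ι}
    {y : R' t ⟶ N} (h : p.ev hR y = 0) : y = 0 := by
  obtain ⟨m, r, e, q, heq⟩ := hN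
  have h1 : ∀ s, y ≫ e s = 0 := fun s => by
    have := p.comp_ev hR y ((p.v (r s)).symm (e s))
    simpa [h] using this.symm
  rw [← Category.comp_id y, ← heq, Preadditive.comp_sum]
  exact Finset.sum_eq_zero fun s _ => by rw [← Category.assoc, h1, zero_comp]

theorem eq_sum (p : HomDual o X N) {m : ℕ} {r : Fin m → ι} {e : ∀ s, N ⟶ R' (r s)}
    {q : ∀ s, R' (r s) ⟶ N} (heq : ∑ s, e s ≫ q s = 𝟙 N) {i : ι} (x : R i ⟶ X) :
    ∑ s, (o.op i (r s)).symm (q s ≫ p.v i x) ≫ (p.v (r s)).symm (e s) = x := by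
  apply (p.v i).injective
  simp only [map_sum, nat, LinearEquiv.apply_symm_apply, ← Category.assoc]
  rw [← Preadditive.sum_comp, heq, Category.id_comp]

theorem ev_surjective (hR : IsDenseFamily R) (p : HomDual o X N) (hN : IsFGProj R' N) {t : ι}
    (f : X ⟶ R t) : ∃ y : R' t ⟶ N, p.ev hR y = f := by
  obtain ⟨m, r, e, q, heq⟩ := hN
  refine ⟨∑ s, o.op (r s) t ((p.v (r s)).symm (e s) ≫ f) ≫ q s, hom_ext hR o fun i x => ?_⟩
  conv_rhs => rw [← p.eq_sum heq x]
  rw [comp_ev, Preadditive.sum_comp, Preadditive.sum_comp, map_sum]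
  refine Finset.sum_congr rfl fun s _ => ?_
  rw [Category.assoc, Category.assoc, o.op_comp, LinearEquiv.apply_symm_apply]

/-- The evaluations at `q s` and the elements corresponding to `e s` form a dual basis of `X`. -/
theorem isFGProj (hR : IsDenseFamily R) (p : HomDual o X N) (hN : IsFGProj R' N) :
    IsFGProj R X := by
  obtain ⟨m, r, e, q, heq⟩ := hN
  refine ⟨m, r, fun s => p.ev hR (q s), fun s => (p.v (r s)).symm (e s), ?_⟩
  refine sub_eq_zero.1 (hR.sep _ fun i x => ?_)
  rw [Preadditive.comp_sub, Preadditive.comp_sum, sub_eq_zero, Category.comp_id]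
  conv_rhs => rw [← p.eq_sum heq x]
  refine Finset.sum_congr rfl fun s _ => ?_
  rw [← Category.assoc, ← p.comp_ev hR, LinearEquiv.symm_apply_apply]

end HomDual

end Transpose

/-! ### Syzygies -/

section Syzygies

variable {C : Type*} [Category C] [Abelian C] {ι : Type} {R : ι → C}

-- The remaining length is carried along with the syzygy, with truncated subtraction. Once it
-- reaches zero the object covers itself and all later syzygies are zero, so the sequence is defined
-- for all indices.
open scoped ZeroObject in
theorem HasFPRes.exists_sequence {n : ℕ} {M : C} (h : HasFPRes R n M) :
    ∃ (X P : ℕ → C) (f : ∀ k, X (k + 1) ⟶ P k) (g : ∀ k, P k ⟶ X k) (w : ∀ k, f k ≫ g k = 0),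
      X 0 = M ∧ (∀ k, (ShortComplex.mk _ _ (w k)).ShortExact ∧ IsFGProj R (P k)) ∧
      IsZero (X (n + 1)) := by
  have h' : ∀ X : {X : ℕ × C // HasFPRes R X.1 X.2}, ∃ (L : {X : ℕ × C // HasFPRes R X.1 X.2})
      (P : C) (f : L.1.2 ⟶ P) (g : P ⟶ X.1.2) (w : f ≫ g = 0),
      ((ShortComplex.mk _ _ w).ShortExact ∧ IsFGProj R P) ∧ L.1.1 = X.1.1 - 1 ∧
      (X.1.1 = 0 → IsZero L.1.2) := by
    rintro ⟨⟨k, X⟩, hX⟩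
    cases k with
    | zero =>
      refine ⟨⟨(0, 0), isFGProj_of_isZero (isZero_zero C)⟩, X, 0, 𝟙 X, by simp, ⟨?_, hX⟩, rfl,
        fun _ => isZero_zero C⟩
      exact (ShortComplex.Splitting.mk (S := ShortComplex.mk (0 : (0 : C) ⟶ X) (𝟙 X) (by simp)) 0
        (𝟙 X) ((isZero_zero C).eq_of_src _ _) (by simp) (by simp)).shortExact
    | succ k =>
      obtain ⟨S, hS, e, h2, h1⟩ := hX
      dsimp only at e ⊢
      subst e
      exact ⟨⟨(k, S.X₁), h1⟩, S.X₂, S.f, S.g, S.zero, ⟨hS, h2⟩, rfl, by simp⟩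
  choose L P f g w hw hL hz using h'
  let X : ℕ → {X : ℕ × C // HasFPRes R X.1 X.2} := fun k => Nat.rec ⟨(n, M), h⟩ (fun _ X => L X) k
  have hX : ∀ k, (X k).1.1 = n - k := fun k => by
    induction k with
    | zero => rfl
    | succ k ih => exact (hL (X k)).trans (by omega)
  exact ⟨fun k => (X k).1.2, fun k => P (X k), fun k => f (X k), fun k => g (X k),
    fun k => w (X k), rfl, fun k => hw (X k), hz (X n) (by rw [hX]; omega)⟩

variable [HasExt.{u} C]

theorem CategoryTheory.ShortComplex.ShortExact.extClass_push_eq_zero_iff {S : ShortComplex C}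
    (hS : S.ShortExact) {Y : C} (ψ : S.X₁ ⟶ Y) :
    hS.extClass.push ψ = 0 ↔ ∃ χ : S.X₂ ⟶ Y, ψ = S.f ≫ χ := by
  constructor
  · intro h
    obtain ⟨g, hg⟩ := Ext.contravariant_sequence_exact₁ hS Y (Ext.mk₀ ψ) (add_comm 1 0)
      (by rwa [Ext.comp_mk₀_eq_push])
    obtain ⟨g, rfl⟩ := Ext.addEquiv₀.symm.surjective g
    exact ⟨g, Ext.addEquiv₀.symm.injective (by simpa using hg.symm)⟩
  · rintro ⟨χ, rfl⟩
    rw [← Ext.push_push]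
    have : hS.extClass.push S.f = 0 := by rw [← Ext.comp_mk₀_eq_push]; exact hS.extClass_comp
    rw [this, Ext.zero_push]

theorem CategoryTheory.ShortComplex.ShortExact.exists_extClass_comp {S : ShortComplex C}
    (hS : S.ShortExact) (hP : Projective S.X₂) {Y : C} {k : ℕ} (α : Ext S.X₃ Y (k + 1)) :
    ∃ β : Ext S.X₁ Y k, hS.extClass.comp β (add_comm 1 k) = α :=
  Ext.contravariant_sequence_exact₃ hS Y α (Ext.eq_zero_of_projective _) (add_comm 1 k)

/-- Classes of degree `k + 1` on the zeroth syzygy are represented by morphisms on the syzygy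
of degree `k + 1`. -/
theorem exists_universal_class {X P : ℕ → C} {f : ∀ k, X (k + 1) ⟶ P k} {g : ∀ k, P k ⟶ X k}
    {w : ∀ k, f k ≫ g k = 0} (h : ∀ k, (ShortComplex.mk _ _ (w k)).ShortExact)
    (hP : ∀ k, Projective (P k)) (k : ℕ) :
    ∃ ε : Ext (X 0) (X (k + 1)) (k + 1), ∀ Y, (∀ α : Ext (X 0) Y (k + 1), ∃ ψ, α = ε.push ψ) ∧
      ∀ ψ : X (k + 1) ⟶ Y, ε.push ψ = 0 ↔ ∃ χ, ψ = f k ≫ χ := by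
  induction k generalizing X P with
  | zero =>
    refine ⟨(h 0).extClass, fun Y => ⟨fun α => ?_, fun ψ => (h 0).extClass_push_eq_zero_iff ψ⟩⟩
    obtain ⟨β, rfl⟩ := (h 0).exists_extClass_comp (hP 0) α
    obtain ⟨ψ, rfl⟩ := Ext.addEquiv₀.symm.surjective β
    exact ⟨ψ, rfl⟩
  | succ k ih =>
    obtain ⟨ε, hε⟩ := ih (X := fun k => X (k + 1)) (P := fun k => P (k + 1))
      (f := fun k => f (k + 1)) (g := fun k => g (k + 1)) (w := fun k => w (k + 1))
      (fun k => h (k + 1)) (fun k => hP (k + 1))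
    refine ⟨(h 0).extClass.comp ε (add_comm 1 (k + 1)), fun Y => ⟨fun α => ?_, fun ψ => ?_⟩⟩
    · obtain ⟨β, rfl⟩ := (h 0).exists_extClass_comp (hP 0) α
      obtain ⟨ψ, rfl⟩ := (hε Y).1 β
      exact ⟨ψ, by rw [Ext.comp_push]⟩
    -- In positive degree the connecting map is injective, because the middle term is projective; so
    -- the vanishing criterion is the one for the first syzygy.
    · rw [← (hε Y).2 ψ, Ext.comp_push]
      constructor
      · intro h0
        obtain ⟨γ, hγ⟩ := Ext.contravariant_sequence_exact₁ (h 0) Y (ε.push ψ)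
          (add_comm 1 (k + 1)) h0
        rw [← hγ, Ext.eq_zero_of_projective γ]
        simp
      · intro h0
        rw [h0, Ext.comp_zero]

end Syzygies

/-! ### Transposing a resolution -/

section TransposeResolution

theorem exists_desc_of_epi {C : Type*} [Category C] [Abelian C] {ι : Type} {R : ι → C}
    (hR : IsDenseFamily R) {Q U B : C} (e : Q ⟶ U) (he : Epi e) (b : Q ⟶ B)
    (h : ∀ i (x : R i ⟶ Q), x ≫ e = 0 → x ≫ b = 0) : ∃ m : U ⟶ B, e ≫ m = b := by
  refine ShortComplex.ShortExact.exists_desc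
    (S := ShortComplex.mk (kernel.ι e) e (kernel.condition e))
    { exact := ShortComplex.exact_kernel e } b ?_
  exact hR.sep _ fun i x => by
    rw [← Category.assoc]
    exact h i _ (by simp)

theorem nonempty_iso_of_epi {C : Type*} [Category C] [Abelian C] {ι : Type} {R : ι → C}
    (hR : IsDenseFamily R) {Q U V : C} (e : Q ⟶ U) (he : Epi e) (b : Q ⟶ V) (hb : Epi b)
    (h : ∀ i (x : R i ⟶ Q), x ≫ e = 0 ↔ x ≫ b = 0) : Nonempty (U ≅ V) := by
  obtain ⟨m, hm⟩ := exists_desc_of_epi hR e he b fun i x => (h i x).1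
  obtain ⟨m', hm'⟩ := exists_desc_of_epi hR b hb e fun i x => (h i x).2
  refine ⟨⟨m, m', ?_, ?_⟩⟩
  · rw [← cancel_epi e, ← Category.assoc, hm, hm', Category.comp_id]
  · rw [← cancel_epi b, ← Category.assoc, hm', hm, Category.comp_id]

variable {K : Type*} [Field K] {C C' : Type*} [Category C] [Abelian C] [Linear K C]
  [Category C'] [Abelian C'] [Linear K C'] {ι : Type} {R : ι → C} {R' : ι → C'}
  [HasExt.{u} C] [HasExt.{u} C']

/-- `X` is `Ext^k(N, Λ)`, tested on the families `R` and `R'`. -/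
structure ExtDual (o : OppositeFamilies K R R') (k : ℕ) (X : C) (N : C') where
  u (i : ι) : (R i ⟶ X) ≃ₗ[K] Ext N (R' i) k
  nat {i j : ι} (a : R i ⟶ R j) (x : R j ⟶ X) : u i (a ≫ x) = (u j x).push (o.op i j a)

/-- Ext groups of degree zero are groups of morphisms. -/
noncomputable def ExtDual.homDual {o : OppositeFamilies K R R'} {X : C} {N : C'}
    (p : ExtDual o 0 X N) : HomDual o X N where
  v i := (p.u i).trans Ext.linearEquiv₀
  nat a x := by
    apply (Ext.linearEquiv₀ (R := K)).symm.injective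
    simp [p.nat, ← Ext.mk₀_push]

/-- `U` is resolved by the duals of the first terms of a resolution of an object. -/
structure IsTransposeStage (K : Type*) [Field K] [Linear K C] (R : ι → C) {Q₀ Q₁ : C}
    (d : Q₀ ⟶ Q₁) (k : ℕ) (U : C) : Prop where
  res : HasFPRes R (k + 1) U
  ext_eq : ∀ i < k, ∀ t, Subsingleton (Ext U (R t) (i + 1))
  universal : ∃ ε : Ext U Q₀ (k + 1), ∀ t,
    (∀ α : Ext U (R t) (k + 1), ∃ f : Q₀ ⟶ R t, α = ε.push f) ∧
    ∀ f : Q₀ ⟶ R t, ε.push f = 0 ↔ ∃ f', f = d ≫ f'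

theorem IsTransposeStage.of_iso {Q₀ Q₁ : C} {d : Q₀ ⟶ Q₁} {k : ℕ} {U V : C}
    (h : IsTransposeStage K R d k U) (e : U ≅ V) : IsTransposeStage K R d k V := by
  obtain ⟨h1, h2, ε, hε⟩ := h
  have key : ∀ {Y : C} {i : ℕ} (α : Ext V Y i), Ext.pull e.inv (Ext.pull e.hom α) = α := by
    intros; simp
  have key' : ∀ {Y : C} {i : ℕ} (α : Ext U Y i), Ext.pull e.hom (Ext.pull e.inv α) = α := by
    intros; simp
  refine ⟨hasFPRes_of_iso h1 e, fun i hi t => subsingleton_of_forall_eq 0 fun α => ?_,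
    Ext.pull e.inv ε, fun t => ⟨fun α => ?_, fun f => ?_⟩⟩
  · have := h2 i hi t
    rw [← key α, Subsingleton.elim (Ext.pull e.hom α) 0, Ext.pull_zero]
  · obtain ⟨f, hf⟩ := (hε t).1 (Ext.pull e.hom α)
    exact ⟨f, by rw [← key α, hf, Ext.pull_push]⟩
  · rw [← (hε t).2 f, Ext.pull_push]
    constructor
    · intro h
      rw [← key' (ε.push f), h, Ext.pull_zero]
    · intro h
      rw [h, Ext.pull_zero]

/-- A new stage, from a short exact sequence with a projective middle term. -/
theorem IsTransposeStage.succ (hR : ∀ i, Projective (R i)) {Q₀ Q₁ : C} {d : Q₀ ⟶ Q₁} {k : ℕ}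
    {S : ShortComplex C} (hS : S.ShortExact) (h : IsTransposeStage K R d k S.X₁)
    (hQ : IsFGProj R S.X₂) (hext : ∀ t (f : S.X₁ ⟶ R t), ∃ g : S.X₂ ⟶ R t, S.f ≫ g = f) :
    IsTransposeStage K R d (k + 1) S.X₃ := by
  obtain ⟨h1, h2, ε, hε⟩ := h
  have hp := hQ.projective hR
  refine ⟨⟨S, hS, rfl, hQ, h1⟩, fun i hi t => ?_,
    hS.extClass.comp ε (add_comm 1 (k + 1)), fun t => ⟨fun α => ?_, fun f => ?_⟩⟩
  · cases i with
    | zero => exact (subsingleton_ext_one_iff hS hp (R t)).2 (hext t)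
    | succ i => exact (subsingleton_ext_succ_iff hS hp (R t) i).2 (h2 i (by omega) t)
  · obtain ⟨β, rfl⟩ := hS.exists_extClass_comp hp α
    obtain ⟨f, rfl⟩ := (hε t).1 β
    exact ⟨f, by rw [Ext.comp_push]⟩
  · rw [← (hε t).2 f, Ext.comp_push]
    constructor
    · intro h0
      obtain ⟨γ, hγ⟩ := Ext.contravariant_sequence_exact₁ hS (R t) (ε.push f)
        (add_comm 1 (k + 1)) h0
      rw [← hγ, Ext.eq_zero_of_projective γ]
      simp
    · intro h0
      rw [h0, Ext.comp_zero]

theorem isTransposeStage_zero (hR : ∀ i, Projective (R i)) {S : ShortComplex C} (hS : S.ShortExact)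
    (h₁ : IsFGProj R S.X₁) (h₂ : IsFGProj R S.X₂) : IsTransposeStage K R S.f 0 S.X₃ := by
  refine ⟨⟨S, hS, rfl, h₂, h₁⟩, fun i hi => absurd hi (by omega),
    hS.extClass, fun t => ⟨fun α => ?_, fun f => hS.extClass_push_eq_zero_iff f⟩⟩
  obtain ⟨β, rfl⟩ := hS.exists_extClass_comp (h₂.projective hR) α
  obtain ⟨f, rfl⟩ := Ext.addEquiv₀.symm.surjective β
  exact ⟨f, rfl⟩

variable {o : OppositeFamilies K R R'}

/-- Dualize the resolution `P` of `X 0` to a complex `Q`. Vanishing of Ext^i(X 0, Λ) for i ≤ k makes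
`Q` exact up to index k, so the cokernel of `Q k ⟶ Q (k + 1)` is resolved by the terms up to k + 1.
Dualizing this resolution gives back `P` by reflexivity, whence the Ext groups of the cokernel. -/
theorem exists_transposeStage (hR : IsDenseFamily R) (hR' : IsDenseFamily R') {X P : ℕ → C'}
    {f : ∀ k, X (k + 1) ⟶ P k} {g : ∀ k, P k ⟶ X k} {w : ∀ k, f k ≫ g k = 0}
    (h : ∀ k, (ShortComplex.mk _ _ (w k)).ShortExact ∧ IsFGProj R' (P k))
    {Q : ℕ → C} (p : ∀ k, HomDual o (Q k) (P k)) {d : ∀ k, Q k ⟶ Q (k + 1)}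
    (hd : ∀ k i (x : R i ⟶ Q k), (p (k + 1)).v i (x ≫ d k) = (g (k + 1) ≫ f k) ≫ (p k).v i x)
    (k : ℕ) (h0 : ∀ i ≤ k, ∀ t, Subsingleton (Ext (X 0) (R' t) i)) :
    ∃ (U : C) (e : Q (k + 1) ⟶ U), Epi e ∧
      (∀ i (x : R i ⟶ Q (k + 1)), x ≫ e = 0 ↔ ∃ χ, (p (k + 1)).v i x = (g (k + 1) ≫ f k) ≫ χ) ∧
      IsTransposeStage K R (d 0) k U := by
  have hge := fun k => (h k).1.epi_g
  have hfm := fun k => (h k).1.mono_f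
  dsimp only at hge hfm
  induction k with
  | zero =>
    -- A kernel element is a map `P 0 ⟶ R' i` vanishing on `X 1`; it factors through `X 0` and is
    -- zero as Hom(X 0, Λ) = 0.
    have hm : Mono (d 0) := hR.mono_of _ fun i x hx => by
      apply (p 0).v i |>.injective
      have h1 := hd 0 i x
      rw [hx, map_zero, Category.assoc] at h1
      obtain ⟨ψ, hψ⟩ := (h 0).1.exists_desc ((p 0).v i x)
        (by dsimp only; rw [← cancel_epi (g 1), ← h1, comp_zero])
      have := h0 0 le_rfl i
      have h2 : ψ = 0 := Ext.addEquiv₀.symm.injective (Subsingleton.elim _ _)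
      rw [← hψ, h2, comp_zero, map_zero]
    have hS : (ShortComplex.mk _ _ (cokernel.condition (d 0))).ShortExact :=
      { exact := ShortComplex.exact_cokernel _ }
    refine ⟨cokernel (d 0), cokernel.π (d 0), inferInstance, fun i x => ?_,
      isTransposeStage_zero hR.proj hS ((p 0).isFGProj hR (h 0).2) ((p 1).isFGProj hR (h 1).2)⟩
    constructor
    · intro hx
      obtain ⟨z, rfl⟩ := hS.exists_lift x hx
      exact ⟨_, hd 0 i z⟩
    · rintro ⟨χ, hχ⟩
      have : x = ((p 0).v i).symm χ ≫ d 0 := ((p 1).v i).injective (by rw [hd, hχ]; simp)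
      rw [this, Category.assoc, cokernel.condition, comp_zero]
  | succ k ih =>
    obtain ⟨U, e, he, hk, hU⟩ := ih fun i hi => h0 i (by omega)
    -- By the universal class, vanishing of Ext^{k+1}(X 0, Λ) says that every map from the syzygy to
    -- `R' t` extends to `P k`. This gives exactness of `Q` at the next spot.
    have hext : ∀ t (ψ : X (k + 1) ⟶ R' t), ∃ χ, ψ = f k ≫ χ := fun t ψ => by
      obtain ⟨ε, hε⟩ := exists_universal_class (fun k => (h k).1)
        (fun k => (h k).2.projective hR'.proj) k
      have := h0 (k + 1) le_rfl t
      exact ((hε (R' t)).2 ψ).1 (Subsingleton.elim _ _)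
    obtain ⟨m, hm⟩ := exists_desc_of_epi hR e he (d (k + 1)) fun i x hx => by
      obtain ⟨χ, hχ⟩ := (hk i x).1 hx
      apply ((p (k + 2)).v i).injective
      have := w (k + 1)
      rw [hd, hχ, map_zero]
      simp only [Category.assoc, reassoc_of% this, zero_comp, comp_zero]
    have hmm : Mono m := hR.mono_of _ fun i x hx => by
      obtain ⟨x, rfl⟩ := exists_lift_of_epi hR.proj e he x
      rw [Category.assoc, hm] at hx
      rw [hk]
      have h1 := hd (k + 1) i x
      rw [hx, map_zero, Category.assoc] at h1
      obtain ⟨ψ, hψ⟩ := (h (k + 1)).1.exists_desc ((p (k + 1)).v i x)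
        (by dsimp only; rw [← cancel_epi (g (k + 2)), ← h1, comp_zero])
      obtain ⟨χ, rfl⟩ := hext i ψ
      exact ⟨χ, by rw [← hψ, Category.assoc]⟩
    have hS : (ShortComplex.mk _ _ (cokernel.condition m)).ShortExact :=
      { exact := ShortComplex.exact_cokernel _ }
    refine ⟨cokernel m, cokernel.π m, inferInstance, fun i x => ?_,
      hU.succ hR.proj hS ((p (k + 2)).isFGProj hR (h (k + 2)).2) fun t a => ?_⟩
    · constructor
      · intro hx
        obtain ⟨z, rfl⟩ := hS.exists_lift x hx
        obtain ⟨z, rfl⟩ := exists_lift_of_epi hR.proj e he z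
        refine ⟨(p (k + 1)).v i z, ?_⟩
        rw [← hd, Category.assoc]
        dsimp only
        rw [hm]
      · rintro ⟨χ, hχ⟩
        have : x = ((p (k + 1)).v i).symm χ ≫ d (k + 1) :=
          ((p (k + 2)).v i).injective (by rw [hd, hχ]; simp)
        rw [this, ← hm]
        simp
    · dsimp only at a ⊢
      -- By reflexivity `e ≫ a` is evaluation at an element `y` of `P (k + 1)`. As `d k ≫ e = 0`,
      -- this `y` is a cycle, hence a boundary since `P` is exact, and evaluation at a preimage
      -- extends `a`.
      obtain ⟨y, hy⟩ := (p (k + 1)).ev_surjective hR (h (k + 1)).2 (e ≫ a)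
      have h1 : d k ≫ e = 0 := hR.sep _ fun i x => by
        rw [← Category.assoc, hk]
        exact ⟨_, hd k i x⟩
      have h2 : y ≫ g (k + 1) ≫ f k = 0 := by
        apply (p k).ev_injective hR (h k).2
        rw [← HomDual.map_ev hR (p (k + 1)) (p k) (hd k), hy, ← Category.assoc, h1, zero_comp]
      obtain ⟨z, hz⟩ := (h (k + 1)).1.exists_lift y
        (by dsimp only; rw [← cancel_mono (f k), Category.assoc, h2, zero_comp])
      obtain ⟨z, rfl⟩ := exists_lift_of_epi hR'.proj (g (k + 2)) (hge _) z
      refine ⟨(p (k + 2)).ev hR z, ?_⟩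
      rw [← cancel_epi e, ← hy, ← Category.assoc, hm,
        HomDual.map_ev hR (p (k + 2)) (p (k + 1)) (hd (k + 1)), ← hz, Category.assoc]

theorem ext_eq_zero_of_isZero {V Y : C} {n : ℕ} (hV : IsZero V) (α : Ext V Y n) : α = 0 := by
  have : HasProjectiveDimensionLT V 0 := hV.hasProjectiveDimensionLT_zero
  exact α.eq_zero_of_pd this (Nat.zero_le n)

/-- The transpose of an object of `H^n` is an object of `H^n`, and its Serre dual is the dual of
the given object. -/
theorem HasFPRes.transpose (hR : IsDenseFamily R) (hR' : IsDenseFamily R')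
    (hF : ∀ N : C', ∃ X, Nonempty (ExtDual o 0 X N)) {n : ℕ} (hn : n ≠ 0) {N : C'}
    (hN : HasFPRes R' n N) (h0 : ∀ i < n, ∀ t, Subsingleton (Ext N (R' t) i)) (hNz : ¬ IsZero N)
    {V X : C} (q : ExtDual o n V N) (r : DualPairing o X N) :
    HasFPRes R n V ∧ (∀ i < n, ∀ t, Subsingleton (Ext V (R t) i)) ∧ ¬ IsZero V ∧
      HasSerreDual K n V X := by
  obtain ⟨n, rfl⟩ := Nat.exists_eq_succ_of_ne_zero hn
  obtain ⟨X, P, f, g, w, rfl, h, hz⟩ := hN.exists_sequence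
  choose Q hQ using fun k => hF (P k)
  let p : ∀ k, HomDual o (Q k) (P k) := fun k => (hQ k).some.homDual
  choose d hd using fun k => (p (k + 1)).exists_map hR (p k) (g (k + 1) ≫ f k)
  obtain ⟨U, e, he, hk, hU⟩ := exists_transposeStage hR hR' h p hd n fun i hi => h0 i (by omega)
  have hge := fun k => (h k).1.epi_g
  have hfm := fun k => (h k).1.mono_f
  dsimp only at hge hfm
  -- The original exponent is now n + 1, so the syzygy of index n + 2 is zero and the last
  -- projective is the syzygy of index n + 1.
  have hg : IsIso (g (n + 1)) := (h (n + 1)).1.isIso_g_iff.2 hz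
  obtain ⟨ε, hε⟩ := exists_universal_class (fun k => (h k).1)
    (fun k => (h k).2.projective hR'.proj) n
  -- A map from the last projective to `R' i` represents a class in the top Ext group. This presents
  -- `V` as a quotient of `Q (n + 1)` with the same kernel as the cokernel `U`, so `U` and `V` are
  -- isomorphic.
  obtain ⟨b, hb⟩ := hR.glue (X := Q (n + 1)) (Y := V)
    (fun i x => (q.u i).symm (ε.push (inv (g (n + 1)) ≫ (p (n + 1)).v i x))) (by simp)
    (fun i j a x => (q.u i).injective (by
      simp only [q.nat, (p (n + 1)).nat, LinearEquiv.apply_symm_apply, Ext.push_push,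
        Category.assoc]))
  have hbe : Epi b := hR.epi_of _ fun i y => by
    obtain ⟨ψ, hψ⟩ := (hε _).1 (q.u i y)
    refine ⟨((p (n + 1)).v i).symm (g (n + 1) ≫ ψ), (q.u i).injective ?_⟩
    rw [hb]
    simp [hψ]
  obtain ⟨iso⟩ := nonempty_iso_of_epi hR e he b hbe fun i x => by
    rw [hk, hb, LinearEquiv.map_eq_zero_iff, (hε _).2]
    simp only [IsIso.inv_comp_eq, Category.assoc]
  replace hU := hU.of_iso iso
  obtain ⟨h1, h2, ε', hε'⟩ := hU
  -- Double transposition: both sides are quotients of Hom(R' t, P 0) by the image of Hom(R' t, P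
  -- 1), on the right through evaluation and the universal class.
  have hθ : ∀ t, ∃ θ : (R' t ⟶ X 0) ≃ₗ[K] Ext V (R t) (n + 1),
      ∀ y : R' t ⟶ P 0, θ (y ≫ g 0) = ε'.push ((p 0).ev hR y) := by
    intro t
    let φ : (R' t ⟶ P 0) →ₗ[K] Ext V (R t) (n + 1) :=
      { toFun := fun y => ε'.push ((p 0).ev hR y)
        map_add' := fun y z => by rw [(p 0).ev_add, Ext.push_add]
        map_smul' := fun r y => by rw [(p 0).ev_smul, Ext.push_smul, RingHom.id_apply] }
    let ρ : (R' t ⟶ P 0) →ₗ[K] (R' t ⟶ X 0) := Linear.rightComp K (R' t) (g 0)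
    have hφ : Function.Surjective φ := fun α => by
      obtain ⟨a, rfl⟩ := (hε' t).1 α
      obtain ⟨y, rfl⟩ := (p 0).ev_surjective hR (h 0).2 a
      exact ⟨y, rfl⟩
    have hρ : Function.Surjective ρ := fun y => exists_lift_of_epi hR'.proj (g 0) (hge 0) y
    have hker : LinearMap.ker ρ = LinearMap.ker φ := by
      ext y
      rw [LinearMap.mem_ker, LinearMap.mem_ker]
      change y ≫ g 0 = 0 ↔ ε'.push ((p 0).ev hR y) = 0
      rw [(hε' t).2]
      constructor
      · intro hy
        obtain ⟨z, rfl⟩ := (h 0).1.exists_lift y hy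
        obtain ⟨z, rfl⟩ := exists_lift_of_epi hR'.proj (g 1) (hge _) z
        refine ⟨(p 1).ev hR z, ?_⟩
        rw [HomDual.map_ev hR (p 1) (p 0) (hd 0), Category.assoc]
      · rintro ⟨a, ha⟩
        obtain ⟨z, rfl⟩ := (p 1).ev_surjective hR (h 1).2 a
        rw [HomDual.map_ev hR (p 1) (p 0) (hd 0), ← sub_eq_zero] at ha
        have : y - z ≫ g 1 ≫ f 0 = 0 := by
          apply (p 0).ev_injective hR (h 0).2
          rw [← ha, sub_eq_add_neg, (p 0).ev_add, ← neg_one_smul K, (p 0).ev_smul]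
          simp [sub_eq_add_neg]
        rw [sub_eq_zero.1 this]
        simp [w]
    refine ⟨(ρ.quotKerEquivOfSurjective hρ).symm.trans
      ((Submodule.quotEquivOfEq _ _ hker).trans (φ.quotKerEquivOfSurjective hφ)), fun y => ?_⟩
    have : (ρ.quotKerEquivOfSurjective hρ).symm (y ≫ g 0) = Submodule.Quotient.mk y := by
      rw [LinearEquiv.symm_apply_eq]
      rfl
    simp only [LinearEquiv.trans_apply, this]
    rfl
  choose θ hθ using hθ
  refine ⟨h1, fun i hi t => ?_, fun hV => ?_, ?_⟩
  · cases i with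
    | succ i => exact h2 i (by omega) t
    | zero =>
      refine subsingleton_of_forall_eq 0 fun α => ?_
      obtain ⟨a, rfl⟩ := Ext.addEquiv₀.symm.surjective α
      suffices a = 0 by rw [this, map_zero]
      -- Hom(V, R t) vanishes because it consists of elements of the last projective killed by the
      -- last differential, which is a monomorphism.
      obtain ⟨y, hy⟩ := (p (n + 1)).ev_surjective hR (h _).2 (b ≫ a)
      have h3 : d n ≫ b = 0 := hR.sep _ fun i x => by
        rw [← Category.assoc, hb, hd, LinearEquiv.map_eq_zero_iff, (hε _).2]
        simp only [IsIso.inv_comp_eq, Category.assoc]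
        exact ⟨_, rfl⟩
      have h4 : y ≫ g (n + 1) ≫ f n = 0 := by
        apply (p n).ev_injective hR (h n).2
        rw [← HomDual.map_ev hR (p (n + 1)) (p n) (hd n), hy, ← Category.assoc, h3, zero_comp]
      have h5 : y = 0 := by
        rw [← cancel_mono (g (n + 1) ≫ f n), h4, zero_comp]
      have h6 : (p (n + 1)).ev hR y = 0 := by
        have := (p (n + 1)).ev_smul hR (0 : K) y
        simpa [h5] using this
      rw [← cancel_epi b, ← hy, h6, comp_zero]
  · refine hNz (hR'.isZero_of fun i y => (θ i).injective ?_)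
    rw [ext_eq_zero_of_isZero hV (θ i y), map_zero]
  -- On probes, Hom(R i, X) is the dual of Hom(R' i, N), which `θ` identifies with the dual of
  -- Ext^{n+1}(V, R i).
  · refine h1.hasSerreDual (K := K) hR
      (fun i => ((r.w i).trans (θ i).symm.dualMap).toAddEquiv) fun i j a x α => ?_
    obtain ⟨y, rfl⟩ := (θ i).surjective α
    obtain ⟨y, rfl⟩ := exists_lift_of_epi hR'.proj (g 0) (hge 0) y
    have h3 : (θ i (y ≫ g 0)).push a = θ j ((o.op i j a ≫ y) ≫ g 0) := by
      rw [hθ, hθ, (p 0).ev_comp_op, Ext.push_push]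
    simp [h3, r.nat]

end TransposeResolution

/-! ### Finite dimensional objects -/

section FiniteDimensional

theorem Module.Finite.of_exact_of_finite {K V₁ V₂ V₃ : Type*} [Field K] [AddCommGroup V₁]
    [Module K V₁] [AddCommGroup V₂] [Module K V₂] [AddCommGroup V₃] [Module K V₃]
    {f : V₁ →ₗ[K] V₂} {g : V₂ →ₗ[K] V₃} (h : Function.Exact f g) [Module.Finite K V₁]
    [Module.Finite K V₃] : Module.Finite K V₂ := by
  have : Module.Finite K (LinearMap.ker g) := by
    rw [LinearMap.exact_iff.1 h]
    infer_instance
  have : Module.Finite K (V₂ ⧸ LinearMap.ker g) := Module.Finite.equiv g.quotKerEquivRange.symm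
  exact Module.Finite.of_submodule_quotient (LinearMap.ker g)

variable {K : Type*} [Field K] {C : Type*} [Category C] [Abelian C] [Linear K C] {ι : Type}
  {R : ι → C}

theorem IsFinDim.of_mono {X Y : C} (h : IsFinDim K R Y) (f : X ⟶ Y) (hf : Mono f) :
    IsFinDim K R X := by
  obtain ⟨h1, s, hs⟩ := h
  refine ⟨fun i => ?_, s, fun i hi x => ?_⟩
  · have := h1 i
    exact Module.Finite.of_injective (Linear.rightComp K (R i) f) fun a b hab => by
      simpa [cancel_mono] using hab
  · rw [← cancel_mono f, hs i hi (x ≫ f), zero_comp]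

theorem IsFinDim.of_epi (hR : ∀ i, Projective (R i)) {X Y : C} (h : IsFinDim K R X) (f : X ⟶ Y)
    (hf : Epi f) : IsFinDim K R Y := by
  obtain ⟨h1, s, hs⟩ := h
  refine ⟨fun i => ?_, s, fun i hi y => ?_⟩
  · have := h1 i
    exact Module.Finite.of_surjective (Linear.rightComp K (R i) f) fun y =>
      exists_lift_of_epi hR f hf y
  · obtain ⟨x, rfl⟩ := exists_lift_of_epi hR f hf y
    rw [hs i hi x, zero_comp]

/-- The sequence of linear maps obtained by testing a short exact sequence on a projective. -/
theorem CategoryTheory.ShortComplex.ShortExact.exact_rightComp {S : ShortComplex C}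
    (hS : S.ShortExact) (P : C) : Function.Exact (Linear.rightComp K P S.f)
      (Linear.rightComp K P S.g) := fun x => by
  constructor
  · intro hx
    exact hS.exists_lift x hx
  · rintro ⟨y, rfl⟩
    simp

theorem IsFinDim.of_shortExact {S : ShortComplex C} (hS : S.ShortExact) (h1 : IsFinDim K R S.X₁)
    (h3 : IsFinDim K R S.X₃) : IsFinDim K R S.X₂ := by
  classical
  obtain ⟨h1, s, hs⟩ := h1
  obtain ⟨h3, t, ht⟩ := h3
  refine ⟨fun i => ?_, s ∪ t, fun i hi x => ?_⟩
  · have := h1 i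
    have := h3 i
    exact Module.Finite.of_exact_of_finite (hS.exact_rightComp (K := K) (R i))
  · rw [Finset.mem_union, not_or] at hi
    obtain ⟨y, rfl⟩ := hS.exists_lift x (ht i hi.2 _)
    rw [hs i hi.1 y, zero_comp]

theorem IsFinDim.finrank_eq (hR : ∀ i, Projective (R i)) {S : ShortComplex C} (hS : S.ShortExact)
    (h : IsFinDim K R S.X₂) (i : ι) : Module.finrank K (R i ⟶ S.X₂) =
      Module.finrank K (R i ⟶ S.X₁) + Module.finrank K (R i ⟶ S.X₃) := by
  have := h.finite i
  have := hS.mono_f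
  rw [← LinearMap.finrank_range_add_finrank_ker (Linear.rightComp K (R i) S.g), add_comm]
  congr 1
  · rw [LinearMap.exact_iff.1 (hS.exact_rightComp (K := K) (R i))]
    exact LinearMap.finrank_range_of_inj fun a b hab => by simpa [cancel_mono] using hab
  · rw [LinearMap.range_eq_top.2, finrank_top]
    exact fun y => exists_lift_of_epi hR S.g hS.epi_g y

theorem IsFinDim.isZero (hR : IsDenseFamily R) {X : C} (h : IsFinDim K R X) {s : Finset ι}
    (hs : ∀ i ∉ s, ∀ x : R i ⟶ X, x = 0)
    (h0 : ∑ i ∈ s, Module.finrank K (R i ⟶ X) = 0) : IsZero X := by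
  refine hR.isZero_of fun i x => ?_
  by_cases hi : i ∈ s
  · have := h.finite i
    have h1 := Finset.sum_eq_zero_iff.1 h0 i hi
    have := Module.finrank_zero_iff.1 h1
    exact Subsingleton.elim _ _
  · exact hs i hi x

/-- Finite dimensional objects have finite length. -/
theorem IsFinDim.induction (hR : IsDenseFamily R) {𝒬 : C → Prop} (h0 : ∀ X, IsZero X → 𝒬 X)
    (hs : ∀ X, Simple X → IsFinDim K R X → 𝒬 X)
    (he : ∀ S : ShortComplex C, S.ShortExact → 𝒬 S.X₁ → 𝒬 S.X₃ → 𝒬 S.X₂) {X : C}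
    (hX : IsFinDim K R X) : 𝒬 X := by
  obtain ⟨s, hsX⟩ := hX.support
  generalize hm : ∑ i ∈ s, Module.finrank K (R i ⟶ X) = m
  -- The induction is on the total dimension over a support `s` that is kept fixed; `s` still
  -- supports all subobjects and quotients, and dimensions add up.
  induction m using Nat.strong_induction_on generalizing X with
  | _ m ih =>
    by_cases hz : IsZero X
    · exact h0 X hz
    by_cases hsX' : Simple X
    · exact hs X hsX' hX
    have : ∃ (A : C) (f : A ⟶ X), Mono f ∧ f ≠ 0 ∧ ¬ IsIso f := by
      by_contra! h
      refine hsX' ⟨fun {A} f _ => ⟨fun hi hf => ?_, fun hf => h A f inferInstance hf⟩⟩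
      exact hz ((IsZero.iff_id_eq_zero X).2 (by rw [← cancel_epi f, hf]; simp))
    obtain ⟨A, f, hf, hf0, hfi⟩ := this
    let S : ShortComplex C := ShortComplex.mk f (cokernel.π f) (cokernel.condition f)
    have hS : S.ShortExact := { exact := ShortComplex.exact_cokernel f }
    have hA := hX.of_mono f hf
    have hB := hX.of_epi hR.proj (cokernel.π f) inferInstance
    have hsA : ∀ i ∉ s, ∀ x : R i ⟶ A, x = 0 := fun i hi x => by
      rw [← cancel_mono f, hsX i hi (x ≫ f), zero_comp]
    have hsB : ∀ i ∉ s, ∀ x : R i ⟶ cokernel f, x = 0 := fun i hi y => by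
      obtain ⟨x, rfl⟩ := exists_lift_of_epi hR.proj (cokernel.π f) inferInstance y
      rw [hsX i hi x, zero_comp]
    have hsum : m = ∑ i ∈ s, Module.finrank K (R i ⟶ A) +
        ∑ i ∈ s, Module.finrank K (R i ⟶ cokernel f) := by
      rw [← hm, ← Finset.sum_add_distrib]
      exact Finset.sum_congr rfl fun i _ => IsFinDim.finrank_eq hR.proj hS hX i
    have hA0 : ∑ i ∈ s, Module.finrank K (R i ⟶ A) ≠ 0 := fun h =>
      hf0 ((hA.isZero hR hsA h).eq_of_src _ _)
    have hB0 : ∑ i ∈ s, Module.finrank K (R i ⟶ cokernel f) ≠ 0 := fun h => by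
      have : Epi f := Preadditive.epi_of_cokernel_zero ((hB.isZero hR hsB h).eq_of_tgt _ _)
      exact hfi (isIso_of_mono_of_epi f)
    exact he S hS (ih (∑ i ∈ s, Module.finrank K (R i ⟶ A)) (by omega) hA hsA rfl)
      (ih (∑ i ∈ s, Module.finrank K (R i ⟶ cokernel f)) (by omega) hB hsB rfl)

theorem IsFinDim.finite_hom {P X : C} (h : IsFinDim K R X) (hP : IsFGProj R P) :
    Module.Finite K (P ⟶ X) := by
  obtain ⟨m, t, e, p, hep⟩ := hP
  have := fun s => h.finite (t s)
  refine Module.Finite.of_injective (LinearMap.pi fun s => Linear.leftComp K X (p s)) fun a b hab => ?_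
  rw [← Category.id_comp a, ← Category.id_comp b, ← hep, Preadditive.sum_comp,
    Preadditive.sum_comp]
  refine Finset.sum_congr rfl fun s _ => ?_
  have := congrFun hab s
  simp only [LinearMap.pi_apply, Linear.leftComp_apply] at this
  rw [Category.assoc, Category.assoc, this]

theorem IsFinDim.finite_hom_of_hasFPRes {n : ℕ} {M X : C} (h : IsFinDim K R X)
    (hM : HasFPRes R n M) : Module.Finite K (M ⟶ X) := by
  obtain ⟨S, hS, rfl, h2, -⟩ := hM.hasFPResInf.exists_shortExact
  have := h.finite_hom h2
  have := hS.epi_g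
  exact Module.Finite.of_injective (Linear.leftComp K X S.g) fun a b hab => by
    simpa [cancel_epi] using hab

end FiniteDimensional

/-! ### Tops and projective dimension -/

section Tops

variable {C : Type*} [Category C] [Abelian C] {ι : Type} {R : ι → C}

/-- An epimorphism such that all endomorphisms of its source over its target are isomorphisms. -/
structure IsTopQuotient {L T : C} (π : L ⟶ T) : Prop where
  epi : Epi π
  isIso : ∀ e : L ⟶ L, e ≫ π = π → IsIso e

variable [HasExt.{u} C]

/-- As the Ext group vanishes, `π` extends to `S.X₂`; as `S.X₂` is projective, the extension lifts
to `k : S.X₂ ⟶ S.X₁`. Then `S.f ≫ k` lies over `π`, so it is invertible and the sequence splits. -/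
theorem IsTopQuotient.projective {S : ShortComplex C} (hS : S.ShortExact) (hP : Projective S.X₂) {T : C}
    {π : S.X₁ ⟶ T} (hπ : IsTopQuotient π) (h : Subsingleton (Ext S.X₃ T 1)) : Projective S.X₃ := by
  obtain ⟨g, hg⟩ := (subsingleton_ext_one_iff hS hP T).1 h π
  have := hπ.epi
  let k : S.X₂ ⟶ S.X₁ := Projective.factorThru g π
  have hk : k ≫ π = g := Projective.factorThru_comp g π
  have : IsIso (S.f ≫ k) := hπ.isIso _ (by rw [Category.assoc, hk, hg])
  let s := ShortComplex.Splitting.ofExactOfRetraction S hS.exact (k ≫ inv (S.f ≫ k))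
    (by rw [← Category.assoc, IsIso.hom_inv_id]) hS.epi_g
  exact Retract.projective ⟨s.s, S.g, s.s_g⟩

/-- Dimension shifting moves the vanishing to an Ext^1 of a late syzygy, where the top of the final
term tests projectivity. -/
theorem HasFPRes.hasProjectiveDimensionLT_of_tops {K : Type*} [Field K] [Linear K C]
    (hR : ∀ i, Projective (R i))
    (htop : ∀ L : C, IsFGProj R L → ∃ (T : C) (π : L ⟶ T), IsFinDim K R T ∧ IsTopQuotient π) {k : ℕ} {M : C}
    (hM : HasFPRes R (k + 1) M) (h : ∀ T, IsFinDim K R T → Subsingleton (Ext M T (k + 1))) :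
    HasProjectiveDimensionLT M (k + 1) := by
  induction k generalizing M with
  | zero =>
    obtain ⟨S, hS, rfl, h2, h1⟩ := hM
    obtain ⟨T, π, hT, hπ⟩ := htop _ h1
    have := hπ.projective hS (h2.projective hR) (h T hT)
    infer_instance
  | succ k ih =>
    obtain ⟨S, hS, rfl, h2, h1⟩ := hM
    have := h2.projective hR
    exact hS.hasProjectiveDimensionLT_X₃ (k + 1) (ih h1 fun T hT =>
      (subsingleton_ext_succ_iff hS this T k).1 (h T hT)) inferInstance

/-- A class of objects with enough tops, each of which satisfies `𝒯`. -/
structure IsClassWithTops (G 𝒯 : C → Prop) : Prop where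
  step : ∀ Q, G Q → ∃ S : ShortComplex C, S.ShortExact ∧ S.X₃ = Q ∧ Projective S.X₂ ∧ G S.X₁
  top : ∀ Q, G Q → ∃ (T : C) (π : Q ⟶ T), IsTopQuotient π ∧ 𝒯 T

theorem IsClassWithTops.hasProjectiveDimensionLT {G 𝒯 : C → Prop} (hG : IsClassWithTops G 𝒯)
    {k : ℕ} {Q : C} (hQ : G Q) (h : ∀ T, 𝒯 T → Subsingleton (Ext Q T (k + 1))) :
    HasProjectiveDimensionLT Q (k + 1) := by
  induction k generalizing Q with
  | zero =>
    obtain ⟨S, hS, rfl, h2, h1⟩ := hG.step Q hQ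
    obtain ⟨T, π, hπ, hT⟩ := hG.top _ h1
    have := hπ.projective hS h2 (h T hT)
    infer_instance
  | succ k ih =>
    obtain ⟨S, hS, rfl, h2, h1⟩ := hG.step Q hQ
    exact hS.hasProjectiveDimensionLT_X₃ (k + 1) (ih h1 fun T hT =>
      (subsingleton_ext_succ_iff hS h2 T k).1 (h T hT)) inferInstance

theorem HasFreeCovers.enoughProjectives (hF : HasFreeCovers R) : EnoughProjectives C :=
  ⟨fun X => by
    obtain ⟨F, p, hp, hpr, -⟩ := hF X
    exact ⟨⟨F, p⟩⟩⟩

end Tops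

/-! ### Families with a duality -/

section Dualizing

variable {K : Type*} [Field K] {C C' : Type*} [Category C] [Abelian C] [Linear K C]
  [Category C'] [Abelian C'] [Linear K C'] {ι : Type} {R : ι → C} {R' : ι → C'}

/-- Duality preserves simple objects. -/
theorem DualPairing.simple {o : OppositeFamilies K R R'} (hR : IsDenseFamily R)
    (hR' : IsDenseFamily R') (hD : ∀ N : C', ∃ X, Nonempty (DualPairing o X N)) {X : C} {N : C'}
    (p : DualPairing o X N) [Simple X] : Simple N := by
  refine ⟨fun {A} f _ => ⟨fun hi hf => ?_, fun hf => ?_⟩⟩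
  · refine Simple.not_isZero X ((p.isZero_iff hR hR').2 ((IsZero.iff_id_eq_zero N).2 ?_))
    rw [← cancel_epi f, hf]
    simp
  · let S : ShortComplex C' := ShortComplex.mk f (cokernel.π f) (cokernel.condition f)
    have hS : S.ShortExact := { exact := ShortComplex.exact_cokernel f }
    obtain ⟨Y, ⟨q⟩⟩ := hD A
    obtain ⟨Z, ⟨r⟩⟩ := hD (cokernel f)
    obtain ⟨a, b, w, hT, ha, hb⟩ := DualPairing.exists_shortExact hR hR' hS q p r
    have := hT.mono_f
    have := hT.epi_g
    dsimp only at *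
    -- The mono `a` from the dual of the cokernel into the simple `X` is zero or invertible; in the
    -- second case the dual of `A` vanishes and `f` is zero.
    have ha0 : a = 0 := by
      by_contra h0
      have := isIso_of_mono_of_nonzero h0
      have hb0 : b = 0 := by rw [← cancel_epi a, w, comp_zero]
      have hY : IsZero Y := (IsZero.iff_id_eq_zero Y).2 (by rw [← cancel_epi b, hb0]; simp)
      exact hf (((q.isZero_iff hR hR').1 hY).eq_of_src _ _)
    have hZ : IsZero Z := (IsZero.iff_id_eq_zero Z).2 (by rw [← cancel_mono a, ha0]; simp)
    have : Epi f := Preadditive.epi_of_cokernel_zero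
      (((r.isZero_iff hR hR').1 hZ).eq_of_tgt _ _)
    exact isIso_of_mono_of_epi f

variable [HasExt.{u} C] [HasExt.{u} C']

/-- The properties of the categories of left and right modules over an algebra which are used to
construct almost split sequences. -/
structure IsDualizing (o : OppositeFamilies K R R') : Prop where
  dense : IsDenseFamily R
  dense' : IsDenseFamily R'
  cover : HasFreeCovers R
  dual : ∀ N : C', ∃ X : C, Nonempty (DualPairing o X N)
  dual' : ∀ M : C, ∃ L : C', Nonempty (DualPairing o.symm L M)
  hom : ∀ N : C', ∃ X : C, Nonempty (ExtDual o 0 X N)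
  top : ∀ L : C, IsFGProj R L → ∃ (T : C) (π : L ⟶ T), IsFinDim K R T ∧ IsTopQuotient π
  top' : ∃ G : C' → Prop, IsClassWithTops G (fun T => ∃ X, Nonempty (DualPairing o.symm T X)) ∧
    ∀ Q, IsFinDim K R' Q → G Q
  finDim : ∀ S : C, Simple S → IsFinDim K R S
  fin : ∀ T : C, Simple T → ∃ S : ShortComplex C, S.ShortExact ∧ S.X₃ = T ∧ IsFGProj R S.X₂ ∧
    IsFinGen R S.X₁
  fin' : ∀ T : C', Simple T → ∃ S : ShortComplex C', S.ShortExact ∧ S.X₃ = T ∧ IsFGProj R' S.X₂ ∧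
    IsFinGen R' S.X₁

/-- No bound on the global dimension is required, so this direction of `hCat_iff` is also available
for right modules. -/
theorem HCat.hasFPRes (hR : ∀ i, Projective (R i)) {n : ℕ} {M : C} (h : HCat R n M) :
    HasFPRes R n M ∧ (∀ i < n, ∀ t, Subsingleton (Ext M (R t) i)) ∧ ¬ IsZero M := by
  obtain ⟨hpd, hext, P, hP⟩ := h
  refine ⟨(hasFPResInf_of_projectiveResolution P hP).hasFPRes hR
    ((projectiveDimension_le_iff M n).1 hpd.le),
    fun i hi t => hext i hi.ne t, fun h => ?_⟩
  rw [(projectiveDimension_eq_bot_iff M).2 h] at hpd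
  exact absurd hpd (WithBot.bot_ne_coe)

variable {o : OppositeFamilies K R R'} {n : ℕ}

/-- Finite dimensional objects on the other side have projective dimension at most `n`. -/
theorem IsDualizing.hasProjectiveDimensionLT (hd : IsDualizing o)
    (hn : ∀ X : C, HasProjectiveDimensionLT X (n + 1)) {Q : C'} (hQ : IsFinDim K R' Q) :
    HasProjectiveDimensionLT Q (n + 1) := by
  obtain ⟨G, hG, hG'⟩ := hd.top'
  refine hG.hasProjectiveDimensionLT (hG' Q hQ) ?_
  -- Only the left global dimension is known. The test objects on the right are duals DX, and
  -- Ext^{n+1}(Q, DX) vanishes together with the left group Ext^{n+1}(X, DQ).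
  rintro T ⟨X, ⟨q⟩⟩
  obtain ⟨X', ⟨p⟩⟩ := hd.dual Q
  have := hd.cover.enoughProjectives
  rw [DualPairing.subsingleton_ext_iff hd.dense hd.dense' hd.dual hd.dual' p q n]
  have := hn X
  exact HasProjectiveDimensionLT.subsingleton X (n + 1) (n + 1) le_rfl X'

/-- This is the concrete form T = D tr^n M of the Serre dual: probed by `R i`, it is the dual of
Ext^n(M, R i). -/
theorem HasFPRes.hasSerreDual_of_dual (hR : IsDenseFamily R) {M T : C} {N : C'}
    (hM : HasFPRes R n M) (q : ExtDual o.symm n N M) (p : DualPairing o T N) :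
    HasSerreDual K n M T := by
  refine hM.hasSerreDual (K := K) hR (fun i => ((p.w i).trans (q.u i).symm.dualMap).toAddEquiv)
    fun i j a x α => ?_
  obtain ⟨y, rfl⟩ := (q.u i).surjective α
  have := q.nat (o.op i j a) y
  simp only [OppositeFamilies.symm_op, LinearEquiv.symm_apply_apply] at this
  simp [← this, p.nat]

/-- An object of `H^n` has a nonzero extension by a simple object. -/
theorem IsDualizing.exists_simple (hd : IsDualizing o) (hn : n ≠ 0) {M : C} (hM : HCat R n M) :
    ∃ W : C, Simple W ∧ ¬ Subsingleton (Ext M W n) := by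
  by_contra! h
  obtain ⟨m, rfl⟩ := Nat.exists_eq_succ_of_ne_zero hn
  have h1 := (hM.hasFPRes hd.dense.proj).1
  -- If Ext^n(M, -) killed all simples, it would kill all finite dimensional objects by finite
  -- length, in particular the tops used for testing, and the projective dimension would drop below
  -- n.
  have : HasProjectiveDimensionLT M (m + 1) :=
    h1.hasProjectiveDimensionLT_of_tops hd.dense.proj hd.top fun T hT => by
      refine hT.induction hd.dense (𝒬 := fun T => Subsingleton (Ext M T (m + 1))) ?_
        (fun X hX _ => h X hX) ?_
      · intro X hX
        refine subsingleton_of_forall_eq 0 fun α => ?_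
        have : α.push (𝟙 X) = α := by simp
        rw [← this, hX.eq_of_src (𝟙 X) 0, Ext.push_zero]
      · intro S hS h1 h3
        refine subsingleton_of_forall_eq 0 fun α => ?_
        obtain ⟨β, rfl⟩ := Ext.covariant_sequence_exact₂ M hS α (Subsingleton.elim _ _)
        rw [Subsingleton.elim β 0, Ext.zero_comp]
  have h2 := (projectiveDimension_lt_iff (X := M) (n := m + 1)).2 this
  rw [hM.1] at h2
  exact lt_irrefl _ h2

/-- The conditions in the definition of generalized Artin-Schelter regularity produce a simple
object of `H^n` whose Serre dual is a given simple object. -/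
theorem IsDualizing.exists_simple_hasSerreDual (hd : IsDualizing o) (hn : n ≠ 0) {tr' : C' → C}
    (hreg : IsGenASRegular R R' tr' n) (htr' : ∀ N, Nonempty (ExtDual o n (tr' N) N))
    (htr : ∀ M : C, ∃ N : C', Nonempty (ExtDual o.symm n N M)) {M W : C} [Simple W]
    (h : ¬ Subsingleton (Ext M W n)) :
    ∃ T : C, Simple T ∧ HCat R n T ∧ HasSerreDual K n T W := by
  have hpd := hasProjectiveDimensionLT_of_globalDim hreg.globalDim_eq
  obtain ⟨S, ⟨q⟩⟩ := hd.dual' W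
  have hW := hd.finDim W inferInstance
  let p : DualPairing o W S := q.symm hW.finite
  have hS : Simple S := p.simple hd.dense hd.dense' hd.dual
  have hSf : IsFinDim K R' S := p.isFinDim_iff.2 hW
  -- The lower bound comes from exchanging duals: Ext^n(S, DM) is nonzero because Ext^n(M, DS) =
  -- Ext^n(M, W) is.
  have hpdS : projectiveDimension S = n := by
    refine le_antisymm ((projectiveDimension_le_iff S n).2 (hd.hasProjectiveDimensionLT hpd hSf))
      ((projectiveDimension_ge_iff S n).2 fun hlt => h ?_)
    obtain ⟨L, ⟨r⟩⟩ := hd.dual' M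
    obtain ⟨m, rfl⟩ := Nat.exists_eq_succ_of_ne_zero hn
    have := hd.cover.enoughProjectives
    rw [← DualPairing.subsingleton_ext_iff hd.dense hd.dense' hd.dual hd.dual' p r m]
    exact HasProjectiveDimensionLT.subsingleton S (m + 1) (m + 1) le_rfl L
  obtain ⟨hS1, hS2, hS3⟩ := (hreg.simple_mem' S hS hpdS).hasFPRes hd.dense'.proj
  obtain ⟨T, hT, hTH, f, hf⟩ := hreg.simple_sub S hS hpdS
  refine ⟨T, hT, hTH, ?_⟩
  -- The transpose of `S` has Serre dual DS, which is `W` again.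
  obtain ⟨-, -, -, tV, htV⟩ := hS1.transpose hd.dense hd.dense' hd.hom hn hS2 hS3
    (htr' S).some p
  obtain ⟨hT1, hT2, hT3⟩ := hTH.hasFPRes hd.dense.proj
  obtain ⟨N, ⟨r⟩⟩ := htr T
  obtain ⟨X, ⟨r'⟩⟩ := hd.dual N
  obtain ⟨tT, htT⟩ := hT1.hasSerreDual_of_dual hd.dense r r'
  -- The morphism `a` between the Serre duals of `T` and of `tr' S` is dual to restriction of
  -- classes along `f`.
  obtain ⟨a, ha, -⟩ := htV X (tT ∘ₗ Ext.pullₗ K X n f)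
  replace ha : ∀ β, tV (β.push a) = tT (Ext.pull f β) := ha
  -- Ext^n is right exact by the bound on projective dimensions, so every class on `T` is a
  -- restriction along `f`; the dual of a surjection is injective.
  have ham : Mono a := by
    refine Preadditive.mono_of_cancel_zero a fun {Y} x hx => htT.eq_zero_of_forall fun γ => ?_
    have hV : (ShortComplex.mk _ _ (cokernel.condition f)).ShortExact :=
      { exact := ShortComplex.exact_cokernel f }
    obtain ⟨β, rfl⟩ := exists_pull_eq hpd hV γ
    rw [Ext.pull_push, ← ha, Ext.push_push, hx]
    simp
  -- Otherwise the Serre dual of `T` is zero, so all Ext groups from `T` to `R` vanish up to degree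
  -- n, and `T` is zero.
  have ha0 : a ≠ 0 := by
    rintro rfl
    have hX : IsZero X := (IsZero.iff_id_eq_zero X).2 (by
      rw [← cancel_mono (0 : X ⟶ W)]
      simp)
    refine hT3 (hT1.isZero hd.dense.proj fun i hi t => ?_)
    rcases hi.lt_or_eq with hi | rfl
    · exact hT2 i hi t
    · exact subsingleton_of_forall_eq 0 fun α => htT.class_eq_zero fun g => by
        rw [hX.eq_of_tgt g 0]
        simp
  have := isIso_of_mono_of_nonzero ha0
  exact HasSerreDual.of_iso ⟨tT, htT⟩ (asIso a)

/-- Every object of `H^n` has a simple subobject in `H^n`, with quotient in `H^n` or zero. -/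
theorem IsDualizing.exists_filtration_step (hd : IsDualizing o) (hn : n ≠ 0) {tr' : C' → C}
    (hreg : IsGenASRegular R R' tr' n) (htr' : ∀ N, Nonempty (ExtDual o n (tr' N) N))
    (htr : ∀ M : C, ∃ N : C', Nonempty (ExtDual o.symm n N M)) {M : C} (hM : HCat R n M) :
    ∃ (W T U : C) (f : T ⟶ M) (g : M ⟶ U) (w : f ≫ g = 0), Simple W ∧ Simple T ∧
      ¬ Subsingleton (Ext M W n) ∧ HasSerreDual K n T W ∧ HCat R n T ∧
      (ShortComplex.mk f g w).ShortExact ∧ (¬ IsZero U → HCat R n U) := by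
  have hpd := hasProjectiveDimensionLT_of_globalDim hreg.globalDim_eq
  obtain ⟨W, hW, hMW⟩ := hd.exists_simple hn hM
  obtain ⟨T, hT, hTH, t, ht⟩ := hd.exists_simple_hasSerreDual hn hreg htr' htr hMW
  obtain ⟨hT1, hT2, hT3⟩ := hTH.hasFPRes hd.dense.proj
  obtain ⟨hM1, hM2, hM3⟩ := hM.hasFPRes hd.dense.proj
  have htp := ht.isPerfectTrace hd.dense.proj hd.cover hT1 hT2
  -- Since `W` is the Serre dual of `T`, Ext^n(M, W) is dual to Hom(T, M), which is therefore
  -- nonzero.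
  obtain ⟨f, hf⟩ : ∃ f : T ⟶ M, f ≠ 0 := by
    by_contra! h
    exact hMW (subsingleton_of_forall_eq 0 fun β => htp.class_eq_zero fun f => by
      rw [h f]
      simp)
  have hfm : Mono f := Preadditive.mono_of_kernel_zero (kernel_zero_of_nonzero_from_simple hf)
  have hS : (ShortComplex.mk _ _ (cokernel.condition f)).ShortExact :=
    { exact := ShortComplex.exact_cokernel f }
  refine ⟨W, T, cokernel f, f, cokernel.π f, cokernel.condition f, hW, hT, hMW, ⟨t, ht⟩, hTH, hS,
    fun hU => (hCat_iff hd.dense.proj hpd _).2 ⟨?_, fun i hi t => ?_, hU⟩⟩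
  · exact (HasFPResInf.of_cokernel hd.dense hS hT1.hasFPResInf hM1.hasFPResInf).hasFPRes
      hd.dense.proj (hpd _)
  · have := hM2 i hi t
    refine subsingleton_of_forall_eq 0 fun α => ?_
    cases i with
    | zero =>
      obtain ⟨a, rfl⟩ := Ext.addEquiv₀.symm.surjective α
      have h1 : cokernel.π f ≫ a = 0 := Ext.addEquiv₀.symm.injective (Subsingleton.elim _ _)
      have h2 : a = 0 := by rw [← cancel_epi (cokernel.π f), h1, comp_zero]
      rw [h2, map_zero]
    | succ i =>
      have := hT2 i (by omega) t
      -- Ext^{i+1} of the quotient lies between Ext^i of `T` and Ext^{i+1} of `M`, both zero because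
      -- i + 1 < n.
      obtain ⟨β, rfl⟩ := Ext.contravariant_sequence_exact₃ hS (R t) α (Subsingleton.elim _ _)
        (add_comm 1 i)
      rw [Subsingleton.elim β 0, Ext.comp_zero]

end Dualizing

/-! ### Extensions from classes -/

section Extensions

variable {C : Type*} [Category C] [Abelian C] [HasExt.{u} C] {ι : Type} {R : ι → C}

/-- Every class of degree one is the class of an extension. -/
theorem exists_shortExact_of_class [EnoughProjectives C] {Z A : C} (η : Ext Z A 1) :
    ∃ (B : C) (f : A ⟶ B) (g : B ⟶ Z) (w : f ≫ g = 0) (h : (ShortComplex.mk f g w).ShortExact),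
      h.extClass = η := by
  obtain ⟨P, e⟩ := (EnoughProjectives.presentation Z).some
  rename_i hP he
  let S : ShortComplex C := ShortComplex.mk (kernel.ι e) e (kernel.condition e)
  have hS : S.ShortExact := { exact := ShortComplex.exact_kernel e }
  obtain ⟨β, rfl⟩ := hS.exists_extClass_comp hP (k := 0) η
  obtain ⟨ψ, rfl⟩ := Ext.addEquiv₀.symm.surjective β
  -- The class is the image of a morphism `ψ` out of the syzygy of `Z`, and the extension is the
  -- pushout of a projective presentation along `ψ`.
  let g : pushout (kernel.ι e) ψ ⟶ Z := pushout.desc e 0 (by rw [kernel.condition, comp_zero])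
  have w : pushout.inr (kernel.ι e) ψ ≫ g = 0 := pushout.inr_desc _ _ _
  have hl : pushout.inl (kernel.ι e) ψ ≫ g = e := pushout.inl_desc _ _ _
  let T : ShortComplex C := ShortComplex.mk (pushout.inr (kernel.ι e) ψ) g w
  let k : IsColimit (CokernelCofork.ofπ g w) := CokernelCofork.IsColimit.ofπ _ _
    (fun {W} a ha => hS.exact.desc (pushout.inl (kernel.ι e) ψ ≫ a)
      (by dsimp only [S]; rw [← Category.assoc, pushout.condition, Category.assoc, ha, comp_zero]))
    (fun {W} a ha => by
      apply pushout.hom_ext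
      · rw [← Category.assoc, hl]
        exact hS.exact.g_desc _ _
      · rw [← Category.assoc, w, zero_comp, ha])
    (fun {W} a ha m hm => by
      rw [← cancel_epi e]
      refine Eq.trans ?_ (hS.exact.g_desc _ _).symm
      rw [← hm, ← Category.assoc, hl])
  have hT : T.ShortExact :=
    { exact := T.exact_of_g_is_cokernel k
      mono_f := by dsimp [T]; infer_instance
      epi_g := by
        have : Epi (pushout.inl (kernel.ι e) ψ ≫ g) := by rw [hl]; infer_instance
        exact epi_of_epi (pushout.inl (kernel.ι e) ψ) g }
  refine ⟨_, _, _, w, hT, ?_⟩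
  have := ShortComplex.ShortExact.extClass_naturality hS hT
    { τ₁ := ψ, τ₂ := pushout.inl (kernel.ι e) ψ, τ₃ := 𝟙 Z, comm₁₂ := pushout.condition.symm,
      comm₂₃ := by simp [S, T, hl] }
  rw [Ext.mk₀_id_comp] at this
  exact this.symm

theorem hCat_of_shortExact (hR : IsDenseFamily R) {n : ℕ}
    (hn : ∀ X : C, HasProjectiveDimensionLT X (n + 1)) {S : ShortComplex C} (hS : S.ShortExact)
    (h1 : HCat R n S.X₁) (h3 : HCat R n S.X₃) : HCat R n S.X₂ := by
  obtain ⟨a1, b1, c1⟩ := h1.hasFPRes hR.proj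
  obtain ⟨a3, b3, c3⟩ := h3.hasFPRes hR.proj
  refine (hCat_iff hR.proj hn _).2 ⟨?_, fun i hi t => ?_, fun h => c1 ?_⟩
  · exact (HasFPResInf.of_shortExact hR hS a1.hasFPResInf a3.hasFPResInf).hasFPRes hR.proj (hn _)
  · have := b1 i hi t
    have := b3 i hi t
    refine subsingleton_of_forall_eq 0 fun α => ?_
    obtain ⟨β, rfl⟩ := Ext.contravariant_sequence_exact₂ hS (R t) α (Subsingleton.elim _ _)
    rw [Subsingleton.elim β 0, Ext.comp_zero]
  · have := hS.mono_f
    exact (IsZero.iff_id_eq_zero _).2 (by rw [← cancel_mono S.f, h.eq_of_tgt (𝟙 _ ≫ S.f) 0, zero_comp])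

/-- Realize the class by an extension, whose middle term is in H^1 by closure under extensions. By
the long exact sequences the factorization properties are exactly the vanishing of pullbacks and
pushouts. -/
theorem exists_isAlmostSplitSequence [EnoughProjectives C] (hR : IsDenseFamily R)
    (hn : ∀ X : C, HasProjectiveDimensionLT X (1 + 1)) {Z A : C} (hZ : HCat R 1 Z)
    (hA : HCat R 1 A) (hZi : Indecomposable Z) (hAi : Indecomposable A) (η : Ext Z A 1)
    (h0 : η ≠ 0) (h1 : ∀ (X : C) (f : X ⟶ Z), ¬ IsSplitEpi f → Ext.pull f η = 0)
    (h2 : ∀ (Y : C) (g : A ⟶ Y), ¬ IsSplitMono g → η.push g = 0) :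
    ∃ S, IsAlmostSplitSequence (HCat R 1) S ∧ S.X₁ = A ∧ S.X₃ = Z := by
  obtain ⟨B, f, g, w, hS, rfl⟩ := exists_shortExact_of_class η
  refine ⟨_, ⟨hS, hA, hCat_of_shortExact hR hn hS hA hZ, hZ, hAi, hZi, ⟨fun s => h0 ?_⟩,
    fun X a _ ha => ?_, fun Y a _ ha => ?_⟩, rfl, rfl⟩
  · have h3 : hS.extClass.push (f ≫ s.r) = 0 := (hS.extClass_push_eq_zero_iff _).2 ⟨s.r, rfl⟩
    have h4 : f ≫ s.r = 𝟙 A := s.f_r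
    rw [h4] at h3
    simpa using h3
  · obtain ⟨b, hb⟩ := Ext.covariant_sequence_exact₃ X hS (Ext.mk₀ a) (zero_add 1)
      (by rw [Ext.mk₀_comp_eq_pull]; exact h1 X a ha)
    obtain ⟨b, rfl⟩ := Ext.addEquiv₀.symm.surjective b
    exact ⟨b, Ext.addEquiv₀.symm.injective (by simpa using hb)⟩
  · obtain ⟨b, hb⟩ := (hS.extClass_push_eq_zero_iff a).1 (h2 Y a ha)
    exact ⟨b, hb.symm⟩

/-- In dimension at most one, the finitely generated kernel in a presentation of a simple object is
projective; composition series and the horseshoe do the rest. -/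
theorem hasFPResInf_of_isFinDim {K : Type*} [Field K] [Linear K C] (hR : IsDenseFamily R)
    (hfin : ∀ T : C, Simple T → ∃ S : ShortComplex C, S.ShortExact ∧ S.X₃ = T ∧
      IsFGProj R S.X₂ ∧ IsFinGen R S.X₁)
    (hn : ∀ X : C, IsFinDim K R X → HasProjectiveDimensionLT X (1 + 1)) {T : C}
    (hT : IsFinDim K R T) : HasFPResInf R T := by
  refine hT.induction hR (fun X hX => ?_) (fun X hX hXf => ?_)
    (fun S hS h1 h3 => HasFPResInf.of_shortExact hR hS h1 h3)
  · exact HasFPRes.hasFPResInf (k := 0) (isFGProj_of_isZero hX)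
  · obtain ⟨S, hS, rfl, h2, h1⟩ := hfin X hX
    have := h2.projective hR.proj
    have : HasProjectiveDimensionLT S.X₁ 1 :=
      hS.hasProjectiveDimensionLT_X₁ 1 inferInstance (hn _ hXf)
    have : Projective S.X₁ := inferInstance
    exact HasFPRes.hasFPResInf (k := 1) ⟨S, hS, rfl, h2, h1.isFGProj this⟩

end Extensions

/-! ### Almost split sequences and almost split extensions -/

section Main

variable {K : Type*} [Field K] {C C' : Type*} [Category C] [Abelian C] [Linear K C]
  [Category C'] [Abelian C'] [Linear K C'] {ι : Type} {R : ι → C} {R' : ι → C'}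
  [HasExt.{u} C] [HasExt.{u} C'] {o : OppositeFamilies K R R'} {n : ℕ}

/-- Finiteness of the groups `Ext^n(M, Λ)`. -/
structure IsExtFinDim (K : Type*) [Field K] {C : Type*} [Category C] [Abelian C] [Linear K C]
    [HasExt.{u} C] (R : ι → C) (n : ℕ) (M : C) : Prop where
  finite : ∀ i, Module.Finite K (Ext M (R i) n)
  support : ∃ s : Finset ι, ∀ i ∉ s, ∀ α : Ext M (R i) n, α = 0

theorem IsExtFinDim.isFinDim {M : C} {N : C'} (q : ExtDual o.symm n N M)
    (h : IsExtFinDim K R n M) : IsFinDim K R' N := by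
  obtain ⟨h1, s, hs⟩ := h
  exact ⟨fun i => have := h1 i; Module.Finite.equiv (q.u i).symm, s,
    fun i hi x => (q.u i).injective (by rw [hs i hi (q.u i x), map_zero])⟩

/-- The two alternatives in `hi` serve the two existence statements: either the end `Z` is given as
indecomposable, or the start `T` is known to have a local endomorphism ring, which then passes to
`Z`. -/
theorem exists_almostSplit_of_hCat (hd : IsDualizing o) {Z T : C} (hZ : HCat R n Z)
    (hKS : IsKrullSchmidt (HCat R n)) (hZf : IsFinDim K R Z) (hT : HasSerreDual K n Z T)
    (hi : Indecomposable Z ∨ HasLocalEnd T) :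
    HasLocalEnd Z ∧ HasLocalEnd T ∧ ∃ t : Ext Z T n →ₗ[K] K, IsPerfectTrace t ∧
    ∃ η : Ext Z T n, η ≠ 0 ∧
      (∀ (X : C) (f : X ⟶ Z), ¬ IsSplitEpi f → Ext.pull f η = 0) ∧
      ∀ (Y : C) (g : T ⟶ Y), ¬ IsSplitMono g → η.push g = 0 := by
  obtain ⟨t, ht⟩ := hT
  obtain ⟨h1, h2, -⟩ := hZ.hasFPRes hd.dense.proj
  have htp := ht.isPerfectTrace hd.dense.proj hd.cover h1 h2
  have := hZf.finite_hom_of_hasFPRes h1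
  have hl : HasLocalEnd Z := hi.elim (fun hi => hKS.hasLocalEnd hZ hi) htp.hasLocalEnd.2
  exact ⟨hl, htp.hasLocalEnd.1 hl, t, htp, htp.exists_almostSplit hl⟩

/-- The conditions on `Λ`, `tr`, `D` and `H^n` under which the main theorem is proved. -/
structure IsAlmostSplitSetting (o : OppositeFamilies K R R') (n : ℕ) (D : C → C') (τ : C → C) :
    Prop where
  dualizing : IsDualizing o
  ne_zero : n ≠ 0
  pd : ∀ X : C, HasProjectiveDimensionLT X (n + 1)
  ks : IsKrullSchmidt (HCat R n)
  transpose : ∀ N : C', ∃ V : C, Nonempty (ExtDual o n V N)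
  dual : ∀ M, Nonempty (DualPairing o.symm (D M) M)
  dualTr : ∀ M, ∃ N, Nonempty (ExtDual o.symm n N M) ∧ Nonempty (DualPairing o (τ M) N)
  finDim : ∀ M, HCat R n M → IsFinDim K R M
  extFinDim : ∀ M, HCat R n M → IsExtFinDim K R n M

variable {D : C → C'} {τ : C → C}

/-- Take V = tr^n N for N = DA. Its Serre dual is DN, which is `A` because finite dimensional
objects are reflexive. -/
theorem IsAlmostSplitSetting.exists_transpose (h : IsAlmostSplitSetting o n D τ) {A : C}
    (hA : HCat R n A) {N : C'} (q : DualPairing o.symm N A) (h1 : HasFPRes R' n N)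
    (h2 : ∀ i < n, ∀ t, Subsingleton (Ext N (R' t) i)) (h3 : ¬ IsZero N) :
    ∃ V, HCat R n V ∧ HasSerreDual K n V A := by
  obtain ⟨V, ⟨r⟩⟩ := h.transpose N
  have hd := h.dualizing
  obtain ⟨v1, v2, v3, v4⟩ := h1.transpose hd.dense hd.dense' hd.hom h.ne_zero h2 h3 r
    (q.symm (h.finDim A hA).finite : DualPairing o A N)
  exact ⟨V, (hCat_iff hd.dense.proj h.pd V).2 ⟨v1, v2, v3⟩, v4⟩

theorem IsAlmostSplitSetting.hasAlmostSplitExts (h : IsAlmostSplitSetting o n D τ)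
    {H' : C' → Prop} (hH' : ∀ N, H' N → HCat R' n N) :
    HasAlmostSplitExts (HCat R n) H' D τ n := by
  have hd := h.dualizing
  constructor
  · intro Z hZ hZi
    obtain ⟨N, ⟨q⟩, ⟨p⟩⟩ := h.dualTr Z
    obtain ⟨-, -, t, ht, η, h0, h1, h2⟩ := exists_almostSplit_of_hCat hd hZ h.ks (h.finDim Z hZ)
      ((hZ.hasFPRes hd.dense.proj).1.hasSerreDual_of_dual hd.dense q p) (.inl hZi)
    exact ⟨η, h0, fun X f _ hf => h1 X f hf, fun Y g _ hg => h2 Y g hg⟩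
  · intro A hA hAi hDA
    obtain ⟨b1, b2, b3⟩ := (hH' _ hDA).hasFPRes hd.dense'.proj
    obtain ⟨V, hV, hVA⟩ := h.exists_transpose hA (h.dual A).some b1 b2 b3
    obtain ⟨hl, -, t, ht, η, h0, h1, h2⟩ := exists_almostSplit_of_hCat hd hV h.ks (h.finDim V hV)
      hVA (.inr (h.ks.hasLocalEnd hA hAi))
    exact ⟨V, hV, hl.indecomposable, η, h0, fun X f _ hf => h1 X f hf, fun Y g _ hg => h2 Y g hg⟩

theorem exists_image_factorization {C : Type*} [Category C] [Abelian C] {X Y : C} (f : X ⟶ Y) :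
    ∃ (J : C) (e : X ⟶ J) (m : J ⟶ Y), Epi e ∧ Mono m ∧ e ≫ m = f :=
  ⟨_, Limits.factorThruImage f, Limits.image.ι f, inferInstance, inferInstance,
    Limits.image.fac f⟩

/-- Beyond the almost split class, the point is that τZ lies in H^1. It is finite dimensional, hence
resolved, and the object `L` excludes nonzero maps to the generators. -/
theorem IsAlmostSplitSetting.exists_ending (h : IsAlmostSplitSetting o 1 D τ) {Z L : C}
    (hZ : HCat R 1 Z) (hZi : Indecomposable Z) (hL : HCat R 1 L) (hZL : Nontrivial (Ext Z L 1)) :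
    ∃ S, IsAlmostSplitSequence (HCat R 1) S ∧ S.X₃ = Z := by
  have hd := h.dualizing
  obtain ⟨N, ⟨q⟩, ⟨p⟩⟩ := h.dualTr Z
  obtain ⟨-, hl, t, ht, η, h0, h1, h2⟩ := exists_almostSplit_of_hCat hd hZ h.ks (h.finDim Z hZ)
    ((hZ.hasFPRes hd.dense.proj).1.hasSerreDual_of_dual hd.dense q p) (.inl hZi)
  obtain ⟨g, hg⟩ : ∃ g : L ⟶ τ Z, g ≠ 0 := by
    by_contra! hg
    obtain ⟨β, hβ⟩ := exists_ne (0 : Ext Z L 1)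
    exact hβ (ht.1.class_eq_zero fun f => by simp [hg f])
  have hTf : IsFinDim K R (τ Z) := p.isFinDim_iff.1 ((h.extFinDim Z hZ).isFinDim q)
  have hT1 := hasFPResInf_of_isFinDim hd.dense hd.fin (fun X _ => h.pd X) hTf
  -- The image of `f` is a subobject of a projective, so it is projective and splits off τZ.
  -- Locality makes `f` a monomorphism, and then `g ≫ f` is a nonzero map from `L` to `R i`,
  -- although Hom(L, R i) = 0.
  have hT0 : ∀ i (f : τ Z ⟶ R i), f = 0 := by
    intro i f
    by_contra hf
    have hR := hd.dense.proj i
    obtain ⟨J, e, m, he, hm, rfl⟩ := exists_image_factorization f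
    have hS : (ShortComplex.mk _ _ (cokernel.condition m)).ShortExact :=
      { exact := ShortComplex.exact_cokernel _ }
    have hJ1 : HasProjectiveDimensionLT J 1 :=
      hS.hasProjectiveDimensionLT_X₁ 1 (by dsimp only; infer_instance) (h.pd _)
    have hJ : Projective J := projective_iff_hasProjectiveDimensionLT_one.2 hJ1
    have : IsIso e := hl.isIso_of_retract e (Projective.factorThru (𝟙 _) e)
      (Projective.factorThru_comp _ _) fun hz => hf (by rw [hz.eq_of_tgt e 0, zero_comp])
    have hem : Mono (e ≫ m) := inferInstance
    have := (hL.hasFPRes hd.dense.proj).2.1 0 zero_lt_one i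
    have h3 : g ≫ e ≫ m = 0 := Ext.addEquiv₀.symm.injective (Subsingleton.elim _ _)
    exact hg (by rw [← cancel_mono (e ≫ m), h3, zero_comp])
  have hT : HCat R 1 (τ Z) := by
    refine (hCat_iff hd.dense.proj h.pd _).2 ⟨hT1.hasFPRes hd.dense.proj (h.pd _), fun i hi t => ?_,
      hl.not_isZero⟩
    obtain rfl : i = 0 := by omega
    refine subsingleton_of_forall_eq 0 fun α => ?_
    obtain ⟨a, rfl⟩ := Ext.addEquiv₀.symm.surjective α
    rw [hT0 t a, map_zero]
  have := hd.cover.enoughProjectives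
  obtain ⟨S, hS, -, h3⟩ := exists_isAlmostSplitSequence hd.dense h.pd hZ hT hZi hl.indecomposable η
    h0 h1 h2
  exact ⟨S, hS, h3⟩

/-- Over a hereditary category, an object with local endomorphism ring which has a nonzero
morphism from an injective object is injective. -/
theorem ext_eq_zero_of_ne_zero (hn : ∀ X : C, HasProjectiveDimensionLT X (1 + 1)) {I A : C}
    (hI : ∀ X, Subsingleton (Ext X I 1)) (hA : HasLocalEnd A) {f : I ⟶ A} (hf : f ≠ 0) {L : C}
    (α : Ext L A 1) : α = 0 := by
  obtain ⟨J, e, m, he, hm, rfl⟩ := exists_image_factorization f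
  -- Quotients of injectives are injective because Ext^2 vanishes. So the image of `f` is a direct
  -- summand of `A`, and locality makes it all of `A`.
  have hJ : ∀ {X : C} (β : Ext X J 1), β = 0 := by
    intro X β
    have hS : (ShortComplex.mk _ _ (kernel.condition e)).ShortExact :=
      { exact := ShortComplex.exact_kernel _ }
    obtain ⟨γ, rfl⟩ := Ext.covariant_sequence_exact₃ X hS β (rfl : 1 + 1 = 2)
      (Ext.eq_zero_of_pd (hn X) le_rfl _)
    have := hI X
    rw [Subsingleton.elim γ 0, Ext.zero_comp]
  have hS : (ShortComplex.mk _ _ (cokernel.condition m)).ShortExact :=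
    { exact := ShortComplex.exact_cokernel _ }
  obtain ⟨χ, hχ⟩ := (hS.extClass_push_eq_zero_iff (𝟙 _)).1 (hJ _)
  dsimp only at χ hχ
  have : IsIso χ := hA.isIso_of_retract χ m hχ.symm
    fun hz => hf (by rw [hz.eq_of_tgt e 0, zero_comp])
  have h1 : (α.push χ).push (inv χ) = α := by simp
  rw [← h1, hJ (α.push χ), Ext.zero_push]

theorem IsAlmostSplitSetting.exists_starting (h : IsAlmostSplitSetting o 1 D τ) {A L : C}
    (hA : HCat R 1 A) (hAi : Indecomposable A) (hAL : Nontrivial (Ext L A 1)) :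
    ∃ S, IsAlmostSplitSequence (HCat R 1) S ∧ S.X₁ = A := by
  have hd := h.dualizing
  have hl := h.ks.hasLocalEnd hA hAi
  have hAf := h.finDim A hA
  obtain ⟨q⟩ := h.dual A
  let p : DualPairing o A (D A) := q.symm hAf.finite
  have hNf : IsFinDim K R' (D A) := p.isFinDim_iff.2 hAf
  have hpd' : ∀ X : C', IsFinDim K R' X → HasProjectiveDimensionLT X (1 + 1) :=
    fun X hX => hd.hasProjectiveDimensionLT h.pd hX
  have hN1 := (hasFPResInf_of_isFinDim hd.dense' hd.fin' hpd' hNf).hasFPRes hd.dense'.proj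
    (hpd' _ hNf)
  -- A nonzero `g` dualizes to a nonzero map from D(R' i) to `A`. Since D(R' i) is injective, `A`
  -- would be injective as well, against the nonzero group Ext^1(L, A).
  have hN2 : ∀ i (g : D A ⟶ R' i), g = 0 := by
    intro i g
    by_contra hg
    obtain ⟨I, ⟨r⟩⟩ := hd.dual (R' i)
    obtain ⟨f, hf⟩ := p.exists_map hd.dense r g
    have hf0 : f ≠ 0 := by
      rintro rfl
      refine hg (hd.dense'.sep _ fun k y => r.eq_zero_of fun x => ?_)
      rw [← hf]
      simp
    have hI : ∀ X, Subsingleton (Ext X I 1) := by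
      intro X
      obtain ⟨M, ⟨s⟩⟩ := hd.dual' X
      have := hd.cover.enoughProjectives
      rw [← DualPairing.subsingleton_ext_iff hd.dense hd.dense' hd.dual hd.dual' r s 0]
      have := hd.dense'.proj i
      exact subsingleton_of_forall_eq 0 fun α => Ext.eq_zero_of_projective α
    obtain ⟨β, hβ⟩ := exists_ne (0 : Ext L A 1)
    exact hβ (ext_eq_zero_of_ne_zero h.pd hI hl hf0 β)
  obtain ⟨V, hV, hVA⟩ := h.exists_transpose hA q hN1 (fun i hi t => by
    obtain rfl : i = 0 := by omega
    refine subsingleton_of_forall_eq 0 fun α => ?_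
    obtain ⟨a, rfl⟩ := Ext.addEquiv₀.symm.surjective α
    rw [hN2 t a, map_zero])
    fun hz => hl.not_isZero ((p.isZero_iff hd.dense hd.dense').2 hz)
  obtain ⟨hl', -, t, ht, η, h0, h1, h2⟩ := exists_almostSplit_of_hCat hd hV h.ks (h.finDim V hV)
    hVA (.inr hl)
  have := hd.cover.enoughProjectives
  obtain ⟨S, hS, h3, -⟩ := exists_isAlmostSplitSequence hd.dense h.pd hV hA hl'.indecomposable hAi η
    h0 h1 h2
  exact ⟨S, hS, h3⟩

theorem IsAlmostSplitSetting.hasAlmostSplitSequences (h : IsAlmostSplitSetting o 1 D τ) :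
    HasAlmostSplitSequences (HCat R 1) := by
  constructor
  · rintro Z hZ hZi ⟨L, hL, hZL⟩
    obtain ⟨S, hS, rfl⟩ := h.exists_ending hZ hZi hL hZL
    exact ⟨S, hS, ⟨Iso.refl _⟩⟩
  · rintro A hA hAi ⟨L, hL, hAL⟩
    obtain ⟨S, hS, rfl⟩ := h.exists_starting hA hAi hAL
    exact ⟨S, hS, ⟨Iso.refl _⟩⟩

end Main

/-! ### Finiteness of the objects of `H^n` -/

section Finiteness

variable {K : Type*} [Field K] {C : Type*} [Category C] [Abelian C] [Linear K C] {ι : Type}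
  {R : ι → C} [HasExt.{u} C] {n : ℕ}

/-- The trace pairing embeds Ext^n(T, R i) into the dual of Hom(R i, W). -/
theorem isExtFinDim_of_hasSerreDual {T W : C} (h : HasSerreDual K n T W) (hW : IsFinDim K R W) :
    IsExtFinDim K R n T := by
  obtain ⟨t, ht⟩ := h
  obtain ⟨h1, s, hs⟩ := hW
  refine ⟨fun i => ?_, s, fun i hi α => ht.class_eq_zero fun f => by rw [hs i hi f]; simp⟩
  have := h1 i
  let φ : Ext T (R i) n →ₗ[K] Module.Dual K (R i ⟶ W) :=
    { toFun := fun η =>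
        { toFun := fun f => t (η.push f)
          map_add' := by simp
          map_smul' := by simp }
      map_add' := fun η θ => by ext; simp
      map_smul' := fun r η => by ext; simp }
  refine Module.Finite.of_injective φ ((injective_iff_map_eq_zero φ).2 fun η hη => ?_)
  exact ht.class_eq_zero fun f => LinearMap.congr_fun hη f

theorem CategoryTheory.ShortComplex.ShortExact.exact_pull {S : ShortComplex C} (hS : S.ShortExact)
    (Y : C) (n : ℕ) : Function.Exact (Ext.pullₗ K Y n S.g) (Ext.pullₗ K Y n S.f) := fun α => by
  constructor
  · intro h
    exact Ext.contravariant_sequence_exact₂ hS Y α h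
  · rintro ⟨β, rfl⟩
    simp

theorem IsExtFinDim.of_shortExact {S : ShortComplex C} (hS : S.ShortExact)
    (h1 : IsExtFinDim K R n S.X₁) (h3 : IsExtFinDim K R n S.X₃) : IsExtFinDim K R n S.X₂ := by
  classical
  obtain ⟨h1, s, hs⟩ := h1
  obtain ⟨h3, t, ht⟩ := h3
  refine ⟨fun i => ?_, s ∪ t, fun i hi α => ?_⟩
  · have := h1 i
    have := h3 i
    exact Module.Finite.of_exact_of_finite (hS.exact_pull (K := K) (R i) n)
  · rw [Finset.mem_union, not_or] at hi
    obtain ⟨β, rfl⟩ := Ext.contravariant_sequence_exact₂ hS (R i) α (hs i hi.1 _)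
    rw [ht i hi.2 β, Ext.comp_zero]

theorem isFinDim_of_isZero {X : C} (h : IsZero X) : IsFinDim K R X := by
  have h0 : ∀ i (x : R i ⟶ X), x = 0 := fun i x => h.eq_of_tgt _ _
  exact ⟨fun i => ⟨⟨∅, by ext x; simp [h0 i x]⟩⟩, ∅, fun i _ => h0 i⟩

theorem isExtFinDim_of_isZero {X : C} (h : IsZero X) : IsExtFinDim K R n X := by
  have h0 : ∀ i (α : Ext X (R i) n), α = 0 := fun i α => ext_eq_zero_of_isZero h α
  exact ⟨fun i => ⟨⟨∅, by ext x; simp [h0 i x]⟩⟩, ∅, fun i _ => h0 i⟩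

/-- One step of the filtration: the simple subobject is finite dimensional, and its top Ext groups
are controlled by its simple Serre dual `W`. -/
theorem isFinDim_and_isExtFinDim_of_shortExact
    (hfd : ∀ S : C, Simple S → IsFinDim K R S) {S : ShortComplex C} (hS : S.ShortExact) {W : C}
    (hW : Simple W) (h1 : Simple S.X₁) (hT : HasSerreDual K n S.X₁ W)
    (h3 : ¬ IsZero S.X₃ → IsFinDim K R S.X₃ ∧ IsExtFinDim K R n S.X₃) :
    IsFinDim K R S.X₂ ∧ IsExtFinDim K R n S.X₂ := by
  have h3' : IsFinDim K R S.X₃ ∧ IsExtFinDim K R n S.X₃ := by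
    by_cases hz : IsZero S.X₃
    · exact ⟨isFinDim_of_isZero hz, isExtFinDim_of_isZero hz⟩
    · exact h3 hz
  exact ⟨IsFinDim.of_shortExact hS (hfd _ h1) h3'.1,
    IsExtFinDim.of_shortExact hS (isExtFinDim_of_hasSerreDual hT (hfd _ hW)) h3'.2⟩

end Finiteness

/-! ### Reindexing -/

section Reindexing

variable {C : Type*} [Category C] [Abelian C] [HasExt.{u} C] {ι ι' : Type} {R : ι → C}

attribute [local instance] Abelian.hasFiniteBiproducts in
theorem isFinGen_reindex (e : ι' ≃ ι) (M : C) :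
    IsFinGen (fun i => R (e i)) M ↔ IsFinGen R M := by
  constructor
  · rintro ⟨m, t, p, hp⟩
    exact ⟨m, fun s => e (t s), p, hp⟩
  · rintro ⟨m, t, p, hp⟩
    obtain ⟨t, rfl⟩ : ∃ t' : Fin m → ι', t = fun s => e (t' s) :=
      ⟨fun s => e.symm (t s), by simp⟩
    exact ⟨m, t, p, hp⟩

theorem hCat_reindex (e : ι' ≃ ι) (n : ℕ) (M : C) :
    HCat (fun i => R (e i)) n M ↔ HCat R n M := by
  simp only [HCat, isFinGen_reindex]
  refine and_congr Iff.rfl (and_congr ?_ Iff.rfl)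
  exact ⟨fun h i hi t => by simpa using h i hi (e.symm t), fun h i hi t => h i hi (e t)⟩

theorem IsGenASRegular.reindex {C' : Type*} [Category C'] [Abelian C'] [HasExt.{u} C']
    {ι'' : Type} {R' : ι' → C'} {tr' : C' → C} {n : ℕ} (h : IsGenASRegular R R' tr' n)
    (e : ι'' ≃ ι') : IsGenASRegular R (fun i => R' (e i)) tr' n :=
  ⟨h.globalDim_eq, h.simple_mem, fun S hS hp => (hCat_reindex e n S).2 (h.simple_mem' S hS hp),
    h.simple_sub⟩

end Reindexing

/-! ### Noetherian algebras which are finite dimensional modulo the radical -/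

section Radical

open MulOpposite in
/-- The Jacobson radical is left-right symmetric. -/
theorem op_mem_jacobson {Λ : Type*} [Ring Λ] {x : Λ} (hx : x ∈ Ring.jacobson Λ) :
    op x ∈ Ring.jacobson Λᵐᵒᵖ := by
  rw [← Ideal.jacobson_bot] at hx ⊢
  rw [Ideal.mem_jacobson_iff] at hx ⊢
  have hinv : ∀ w ∈ Ideal.jacobson (⊥ : Ideal Λ), ∃ z, z * (w + 1) = 1 := fun w hw => by
    obtain ⟨z, hz⟩ := Ideal.mem_jacobson_iff.1 hw 1
    rw [mul_one, Ideal.mem_bot, sub_eq_zero] at hz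
    exact ⟨z, by rw [mul_add, mul_one, hz]⟩
  intro y
  have h1 : x * y.unop ∈ Ideal.jacobson (⊥ : Ideal Λ) := by
    rw [Ideal.jacobson_bot]
    refine Ideal.mul_mem_right _ _ ?_
    rw [← Ideal.jacobson_bot]
    exact Ideal.mem_jacobson_iff.2 hx
  obtain ⟨z, hz⟩ := hinv _ h1
  -- The left inverse `z` of 1 + xy differs from 1 by an element of the radical, so it has a left
  -- inverse itself. Hence `z` is a two-sided inverse, as the opposite ring requires.
  have h2 : -(z * (x * y.unop)) ∈ Ideal.jacobson (⊥ : Ideal Λ) := neg_mem (Ideal.mul_mem_left _ _ h1)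
  obtain ⟨v, hv⟩ := hinv _ h2
  have h3 : -(z * (x * y.unop)) + 1 = z := by
    rw [mul_add, mul_one] at hz
    rw [← hz]
    abel
  rw [h3] at hv
  have h4 : v = x * y.unop + 1 := by
    calc v = v * (z * (x * y.unop + 1)) := by rw [hz, mul_one]
      _ = x * y.unop + 1 := by rw [← mul_assoc, hv, one_mul]
  refine ⟨op z, ?_⟩
  rw [Ideal.mem_bot, sub_eq_zero]
  apply unop_injective
  simp only [MulOpposite.unop_add, MulOpposite.unop_mul, MulOpposite.unop_op,
    MulOpposite.unop_one]
  rw [h4] at hv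
  rw [← hv, add_mul, one_mul, mul_assoc]

variable {K A : Type u} [Field K] [Ring A] [Algebra K A]

theorem compHom_algebraMap_eq (M : Type*) [AddCommGroup M] [Module A M] [h : Module K M]
    [IsScalarTower K A M] : Module.compHom M (algebraMap K A) = h := by
  refine Module.ext' _ _ fun r x => ?_
  exact algebraMap_smul A r x

theorem finite_of_isFiniteLength
    (hS : ∀ S : ModuleCat.{u} A, Simple S → @Module.Finite K S _ _ (ModuleCat.moduleOfAlgebraModule S))
    {M : Type u} [AddCommGroup M] [Module A M] (h : IsFiniteLength A M) :
    ∀ [Module K M] [IsScalarTower K A M], Module.Finite K M := by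
  induction h with
  | of_subsingleton => intros; infer_instance
  | @of_simple_quotient M _ _ N hN h ih =>
    intro _ _
    have : Simple (ModuleCat.of A (M ⧸ N)) := simple_iff_isSimpleModule.2 hN
    have : Module.Finite K (M ⧸ N) := by
      have h2 : @Module.Finite K (M ⧸ N) _ _ (Module.compHom (M ⧸ N) (algebraMap K A)) :=
        hS (ModuleCat.of A (M ⧸ N)) this
      rwa [compHom_algebraMap_eq] at h2
    have : Module.Finite K (N.restrictScalars K) := ih
    have : Module.Finite K (M ⧸ N.restrictScalars K) := ‹Module.Finite K (M ⧸ N)›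
    exact Module.Finite.of_submodule_quotient (N.restrictScalars K)

theorem finite_quotient_jacobson (h : IsSemisimpleRing (A ⧸ Ring.jacobson A))
    (hS : ∀ S : ModuleCat.{u} A, Simple S → @Module.Finite K S _ _ (ModuleCat.moduleOfAlgebraModule S)) :
    Module.Finite K (A ⧸ Ring.jacobson A) := by
  have h1 : IsSemisimpleModule A (A ⧸ Ring.jacobson A) := by
    let f : (A ⧸ Ring.jacobson A) →ₛₗ[Ideal.Quotient.mk (Ring.jacobson A)] (A ⧸ Ring.jacobson A) :=
      ⟨AddHom.id _, fun _ _ => rfl⟩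
    have : RingHomSurjective (Ideal.Quotient.mk (Ring.jacobson A)) := ⟨Ideal.Quotient.mk_surjective⟩
    exact (f.isSemisimpleModule_iff_of_bijective Function.bijective_id).2 h
  have h2 := (IsSemisimpleModule.finite_tfae (R := A) (M := A ⧸ Ring.jacobson A)).out 0 3
  exact finite_of_isFiniteLength hS (h2.1 inferInstance)

theorem finite_quotient_jacobson_op (h : Module.Finite K (A ⧸ Ring.jacobson A)) :
    Module.Finite K (Aᵐᵒᵖ ⧸ Ring.jacobson Aᵐᵒᵖ) := by
  let φ : A →ₗ[K] (Aᵐᵒᵖ ⧸ Ring.jacobson Aᵐᵒᵖ) :=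
    ((Ring.jacobson Aᵐᵒᵖ).mkQ.restrictScalars K) ∘ₗ (MulOpposite.opLinearEquiv K).toLinearMap
  let ψ : (A ⧸ (Ring.jacobson A).restrictScalars K) →ₗ[K] (Aᵐᵒᵖ ⧸ Ring.jacobson Aᵐᵒᵖ) :=
    Submodule.liftQ _ φ fun x hx => (Submodule.Quotient.mk_eq_zero _).2 (op_mem_jacobson hx)
  have : Module.Finite K (A ⧸ (Ring.jacobson A).restrictScalars K) := h
  refine Module.Finite.of_surjective ψ fun y => ?_
  obtain ⟨y, rfl⟩ := Submodule.Quotient.mk_surjective _ y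
  exact ⟨Submodule.Quotient.mk y.unop, rfl⟩

/-- With J the radical, L/JL is a quotient of a finite power of A/J. -/
theorem finite_quotient_smul_top (h : Module.Finite K (A ⧸ Ring.jacobson A)) (L : Type u)
    [AddCommGroup L] [Module A L] [Module K L] [IsScalarTower K A L] [Module.Finite A L] :
    Module.Finite K (L ⧸ (Ring.jacobson A • (⊤ : Submodule A L))) := by
  obtain ⟨m, f, hf⟩ := Module.Finite.exists_fin' A L
  let N := Ring.jacobson A • (⊤ : Submodule A L)
  let φ : Fin m → (A ⧸ Ring.jacobson A) →ₗ[A] (L ⧸ N) := fun s =>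
    Submodule.liftQ _ (LinearMap.toSpanSingleton A _ (N.mkQ (f (Pi.single s 1)))) fun a ha => by
      rw [LinearMap.mem_ker, LinearMap.toSpanSingleton_apply, ← map_smul]
      exact (Submodule.Quotient.mk_eq_zero _).2 (Submodule.smul_mem_smul ha trivial)
  let ψ : (Fin m → A ⧸ Ring.jacobson A) →ₗ[K] (L ⧸ N) :=
    ∑ s, (φ s).restrictScalars K ∘ₗ LinearMap.proj s
  refine Module.Finite.of_surjective ψ fun y => ?_
  obtain ⟨y, rfl⟩ := Submodule.Quotient.mk_surjective _ y
  obtain ⟨a, rfl⟩ := hf y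
  refine ⟨fun s => Submodule.Quotient.mk (a s), ?_⟩
  have h1 : a = ∑ s, a s • (Pi.single s 1 : Fin m → A) := by
    ext t
    simp [Finset.sum_apply, Pi.single_apply]
  conv_rhs => rw [h1]
  simp only [ψ, LinearMap.coe_sum, Finset.sum_apply, LinearMap.comp_apply, LinearMap.proj_apply]
  rw [map_sum, ← Submodule.mkQ_apply, map_sum]
  refine Finset.sum_congr rfl fun s _ => ?_
  rw [map_smul, map_smul]
  rfl

-- The top is L/JL. An endomorphism over it is onto by Nakayama and then injective because `L` is
-- Noetherian.
open scoped ModuleCat in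
theorem exists_isTopQuotient [IsNoetherianRing A] (h : Module.Finite K (A ⧸ Ring.jacobson A))
    (L : ModuleCat.{u} A) (hL : Module.Finite A L) :
    ∃ (T : ModuleCat.{u} A) (π : L ⟶ T), Module.Finite K T ∧ IsTopQuotient π := by
  let N : Submodule A L := Ring.jacobson A • ⊤
  have h1 := finite_quotient_smul_top h L
  refine ⟨ModuleCat.of A (L ⧸ N), ModuleCat.ofHom N.mkQ, ?_, ?_, fun e he => ?_⟩
  · have e : (L ⧸ N) ≃ₗ[K] (ModuleCat.of A (L ⧸ N)) :=
      { AddEquiv.refl (L ⧸ N) with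
        map_smul' := fun r x => by
          change r • x = algebraMap K A r • x
          rw [algebraMap_smul] }
    exact Module.Finite.equiv e
  · rw [ModuleCat.epi_iff_surjective]
    exact N.mkQ_surjective
  · have h2 : ∀ x, e.hom x - x ∈ N := fun x => by
      rw [← Submodule.Quotient.mk_eq_zero, Submodule.Quotient.mk_sub, sub_eq_zero]
      exact LinearMap.congr_fun (congrArg ModuleCat.Hom.hom he) x
    have hs : Function.Surjective e.hom := by
      rw [← LinearMap.range_eq_top]
      have : (⊤ : Submodule A (L ⧸ LinearMap.range e.hom)) = ⊥ := by
        refine Submodule.FG.eq_bot_of_le_jacobson_smul Module.Finite.fg_top fun y _ => ?_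
        obtain ⟨y, rfl⟩ := Submodule.mkQ_surjective _ y
        have h3 : Submodule.map (LinearMap.range e.hom).mkQ N ≤
            Ring.jacobson A • (⊤ : Submodule A (L ⧸ LinearMap.range e.hom)) := by
          rw [Submodule.map_smul'']
          exact Submodule.smul_mono le_rfl le_top
        have h4 := h3 (Submodule.mem_map_of_mem (h2 y))
        rw [map_sub] at h4
        have h5 : (LinearMap.range e.hom).mkQ (e.hom y) = 0 :=
          (Submodule.Quotient.mk_eq_zero _).2 ⟨y, rfl⟩
        rw [h5, zero_sub] at h4
        exact neg_mem_iff.1 h4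
      rw [← Submodule.Quotient.subsingleton_iff]
      exact (Submodule.subsingleton_iff A).1 (subsingleton_of_bot_eq_top this.symm)
    have hi := IsNoetherian.injective_of_surjective_endomorphism e.hom hs
    have : Mono e := (ModuleCat.mono_iff_injective e).2 hi
    have : Epi e := (ModuleCat.epi_iff_surjective e).2 hs
    exact isIso_of_mono_of_epi e

end Radical

/-! ### The ungraded case -/

namespace ModuleCat

open scoped ModuleCat

section Generators

variable {K A : Type u} [Field K] [Ring A] [Algebra K A]

variable (K) in
/-- Morphisms from the regular module are elements. -/
def evalOne (X : ModuleCat.{u} A) : (ModuleCat.of A A ⟶ X) ≃ₗ[K] X where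
  toFun f := f.hom 1
  invFun x := ofHom (LinearMap.toSpanSingleton A X x)
  map_add' _ _ := rfl
  map_smul' _ _ := rfl
  left_inv f := by
    ext
    simp
  right_inv x := by simp

theorem hom_regular_ext {X : ModuleCat.{u} A} {f g : ModuleCat.of A A ⟶ X}
    (h : f.hom 1 = g.hom 1) : f = g := by
  ext
  exact h

theorem hom_regular_apply {X : ModuleCat.{u} A} (f : ModuleCat.of A A ⟶ X) (a : A) :
    f.hom a = a • f.hom 1 := by
  rw [← map_smul, smul_eq_mul, mul_one]

instance projective_regular : Projective (ModuleCat.of A A) :=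
  (IsProjective.iff_projective A).1 inferInstance

theorem isDenseFamily_regular : IsDenseFamily (fun _ : Unit => ModuleCat.of A A) where
  proj _ := projective_regular
  glue {X Y} c hadd hcomp := by
    let s : X → (ModuleCat.of A A ⟶ X) := fun x => ofHom (LinearMap.toSpanSingleton A X x)
    have hs : ∀ {f : ModuleCat.of A A ⟶ X}, s (f.hom 1) = f := hom_regular_ext (by simp [s])
    refine ⟨ofHom
      { toFun := fun x => (c () (s x)).hom (1 : A)
        map_add' := fun x y => ?_
        map_smul' := fun a x => ?_ }, fun _ x => hom_regular_ext ?_⟩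
    · have : s (x + y) = s x + s y := hom_regular_ext (by simp [s])
      rw [this, hadd]
      rfl
    · have : s (a • x) = ofHom (LinearMap.toSpanSingleton A A a) ≫ s x :=
        hom_regular_ext (by simp [s])
      rw [this, hcomp () ()]
      change (c () (s x)).hom ((1 : A) * a) = a • (c () (s x)).hom (1 : A)
      rw [one_mul]
      exact hom_regular_apply (c () (s x)) a
    · change (c () (s (x.hom (1 : A)))).hom (1 : A) = _
      rw [hs]
  sep {X Y} f h := by
    ext x
    have := congrArg (fun g => g.hom (1 : A)) (h () (ofHom (LinearMap.toSpanSingleton A X x)))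
    change f.hom ((1 : A) • x) = 0 at this
    rwa [one_smul] at this

theorem hasFreeCovers_regular : HasFreeCovers (fun _ : Unit => ModuleCat.of A A) := fun X => by
  classical
  refine ⟨ModuleCat.of A (X →₀ A), ofHom (Finsupp.linearCombination A _root_.id), ?_, ?_,
    fun m t g => ?_⟩
  · rw [epi_iff_surjective]
    exact Finsupp.linearCombination_id_surjective A X
  · exact (IsProjective.iff_projective (X →₀ A)).1 inferInstance
  · let v : Fin m → X →₀ A := fun s => (g s).hom (1 : A)
    -- Finitely many elements of a free module involve finitely many basis vectors; the projection
    -- to these fixes them.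
    let S : Finset X := Finset.univ.biUnion fun s => (v s).support
    refine ⟨S.card, fun _ => (), fun k => ofHom (Finsupp.lapply (S.equivFin.symm k : X)),
      fun k => ofHom (Finsupp.lsingle (S.equivFin.symm k : X)), fun s => hom_regular_ext ?_⟩
    rw [hom_comp, hom_sum, LinearMap.comp_apply, LinearMap.sum_apply]
    change ∑ k, Finsupp.single (S.equivFin.symm k : X) (v s (S.equivFin.symm k)) = v s
    rw [S.equivFin.symm.sum_comp (fun x : S => Finsupp.single (x : X) (v s x)),
      Finset.sum_coe_sort S (fun x => Finsupp.single x (v s x))]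
    refine Eq.symm ((Finsupp.sum_single (v s)).symm.trans
      (Finsupp.sum_of_support_subset _ ?_ _ (by simp)))
    exact Finset.subset_biUnion_of_mem (fun s => (v s).support) (Finset.mem_univ s)

theorem isFGProj_fin (m : ℕ) : IsFGProj (fun _ : Unit => ModuleCat.of A A) (ModuleCat.of A (Fin m → A)) := by
  refine ⟨m, fun _ => (), fun s => ofHom (LinearMap.proj s),
    fun s => ofHom (LinearMap.single A (fun _ => A) s), ?_⟩
  ext1
  rw [hom_sum]
  refine LinearMap.ext fun x => ?_
  rw [LinearMap.sum_apply]
  change ∑ s, Pi.single s (x s) = x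
  exact Finset.univ_sum_single x

theorem finite_of_isFGProj {P : ModuleCat.{u} A} (h : IsFGProj (fun _ : Unit => ModuleCat.of A A) P) :
    Module.Finite A P := by
  obtain ⟨m, t, e, p, hep⟩ := h
  classical
  refine ⟨⟨Finset.univ.image fun s => (p s).hom (1 : A), ?_⟩⟩
  rw [eq_top_iff]
  rintro x -
  have h1 : x = ∑ s, (p s).hom ((e s).hom x) := by
    conv_lhs => rw [show x = (𝟙 P : P ⟶ P).hom x from rfl, ← hep, hom_sum, LinearMap.sum_apply]
    rfl
  rw [h1]
  refine Submodule.sum_mem _ fun s _ => ?_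
  have h2 : (p s).hom ((e s).hom x) = ((e s).hom x : A) • (p s).hom (1 : A) := hom_regular_apply (p s) _
  rw [h2]
  exact Submodule.smul_mem _ _ (Submodule.subset_span (by simp))

theorem exists_epi_of_finite {X : ModuleCat.{u} A} (h : Module.Finite A X) :
    ∃ (m : ℕ) (p : ModuleCat.of A (Fin m → A) ⟶ X), Epi p := by
  obtain ⟨m, f, hf⟩ := Module.Finite.exists_fin' A X
  exact ⟨m, ofHom f, (epi_iff_surjective _).2 hf⟩

theorem isFinGen_of_finite {X : ModuleCat.{u} A} (h : Module.Finite A X) :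
    IsFinGen (fun _ : Unit => ModuleCat.of A A) X := by
  obtain ⟨m, p, hp⟩ := exists_epi_of_finite h
  exact (isFinGen_iff X).2 ⟨_, p, isFGProj_fin m, hp⟩

theorem exists_shortExact_of_finite [IsNoetherianRing A] {X : ModuleCat.{u} A}
    (h : Module.Finite A X) : ∃ S : ShortComplex (ModuleCat.{u} A), S.ShortExact ∧ S.X₃ = X ∧
      IsFGProj (fun _ : Unit => ModuleCat.of A A) S.X₂ ∧ Module.Finite A S.X₁ := by
  obtain ⟨m, p, hp⟩ := exists_epi_of_finite h
  refine ⟨ShortComplex.mk (kernel.ι p) p (kernel.condition p),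
    { exact := ShortComplex.exact_kernel p }, rfl, isFGProj_fin m, ?_⟩
  exact Module.Finite.of_injective (kernel.ι p).hom ((mono_iff_injective _).1 inferInstance)

theorem finite_of_simple (X : ModuleCat.{u} A) [Simple X] : Module.Finite A X := by
  have : IsSimpleModule A X := simple_iff_isSimpleModule.1 ‹Simple X›
  infer_instance

theorem isFinDim_iff_finite (X : ModuleCat.{u} A) :
    IsFinDim K (fun _ : Unit => ModuleCat.of A A) X ↔ Module.Finite K X := by
  constructor
  · intro h
    have : Module.Finite K (ModuleCat.of A A ⟶ X) := h.finite ()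
    exact Module.Finite.equiv (evalOne K X)
  · intro h
    exact ⟨fun _ => Module.Finite.equiv (evalOne K X).symm, Finset.univ, by simp⟩

end Generators

end ModuleCat

/-! ### Values of morphisms from the regular module; duality and transpose for modules -/

namespace ModuleCat

open scoped ModuleCat
open MulOpposite

/-- The family consisting of the regular module only. -/
def regular (A : Type u) [Ring A] (_ : Unit) : ModuleCat.{u} A := ModuleCat.of A A

section Values

variable {K A : Type u} [Field K] [Ring A] [Algebra K A] {i j : Unit} {X : ModuleCat.{u} A}

/-- The value at `1` of a morphism from the regular module. -/
def val (f : regular A i ⟶ X) : X := f.hom (1 : A)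

/-- The value at `1` of an endomorphism of the regular module. -/
def coeff (f : regular A i ⟶ regular A j) : A := f.hom (1 : A)

/-- The morphism from the regular module with a given value. -/
def ofVal (i : Unit) (x : X) : regular A i ⟶ X := ofHom (LinearMap.toSpanSingleton A X x)

/-- The endomorphism of the regular module with a given value. -/
def ofCoeff (i j : Unit) (x : A) : regular A i ⟶ regular A j :=
  ofHom (LinearMap.toSpanSingleton A A x)

theorem val_ext {f g : regular A i ⟶ X} (h : val f = val g) : f = g := hom_regular_ext h

theorem coeff_ext {f g : regular A i ⟶ regular A j} (h : coeff f = coeff g) : f = g :=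
  hom_regular_ext h

theorem val_comp (a : regular A i ⟶ regular A j) (x : regular A j ⟶ X) :
    val (a ≫ x) = coeff a • val x := hom_regular_apply x _

theorem coeff_comp {k : Unit} (a : regular A i ⟶ regular A j) (b : regular A j ⟶ regular A k) :
    coeff (a ≫ b) = coeff a * coeff b := hom_regular_apply b _

@[simp] theorem val_ofVal (x : X) : val (ofVal i x) = x := one_smul A x

@[simp] theorem coeff_ofCoeff (x : A) : coeff (ofCoeff i j x) = x := one_smul A x

@[simp] theorem ofCoeff_coeff (f : regular A i ⟶ regular A j) : ofCoeff i j (coeff f) = f :=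
  coeff_ext (coeff_ofCoeff _)

theorem smul_eq_algebraMap_smul (r : K) (x : X) : r • x = algebraMap K A r • x :=
  (algebraMap_smul A r x).symm

theorem coeff_smul (r : K) (f : regular A i ⟶ regular A j) :
    coeff (r • f) = algebraMap K A r * coeff f :=
  smul_eq_algebraMap_smul (X := regular A j) r (val f)

theorem coeff_id : coeff (𝟙 (regular A i)) = 1 := rfl

variable (K) in
/-- Morphisms from the regular module are given by their values. -/
def valEquiv (i : Unit) (X : ModuleCat.{u} A) : (regular A i ⟶ X) ≃ₗ[K] X where
  toFun := val
  invFun := ofVal i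
  map_add' _ _ := rfl
  map_smul' _ _ := rfl
  left_inv _ := val_ext (val_ofVal _)
  right_inv := val_ofVal

/-- The scalar action on Ext induced by the algebra agrees with the one coming from the linear
category. -/
theorem push_ofCoeff {k : ℕ} {M : ModuleCat.{u} A} (r : K) (α : Ext M (regular A j) k) :
    α.push (ofCoeff j j (algebraMap K A r)) = r • α := by
  have : ofCoeff j j (algebraMap K A r) = r • 𝟙 (regular A j) := coeff_ext (by
    rw [coeff_ofCoeff, coeff_smul, coeff_id, mul_one])
  rw [this, Ext.push_smul, Ext.push_id]

end Values

variable {K Λ : Type u} [Field K] [Ring Λ] [Algebra K Λ]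

variable (K Λ) in
/-- Endomorphisms of the left and of the right regular module are both given by elements. -/
def oppositeRegular : OppositeFamilies K (regular Λ) (regular Λᵐᵒᵖ) where
  op i j :=
    { toFun := fun f => ofCoeff j i (op (coeff f))
      invFun := fun f => ofCoeff i j (unop (coeff f))
      map_add' := fun f g => coeff_ext (by
        rw [coeff_ofCoeff]
        change _ = coeff (ofCoeff j i (op (coeff f))) + coeff (ofCoeff j i (op (coeff g)))
        rw [coeff_ofCoeff, coeff_ofCoeff]
        rfl)
      map_smul' := fun r f => coeff_ext (by
        rw [RingHom.id_apply, coeff_ofCoeff, coeff_smul, coeff_smul, coeff_ofCoeff,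
          Algebra.commutes]
        rfl)
      left_inv := fun f => by simp
      right_inv := fun f => by simp }
  op_comp {i j k} f g := coeff_ext (by
    change coeff (ofCoeff k i (op (coeff (f ≫ g)))) =
      coeff (ofCoeff k j (op (coeff g)) ≫ ofCoeff j i (op (coeff f)))
    rw [coeff_ofCoeff, coeff_comp, coeff_comp, coeff_ofCoeff, coeff_ofCoeff, op_mul])

theorem oppositeRegular_op {i j : Unit} (a : regular Λ i ⟶ regular Λ j) :
    (oppositeRegular K Λ).op i j a = ofCoeff j i (op (coeff a)) := rfl

theorem oppositeRegular_symm_op {i j : Unit} (a : regular Λᵐᵒᵖ i ⟶ regular Λᵐᵒᵖ j) :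
    (oppositeRegular K Λ).symm.op i j a = ofCoeff j i (unop (coeff a)) := rfl

/-- The dual of a right module, on elements. -/
noncomputable def ofOpOpDualEquiv (N : ModuleCat.{u} Λᵐᵒᵖ) :
    ofOpOp (dual K N) ≃ₗ[K] (N →ₗ[K] K) where
  __ := AddEquiv.refl (N →ₗ[K] K)
  map_smul' r φ := by
    rw [smul_eq_algebraMap_smul]
    refine LinearMap.ext fun y => ?_
    let ψ : N →ₗ[K] K := φ
    change ψ (algebraMap K Λᵐᵒᵖ r • y) = r • ψ y
    rw [algebraMap_smul, map_smul]

/-- The dual of a left module, on elements. -/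
def dualEquiv (M : ModuleCat.{u} Λ) : dual K M ≃ₗ[K] (M →ₗ[K] K) where
  __ := AddEquiv.refl (M →ₗ[K] K)
  map_smul' r φ := by
    rw [smul_eq_algebraMap_smul]
    refine LinearMap.ext fun y => ?_
    let ψ : M →ₗ[K] K := φ
    change ψ (algebraMap K Λ r • y) = r • ψ y
    rw [algebraMap_smul, map_smul]

/-- The dual of a right module is a dual. -/
noncomputable def dualPairingOfOpOp (N : ModuleCat.{u} Λᵐᵒᵖ) :
    DualPairing (oppositeRegular K Λ) (ofOpOp (dual K N)) N where
  w i := (valEquiv K i _).trans ((ofOpOpDualEquiv N).trans (valEquiv K i N).dualMap)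
  nat {i j} a x y := by
    change ofOpOpDualEquiv N (val (a ≫ x)) (val y) =
      ofOpOpDualEquiv N (val x) (val ((oppositeRegular K Λ).op i j a ≫ y))
    rw [oppositeRegular_op, val_comp, val_comp, coeff_ofCoeff]
    rfl

/-- The dual of a left module is a dual. -/
def dualPairing (M : ModuleCat.{u} Λ) :
    DualPairing (oppositeRegular K Λ).symm (dual K M) M where
  w i := (valEquiv K i _).trans ((dualEquiv M).trans (valEquiv K i M).dualMap)
  nat {i j} a x y := by
    change dualEquiv M (val (a ≫ x)) (val y) =
      dualEquiv M (val x) (val ((oppositeRegular K Λ).symm.op i j a ≫ y))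
    rw [oppositeRegular_symm_op, val_comp, val_comp, coeff_ofCoeff]
    rfl

/-- `tr^k N` represents the extensions of the right module `N` by the regular module. -/
noncomputable def extDualOfOpOp (k : ℕ) (N : ModuleCat.{u} Λᵐᵒᵖ) :
    ExtDual (oppositeRegular K Λ) k (ofOpOp (tr k N)) N where
  u i := (valEquiv K i _).trans
    { AddEquiv.refl (Ext N (regular Λᵐᵒᵖ i) k) with
      map_smul' := fun r α => by
        rw [smul_eq_algebraMap_smul]
        exact push_ofCoeff (A := Λᵐᵒᵖ) r α }
  nat {_ _} a x := val_comp a x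

/-- `tr^k M` represents the extensions of the left module `M` by the regular module. -/
noncomputable def extDual (k : ℕ) (M : ModuleCat.{u} Λ) :
    ExtDual (oppositeRegular K Λ).symm k (tr k M) M where
  u i := (valEquiv K i _).trans
    { AddEquiv.refl (Ext M (regular Λ i) k) with
      map_smul' := fun r α => by
        rw [smul_eq_algebraMap_smul]
        exact push_ofCoeff (A := Λ) r α }
  nat {_ _} a x := val_comp a x

end ModuleCat

/-! ### The ungraded case: verification of the axioms and termination -/

namespace ModuleCat

open scoped ModuleCat

variable {K Λ : Type u} [Field K] [Ring Λ] [Algebra K Λ]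

theorem isClassWithTops_finite {A : Type u} [Ring A] [Algebra K A] [IsNoetherianRing A]
    (h : Module.Finite K (A ⧸ Ring.jacobson A)) :
    IsClassWithTops (fun X : ModuleCat.{u} A => Module.Finite A X) (fun T => Module.Finite K T) where
  step Q hQ := by
    obtain ⟨S, hS, h3, h2, h1⟩ := exists_shortExact_of_finite hQ
    exact ⟨S, hS, h3, h2.projective fun _ => projective_regular, h1⟩
  top Q hQ := by
    obtain ⟨T, π, hT, hπ⟩ := exists_isTopQuotient h Q hQ
    exact ⟨T, π, hπ, hT⟩

theorem isDualizing (h1 : IsNoetherianRing Λ) (h2 : IsNoetherianRing Λᵐᵒᵖ)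
    (h3 : IsSemisimpleRing (Λ ⧸ Ring.jacobson Λ))
    (h4 : ∀ S : ModuleCat.{u} Λ, Simple S → Module.Finite K S) :
    IsDualizing (oppositeRegular K Λ) := by
  have hj := finite_quotient_jacobson h3 h4
  have hj' := finite_quotient_jacobson_op hj
  exact
  { dense := isDenseFamily_regular
    dense' := isDenseFamily_regular
    cover := hasFreeCovers_regular
    dual := fun N => ⟨_, ⟨dualPairingOfOpOp N⟩⟩
    dual' := fun M => ⟨_, ⟨dualPairing M⟩⟩
    hom := fun N => ⟨_, ⟨extDualOfOpOp 0 N⟩⟩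
    top := fun L hL => by
      obtain ⟨T, π, hT, hπ⟩ := exists_isTopQuotient hj L (finite_of_isFGProj hL)
      exact ⟨T, π, (isFinDim_iff_finite T).2 hT, hπ⟩
    top' := by
      have hG := isClassWithTops_finite hj'
      refine ⟨_, ⟨hG.step, fun Q hQ => ?_⟩, fun Q hQ => ?_⟩
      · obtain ⟨T, π, hπ, hT⟩ := hG.top Q hQ
        have h5 := ((isFinDim_iff_finite (K := K) T).2 hT).finite
        exact ⟨T, π, hπ, _, ⟨(dualPairingOfOpOp T).symm h5⟩⟩
      · have : Module.Finite K Q := (isFinDim_iff_finite Q).1 hQ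
        exact Module.Finite.of_restrictScalars_finite K Λᵐᵒᵖ Q
    finDim := fun S hS => (isFinDim_iff_finite S).2 (h4 S hS)
    fin := fun T hT => by
      obtain ⟨S, hS, e, hP, hf⟩ := exists_shortExact_of_finite (finite_of_simple T)
      exact ⟨S, hS, e, hP, isFinGen_of_finite hf⟩
    fin' := fun T hT => by
      obtain ⟨S, hS, e, hP, hf⟩ := exists_shortExact_of_finite (finite_of_simple T)
      exact ⟨S, hS, e, hP, isFinGen_of_finite hf⟩ }

theorem finite_of_isFinGen {X : ModuleCat.{u} Λ} (h : IsFinGen (regular Λ) X) :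
    Module.Finite Λ X := by
  obtain ⟨P, p, hP, hp⟩ := (isFinGen_iff X).1 h
  have := finite_of_isFGProj hP
  exact Module.Finite.of_surjective p.hom ((epi_iff_surjective p).1 hp)

theorem finite_of_hCat {n : ℕ} {X : ModuleCat.{u} Λ} (h : HCat (regular Λ) n X) :
    Module.Finite Λ X := by
  obtain ⟨-, -, P, hP⟩ := h
  have h0 := finite_of_isFinGen (hP 0)
  exact Module.Finite.of_surjective (P.π.f 0).hom ((epi_iff_surjective _).1 inferInstance)

/-- Induction along proper quotients of a finitely generated module over a Noetherian ring. -/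
theorem induction_of_isNoetherianRing [IsNoetherianRing Λ] {𝒬 : ModuleCat.{u} Λ → Prop}
    (h : ∀ X, (∀ (Y : ModuleCat.{u} Λ) (f : X ⟶ Y), Epi f → ¬ Mono f → 𝒬 Y) → 𝒬 X)
    (M : ModuleCat.{u} Λ) [Module.Finite Λ M] : 𝒬 M := by
  suffices H : ∀ (N : Submodule Λ M) (X : ModuleCat.{u} Λ) (p : M ⟶ X), Epi p →
      LinearMap.ker p.hom = N → 𝒬 X from H _ M (𝟙 M) inferInstance rfl
  intro N
  -- A proper quotient of `X` has a strictly larger kernel in `M`, and submodules of `M` satisfy the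
  -- ascending chain condition.
  induction N using WellFoundedGT.induction with
  | ind N ih =>
    rintro X p hp rfl
    refine h X fun Y f hf hf' => ih (LinearMap.ker (p ≫ f).hom) ?_ Y (p ≫ f) (epi_comp _ _) rfl
    refine lt_of_le_of_ne (fun x hx => ?_) fun he => hf' ?_
    · rw [LinearMap.mem_ker] at hx ⊢
      rw [hom_comp, LinearMap.comp_apply, hx, map_zero]
    · rw [mono_iff_injective, injective_iff_map_eq_zero]
      intro x hx
      obtain ⟨y, rfl⟩ := (epi_iff_surjective p).1 hp x
      have hy : y ∈ LinearMap.ker (p ≫ f).hom := hx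
      rw [← he] at hy
      exact hy

theorem isFinDim_and_isExtFinDim_of_hCat {n : ℕ} (hn : n ≠ 0)
    (h : IsGenASRegularWithDuality Λ K n) {M : ModuleCat.{u} Λ} (hM : HCat (regular Λ) n M) :
    IsFinDim K (regular Λ) M ∧ IsExtFinDim K (regular Λ) n M := by
  have := h.noetherian_left
  have := h.noetherian_right
  have hd := isDualizing (K := K) h.noetherian_left h.noetherian_right h.semiperfect.1 h.finite_simple
  have := finite_of_hCat hM
  revert hM
  refine induction_of_isNoetherianRing (𝒬 := fun M => HCat (regular Λ) n M →
    IsFinDim K (regular Λ) M ∧ IsExtFinDim K (regular Λ) n M) (fun X ih hX => ?_) M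
  obtain ⟨W, T, U, f, g, w, hW, hT, -, hTW, hT', hS, hU⟩ := hd.exists_filtration_step hn h.regular
    (fun N => ⟨extDualOfOpOp n N⟩) (fun M => ⟨_, ⟨extDual n M⟩⟩) hX
  refine isFinDim_and_isExtFinDim_of_shortExact hd.finDim hS hW hT hTW fun hz =>
    ih U g hS.epi_g (fun hg => ?_) (hU hz)
  have hf : f = 0 := by rw [← cancel_mono g, w, zero_comp]
  have := hS.mono_f
  exact Simple.not_isZero T ((IsZero.iff_id_eq_zero T).2 (by
    have : Mono f := hS.mono_f
    rw [← cancel_mono f, hf]; simp))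

theorem isAlmostSplitSetting {n : ℕ} (hn : n ≠ 0) (h : IsGenASRegularWithDuality Λ K n)
    (hks : IsKrullSchmidt (H Λ n)) :
    IsAlmostSplitSetting (oppositeRegular K Λ) n (dual K) (dualTr K n) where
  dualizing := isDualizing h.noetherian_left h.noetherian_right h.semiperfect.1 h.finite_simple
  ne_zero := hn
  pd := hasProjectiveDimensionLT_of_globalDim h.regular.globalDim_eq
  ks := hks
  transpose N := ⟨_, ⟨extDualOfOpOp n N⟩⟩
  dual _ := ⟨dualPairing _⟩
  dualTr _ := ⟨_, ⟨extDual n _⟩, ⟨dualPairingOfOpOp _⟩⟩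
  finDim _ hM := (isFinDim_and_isExtFinDim_of_hCat hn h hM).1
  extFinDim _ hM := (isFinDim_and_isExtFinDim_of_hCat hn h hM).2

theorem IsGenASRegularWithDuality.hasAlmostSplit {n : ℕ} (h : IsGenASRegularWithDuality Λ K n)
    (hks : IsKrullSchmidt (H Λ n)) :
    (n = 1 → HasAlmostSplitSequences (H Λ 1)) ∧
      (1 ≤ n → HasAlmostSplitExts (H Λ n) (H Λᵐᵒᵖ n) (ModuleCat.dual K) (dualTr K n) n) := by
  refine ⟨?_, fun hn => ?_⟩
  · rintro rfl
    exact (isAlmostSplitSetting one_ne_zero h hks).hasAlmostSplitSequences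
  · exact (isAlmostSplitSetting (Nat.one_le_iff_ne_zero.1 hn) h hks).hasAlmostSplitExts fun N hN => hN

end ModuleCat

/-! ### The graded case -/

namespace GrMod

open MulOpposite

section Values

variable {K A : Type u} [Field K] [Ring A] [Algebra K A] {𝒜 : ℤ → Submodule K A}
  [SetLike.GradedMonoid 𝒜] {X : GrMod 𝒜} {i j k d : ℤ}

theorem act_one (h : d + j = j) (e : 𝒜 d) (he : (e : A) = 1) (x : X.obj j) :
    X.act h e x = x := by
  obtain rfl : d = 0 := by omega
  exact X.one_act h e he x

/-- The unit element of the shifted regular module. -/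
def shiftOne (𝒜 : ℤ → Submodule K A) [SetLike.GradedMonoid 𝒜] (h : j + i = 0) :
    (shift 𝒜 i).obj j :=
  (⟨1, by rw [h]; exact SetLike.GradedOne.one_mem⟩ : 𝒜 (j + i))

/-- The value at the unit of a morphism from a shifted regular module. -/
def val (h : j + i = 0) (f : shift 𝒜 i ⟶ X) : X.obj j := f.app j (shiftOne 𝒜 h)

/-- The morphism from a shifted regular module with a given value. -/
def ofVal (h : j + i = 0) (x : X.obj j) : shift 𝒜 i ⟶ X :=
  (⟨fun m => (X.act (show m + i + j = m by omega)).flip x,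
    fun {_ _ _} h' a y => X.mul_act _ _ _ a y _ rfl x⟩ : Hom _ _)

@[simp] theorem val_ofVal (h : j + i = 0) (x : X.obj j) : val h (ofVal h x) = x :=
  act_one _ _ rfl x

theorem app_eq_act (h : j + i = 0) (f : shift 𝒜 i ⟶ X) {m : ℤ} (a : 𝒜 (m + i)) :
    f.app m a = X.act (show m + i + j = m by omega) a (val h f) := by
  rw [val, ← f.comm]
  exact congrArg _ (Subtype.ext (mul_one (a : A)).symm)

@[simp] theorem ofVal_val (h : j + i = 0) (f : shift 𝒜 i ⟶ X) : ofVal h (val h f) = f := by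
  ext m a
  exact (app_eq_act h f a).symm

theorem ofVal_comp (h : j + i = 0) (x : X.obj j) {Y : GrMod 𝒜} (f : X ⟶ Y) :
    ofVal h x ≫ f = ofVal h (f.app j x) := by
  ext m a
  exact f.comm _ _ _

/-- Morphisms from a shifted regular module are given by their values. -/
def valEquiv (h : j + i = 0) (X : GrMod 𝒜) : (shift 𝒜 i ⟶ X) ≃ₗ[K] X.obj j where
  toFun := val h
  invFun := ofVal h
  map_add' _ _ := rfl
  map_smul' _ _ := rfl
  left_inv := ofVal_val h
  right_inv := val_ofVal h

/-- Morphisms between shifted regular modules are right multiplications. -/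
def coeffEquiv (𝒜 : ℤ → Submodule K A) [SetLike.GradedMonoid 𝒜] (h : d + i = j) :
    (shift 𝒜 i ⟶ shift 𝒜 j) ≃ₗ[K] 𝒜 d where
  toFun f := ⟨(show 𝒜 (-i + j) from val (neg_add_cancel i) f : A), by
    obtain rfl : d = -i + j := by omega
    exact Subtype.prop _⟩
  invFun a := rmul 𝒜 h (⟨op a, a.2⟩ : opGrading 𝒜 d)
  map_add' _ _ := rfl
  map_smul' _ _ := rfl
  left_inv f := by
    ext m a
    refine Eq.trans ?_ (app_eq_act (neg_add_cancel i) f a).symm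
    rfl
  right_inv a := Subtype.ext (one_mul (a : A))

theorem val_comp (hi : j + i = 0) {i' j' : ℤ} (hi' : j' + i' = 0) (h : d + j' = j) (h' : d + i = i')
    (a : shift 𝒜 i ⟶ shift 𝒜 i') (x : shift 𝒜 i' ⟶ X) :
    val hi (a ≫ x) = X.act h (coeffEquiv 𝒜 h' a) (val hi' x) := by
  obtain rfl : j = -i := by omega
  obtain rfl : d = -i + i' := by omega
  exact app_eq_act hi' x _

theorem coeffEquiv_comp {i₁ i₂ i₃ d₁ d₂ d₃ : ℤ} (h₁ : d₁ + i₁ = i₂) (h₂ : d₂ + i₂ = i₃)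
    (h₃ : d₃ + i₁ = i₃) (a : shift 𝒜 i₁ ⟶ shift 𝒜 i₂) (b : shift 𝒜 i₂ ⟶ shift 𝒜 i₃) :
    (coeffEquiv 𝒜 h₃ (a ≫ b) : A) = coeffEquiv 𝒜 h₁ a * coeffEquiv 𝒜 h₂ b := by
  have h := val_comp (neg_add_cancel i₁) (neg_add_cancel i₂) (by omega) h₁ a b
  exact congrArg (fun x : 𝒜 (-i₁ + i₃) => (x : A)) h

theorem coeffEquiv_ext (h : d + i = j) {f g : shift 𝒜 i ⟶ shift 𝒜 j}
    (e : (coeffEquiv 𝒜 h f : A) = coeffEquiv 𝒜 h g) : f = g :=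
  (coeffEquiv 𝒜 h).injective (Subtype.ext e)

instance projective_shift (i : ℤ) : Projective (shift 𝒜 i) where
  factors {P Y} f e _ := by
    obtain ⟨x, hx⟩ := app_surjective_of_epi e _ (val (neg_add_cancel i) f)
    exact ⟨ofVal (neg_add_cancel i) x, by rw [ofVal_comp, hx, ofVal_val]⟩

theorem isDenseFamily_shift : IsDenseFamily (shift 𝒜) where
  proj i := projective_shift i
  glue {X Y} c hadd hcomp := by
    -- Elements of degree j are the morphisms from Λ(-j).
    have hn : ∀ j : ℤ, j + -j = 0 := fun j => add_neg_cancel j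
    have hact : ∀ {i j k : ℤ} (h : i + j = k) (a : 𝒜 i) (x : X.obj j),
        ofVal (𝒜 := 𝒜) (hn k) (X.act h a x) =
          (coeffEquiv 𝒜 (show i + -k = -j by omega)).symm a ≫ ofVal (hn j) x := fun {i j k} h a x => by
      apply (valEquiv (𝒜 := 𝒜) (hn k) X).injective
      refine (val_ofVal _ _).trans (Eq.symm ?_)
      refine (val_comp (𝒜 := 𝒜) (hn k) (hn j) h (show i + -k = -j by omega)
        ((coeffEquiv 𝒜 _).symm a) (ofVal (hn j) x)).trans ?_
      rw [LinearEquiv.apply_symm_apply, val_ofVal]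
    refine ⟨⟨fun j =>
      { toFun := fun x => val (hn j) (c (-j) (ofVal (hn j) x))
        map_add' := fun x y => ?_
        map_smul' := fun r x => ?_ }, fun {i j k} h a x => ?_⟩, fun i x => ?_⟩
    · have : ofVal (𝒜 := 𝒜) (hn j) (x + y) = ofVal (hn j) x + ofVal (hn j) y :=
        (valEquiv (hn j) X).symm.map_add x y
      rw [this, hadd]
      rfl
    · have : ofVal (𝒜 := 𝒜) (hn j) (r • x) = (r • 𝟙 (shift 𝒜 (-j))) ≫ ofVal (hn j) x := by
        rw [Linear.smul_comp, Category.id_comp]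
        exact (valEquiv (hn j) X).symm.map_smul r x
      rw [this, hcomp, Linear.smul_comp, Category.id_comp]
      rfl
    · change val (hn k) (c (-k) (ofVal (hn k) (X.act h a x))) =
        Y.act h a (val (hn j) (c (-j) (ofVal (hn j) x)))
      rw [hact, hcomp, val_comp (hn k) (hn j) h (by omega), LinearEquiv.apply_symm_apply]
    · obtain ⟨i, rfl⟩ : ∃ j, i = -j := ⟨-i, by omega⟩
      apply (valEquiv (hn i) Y).injective
      change val (hn i) (c (-i) (ofVal (hn i) (val (hn i) x))) = val (hn i) (c (-i) x)
      rw [ofVal_val]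
  sep {X Y} f h := by
    ext j x
    have := congrArg (val (add_neg_cancel j)) (h _ (ofVal (add_neg_cancel j) x))
    rwa [ofVal_comp, val_ofVal] at this

end Values

variable {K Λ : Type u} [Field K] [Ring Λ] [Algebra K Λ] {𝒜 : ℤ → Submodule K Λ}
  [SetLike.GradedMonoid 𝒜]

/-- Elements of the algebra and of the opposite algebra. -/
def opEquiv (𝒜 : ℤ → Submodule K Λ) (d : ℤ) : 𝒜 d ≃ₗ[K] opGrading 𝒜 d where
  toFun a := ⟨op a, a.2⟩
  invFun a := unopₗ 𝒜 d a
  map_add' _ _ := rfl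
  map_smul' _ _ := rfl
  left_inv _ := rfl
  right_inv _ := rfl

variable (𝒜) in
/-- Morphisms between the shifted left regular modules, and between the shifted right regular
modules, are given by homogeneous elements. -/
noncomputable def oppositeShift : OppositeFamilies K (shift 𝒜) (fun i => shift (opGrading 𝒜) (-i)) where
  op i j := (coeffEquiv 𝒜 (show j - i + i = j by omega)).trans
    ((opEquiv 𝒜 (j - i)).trans (coeffEquiv (opGrading 𝒜) (show j - i + -j = -i by omega)).symm)
  op_comp {i j k} a b := by
    refine coeffEquiv_ext (show k - i + -k = -i by omega) ?_
    rw [coeffEquiv_comp (show k - j + -k = -j by omega) (show j - i + -j = -i by omega)]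
    simp only [LinearEquiv.trans_apply, LinearEquiv.apply_symm_apply]
    change op (coeffEquiv 𝒜 _ (a ≫ b) : Λ) = op (coeffEquiv 𝒜 _ b : Λ) * op (coeffEquiv 𝒜 _ a : Λ)
    rw [coeffEquiv_comp (show j - i + i = j by omega) (show k - j + j = k by omega), op_mul]

theorem coeffEquiv_oppositeShift {i j : ℤ} (a : shift 𝒜 i ⟶ shift 𝒜 j) :
    coeffEquiv (opGrading 𝒜) (show j - i + -j = -i by omega) ((oppositeShift 𝒜).op i j a) =
      opEquiv 𝒜 _ (coeffEquiv 𝒜 (show j - i + i = j by omega) a) :=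
  LinearEquiv.apply_symm_apply _ _

theorem coeffEquiv_oppositeShift_symm {i j : ℤ}
    (a : shift (opGrading 𝒜) (-i) ⟶ shift (opGrading 𝒜) (-j)) :
    coeffEquiv 𝒜 (show i - j + j = i by omega) ((oppositeShift 𝒜).symm.op i j a) =
      unopₗ 𝒜 _ (coeffEquiv (opGrading 𝒜) (show i - j + -i = -j by omega) a) :=
  LinearEquiv.apply_symm_apply _ _

/-- The dual of a graded right module is a dual. -/
noncomputable def dualPairingOfOpOp (N : GrMod (opGrading 𝒜)) :
    DualPairing (oppositeShift 𝒜) (ofOpOp (dual N)) N where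
  w i := (valEquiv (neg_add_cancel i) _).trans (valEquiv (neg_add_cancel (-i)) N).dualMap
  nat {i j} a x y := by
    have h1 := val_comp (neg_add_cancel i) (neg_add_cancel j) (show j - i + -j = -i by omega)
      (by omega) a x
    have h2 := val_comp (neg_add_cancel (-j)) (neg_add_cancel (-i))
      (show j - i + -(-i) = -(-j) by omega) (by omega) ((oppositeShift 𝒜).op i j a) y
    refine (LinearMap.congr_fun h1 (val (neg_add_cancel (-i)) y)).trans ?_
    change _ = DFunLike.coe (F := N.obj (-(-j)) →ₗ[K] K) (val (neg_add_cancel j) x)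
      (val (neg_add_cancel (-j)) ((oppositeShift 𝒜).op i j a ≫ y))
    rw [h2, coeffEquiv_oppositeShift]
    rfl

/-- The dual of a graded left module is a dual. -/
noncomputable def dualPairing (M : GrMod 𝒜) : DualPairing (oppositeShift 𝒜).symm (dual M) M where
  w i := (valEquiv (neg_add_cancel (-i)) _).trans
    (valEquiv (show -(-(-i)) + i = 0 by omega) M).dualMap
  nat {i j} a x y := by
    have h1 := val_comp (neg_add_cancel (-i)) (neg_add_cancel (-j))
      (show i - j + -(-j) = -(-i) by omega) (by omega) a x
    have h2 := val_comp (show -(-(-j)) + j = 0 by omega) (show -(-(-i)) + i = 0 by omega)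
      (show i - j + -(-(-i)) = -(-(-j)) by omega) (by omega) ((oppositeShift 𝒜).symm.op i j a) y
    refine (LinearMap.congr_fun h1 (val (show -(-(-i)) + i = 0 by omega) y)).trans ?_
    change _ = DFunLike.coe (F := M.obj (-(-(-j))) →ₗ[K] K) (val (neg_add_cancel (-j)) x)
      (val (show -(-(-j)) + j = 0 by omega) ((oppositeShift 𝒜).symm.op i j a ≫ y))
    rw [h2, coeffEquiv_oppositeShift_symm]
    rfl

/-- `tr^k N` represents the extensions of the right module `N` by the regular modules. -/
noncomputable def extDualOfOpOp (k : ℕ) (N : GrMod (opGrading 𝒜)) :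
    ExtDual (oppositeShift 𝒜) k (ofOpOp (tr k N)) N where
  u i := valEquiv (neg_add_cancel i) (ofOpOp (tr k N))
  nat {i j} a x := val_comp (neg_add_cancel i) (neg_add_cancel j) (show j - i + -j = -i by omega)
    (by omega) a x

/-- `tr^k M` represents the extensions of the left module `M` by the regular modules. -/
noncomputable def extDual (k : ℕ) (M : GrMod 𝒜) :
    ExtDual (oppositeShift 𝒜).symm k (tr k M) M where
  u i := valEquiv (add_neg_cancel i) (tr k M)
  nat {i j} a x := val_comp (add_neg_cancel i) (add_neg_cancel j) (show i - j + j = i by omega)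
    (by omega) a x

end GrMod

/-- Needed because the partner of Λ(i) on the right is the module shifted by -i. -/
theorem IsDenseFamily.reindex {C : Type*} [Category C] [Abelian C] {ι ι' : Type} {R : ι → C}
    (h : IsDenseFamily R) (e : ι' ≃ ι) : IsDenseFamily (fun i => R (e i)) where
  proj i := h.proj (e i)
  glue {X Y} c hadd hcomp := by
    let c' : ∀ i, (R i ⟶ X) → (R i ⟶ Y) :=
      e.piCongrLeft (fun i => (R i ⟶ X) → (R i ⟶ Y)) c
    have hc : ∀ i, c' (e i) = c i := fun i => e.piCongrLeft_apply_apply (fun i => (R i ⟶ X) → (R i ⟶ Y)) c i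
    obtain ⟨f, hf⟩ := h.glue c' (e.surjective.forall.2 fun i x y => by rw [hc, hadd])
      (e.surjective.forall.2 fun i => e.surjective.forall.2 fun j a x => by rw [hc, hc, hcomp])
    exact ⟨f, fun i x => by rw [hf, hc]⟩
  sep f hf := h.sep f (e.surjective.forall.2 hf)

/-! ### Graded free modules and finiteness conditions -/

namespace GrMod

section Free

variable {K A : Type u} [Field K] [Ring A] [Algebra K A] {𝒜 : ℤ → Submodule K A}
  [SetLike.GradedMonoid 𝒜] {X Y : GrMod 𝒜}

theorem sum_app {σ : Type*} (s : Finset σ) (f : σ → (X ⟶ Y)) (j : ℤ) (x : X.obj j) :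
    (∑ k ∈ s, f k).app j x = ∑ k ∈ s, (f k).app j x := by
  let φ : (X ⟶ Y) →+ Y.obj j :=
    { toFun := fun f => f.app j x
      map_zero' := rfl
      map_add' := fun _ _ => rfl }
  exact map_sum φ f s

theorem mono_of_injective (f : X ⟶ Y) (h : ∀ j, Function.Injective (f.app j)) : Mono f :=
  ⟨fun g g' hg => by
    ext j x
    exact h j (congrArg (fun q => q.app j x) hg)⟩

open Classical in
/-- The inclusion of a summand of a free module. -/
noncomputable def freeIncl {T : Type u} (d : T → ℤ) (t : T) : shift 𝒜 (-d t) ⟶ free 𝒜 d :=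
  (⟨fun m => (DFinsupp.lsingle (R := K) (M := fun t => 𝒜 (m - d t)) t :
      𝒜 (m - d t) →ₗ[K] Π₀ t, 𝒜 (m - d t)), fun {i j k} h a x => by
    exact (DFinsupp.mapRange_single (f := fun t => mulₗ 𝒜 (show i + (j - d t) = k - d t by omega) a)
      (hf := by intro; simp)).symm⟩ : Hom _ _)

/-- The projection to a summand of a free module. -/
noncomputable def freeProj {T : Type u} (d : T → ℤ) (t : T) : free 𝒜 d ⟶ shift 𝒜 (-d t) :=
  (⟨fun m => (DFinsupp.lapply t : (Π₀ t, 𝒜 (m - d t)) →ₗ[K] 𝒜 (m - d t)), fun {i j k} h a x => by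
    exact DFinsupp.mapRange_apply (fun t => mulₗ 𝒜 (show i + (j - d t) = k - d t by omega) a)
      (by intro; simp) _ t⟩ : Hom _ _)

theorem sum_freeProj_comp_freeIncl {T : Type u} (d : T → ℤ) {m : ℕ} {S : Finset T}
    (e : Fin m ≃ S) (j : ℤ) (x : Π₀ t, 𝒜 (j - d t)) (hx : ∀ t ∉ S, x t = 0) :
    Hom.app (∑ k, freeProj d (e k : T) ≫ freeIncl d (e k : T) : free 𝒜 d ⟶ free 𝒜 d) j x = x := by
  classical
  refine (sum_app Finset.univ _ j _).trans ?_
  change ∑ k, (DFinsupp.single (e k : T) (x (e k : T)) : Π₀ t, 𝒜 (j - d t)) = x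
  rw [e.sum_comp (fun s : S => (DFinsupp.single (s : T) (x (s : T)) : Π₀ t, 𝒜 (j - d t))),
    Finset.sum_coe_sort S (fun s => (DFinsupp.single s (x s) : Π₀ t, 𝒜 (j - d t)))]
  ext1 t
  rw [DFinsupp.finsetSum_apply]
  by_cases ht : t ∈ S
  · rw [Finset.sum_eq_single t (fun s _ hs => DFinsupp.single_eq_of_ne hs.symm) (fun h => (h ht).elim)]
    exact DFinsupp.single_eq_same
  · rw [hx t ht]
    refine Finset.sum_eq_zero fun s hs => DFinsupp.single_eq_of_ne ?_
    rintro rfl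
    exact ht hs

theorem hasFreeCovers_shift : HasFreeCovers (shift 𝒜) := fun X => by
  classical
  refine ⟨_, _, freeLift_epi X, inferInstance, fun m t g => ?_⟩
  let d : (Σ j, X.obj j) → ℤ := fun t => t.1
  let v : ∀ s, Π₀ r, 𝒜 (-(t s) - d r) := fun s => val (neg_add_cancel (t s)) (g s)
  let S : Finset (Σ j, X.obj j) := Finset.univ.biUnion fun s => (v s).support
  refine ⟨S.card, fun k => -d (S.equivFin.symm k), fun k => freeProj d _,
    fun k => freeIncl d _, fun s => ?_⟩
  apply (valEquiv (neg_add_cancel (t s)) _).injective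
  refine sum_freeProj_comp_freeIncl d S.equivFin.symm _ (v s) fun r hr => ?_
  by_contra h
  exact hr (Finset.mem_biUnion.2 ⟨s, Finset.mem_univ s, DFinsupp.mem_support_iff.2 h⟩)

-- Finitely many homogeneous elements which detect zero morphisms out of `X` define an epimorphism
-- from a finite sum of shifts.
attribute [local instance] Abelian.hasFiniteBiproducts in
theorem isFinGen_of_forall {T : Type} [Finite T] (d : T → ℤ) (g : ∀ t, X.obj (d t))
    (h : ∀ (Y : GrMod 𝒜) (q : X ⟶ Y), (∀ t, q.app (d t) (g t) = 0) → q = 0) :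
    IsFinGen (shift 𝒜) X := by
  obtain ⟨m, ⟨e⟩⟩ := Finite.exists_equiv_fin T
  refine ⟨m, fun s => -d (e.symm s),
    biproduct.desc fun s => ofVal (add_neg_cancel (d (e.symm s))) (g (e.symm s)), ?_⟩
  refine Preadditive.epi_of_cancel_zero _ fun {Y} q hq => h Y q (e.symm.surjective.forall.2 fun s => ?_)
  have h1 := congrArg (fun f => biproduct.ι (fun s => shift 𝒜 (-d (e.symm s))) s ≫ f) hq
  dsimp only at h1
  rw [← Category.assoc, biproduct.ι_desc, ofVal_comp, comp_zero] at h1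
  rw [← val_ofVal (add_neg_cancel _) (q.app _ (g (e.symm s))), h1]
  rfl

/-- The conditions on an algebra in the graded case. -/
structure IsPositivelyFinite (𝒜 : ℤ → Submodule K A) : Prop where
  eq_zero : ∀ i < 0, ∀ a : 𝒜 i, a = 0
  finite : ∀ i, Module.Finite K (𝒜 i)
  gens : ∃ (m : ℕ) (d : Fin m → ℤ) (a : ∀ k, 𝒜 (d k)), (∀ k, 0 < d k) ∧
    ∀ e > 0, ∀ x : 𝒜 e, ∃ c : ∀ k, 𝒜 (e - d k), (x : A) = ∑ k, (c k : A) * a k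

/-- Locally finite graded modules which are bounded below. -/
structure IsBoundedFinite (X : GrMod 𝒜) : Prop where
  finite : ∀ j, Module.Finite K (X.obj j)
  bounded : ∃ b, ∀ j < b, ∀ x : X.obj j, x = 0

theorem IsBoundedFinite.of_mono {f : X ⟶ Y} (hf : Mono f) (h : IsBoundedFinite Y) :
    IsBoundedFinite X := by
  have hi := app_injective_of_mono f
  obtain ⟨h1, b, hb⟩ := h
  exact ⟨fun j => Module.Finite.of_injective (f.app j) (hi j),
    b, fun j hj x => hi j (by rw [hb j hj (f.app j x), map_zero])⟩

theorem IsPositivelyFinite.isBoundedFinite_of_isFGProj (h𝒜 : IsPositivelyFinite 𝒜)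
    (hX : IsFGProj (shift 𝒜) X) : IsBoundedFinite X := by
  have := h𝒜.finite
  obtain ⟨m, t, e, p, hep⟩ := hX
  have hx : ∀ (j : ℤ) (x : X.obj j), x = ∑ s, (p s).app j ((e s).app j x) := fun j x => by
    conv_lhs => rw [show x = Hom.app (𝟙 X) j x from rfl, ← hep, sum_app]
    rfl
  refine ⟨fun j => ?_, ?_⟩
  · have hfin : ∀ s, Module.Finite K ((shift 𝒜 (t s)).obj j) := fun s => h𝒜.finite (j + t s)
    refine Module.Finite.of_injective (LinearMap.pi fun s => (e s).app j) ?_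
    refine (injective_iff_map_eq_zero _).2 fun x h0 => ?_
    rw [hx j x]
    refine Finset.sum_eq_zero fun s _ => ?_
    rw [show (e s).app j x = 0 from congrFun h0 s, map_zero]
  · obtain ⟨b, hb⟩ := (Set.finite_range t).bddAbove
    refine ⟨-b, fun j hj x => ?_⟩
    rw [hx j x]
    refine Finset.sum_eq_zero fun s _ => ?_
    have h1 := hb (Set.mem_range_self s)
    have h2 : (e s).app j x = 0 := h𝒜.eq_zero (j + t s) (by omega) _
    rw [h2, map_zero]

end Free

end GrMod

/-! ### Tops and simple objects for positively graded algebras -/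

namespace GrMod

section Tops

variable {K A : Type u} [Field K] [Ring A] [Algebra K A] {𝒜 : ℤ → Submodule K A}
  [SetLike.GradedMonoid 𝒜] {X Y : GrMod 𝒜}

/-- The elements which are sums of multiples by elements of positive degree. -/
def rad (X : GrMod 𝒜) (j : ℤ) : Submodule K (X.obj j) :=
  Submodule.span K {x | ∃ (d i : ℤ) (h : d + i = j) (a : 𝒜 d) (y : X.obj i), 0 < d ∧
    X.act h a y = x}

theorem act_mem_rad {d i j : ℤ} (h : d + i = j) (hd : 0 < d) (a : 𝒜 d) (y : X.obj i) :
    X.act h a y ∈ rad X j :=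
  Submodule.subset_span ⟨d, i, h, a, y, hd, rfl⟩

theorem IsPositivelyFinite.rad_le (h𝒜 : IsPositivelyFinite 𝒜) {i j k : ℤ} (h : i + j = k)
    (a : 𝒜 i) : rad X j ≤ (rad X k).comap (X.act h a) := by
  refine Submodule.span_le.2 ?_
  rintro _ ⟨d, l, h', b, y, hd, rfl⟩
  change X.act h a (X.act h' b y) ∈ rad X k
  by_cases hi : i < 0
  · rw [h𝒜.eq_zero i hi a, map_zero, LinearMap.zero_apply]
    exact zero_mem _
  · rw [← X.mul_act h' h (show i + d + l = k by omega) a b (mulₗ 𝒜 rfl a b) rfl y]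
    exact act_mem_rad _ (by omega) _ _

/-- The quotient by the multiples by elements of positive degree. -/
def top (h𝒜 : IsPositivelyFinite 𝒜) (X : GrMod 𝒜) : GrMod 𝒜 where
  obj j := X.obj j ⧸ rad X j
  act {i j k} h := LinearMap.mk₂ K
    (fun a => Submodule.mapQ (rad X j) (rad X k) (X.act h a) (h𝒜.rad_le h a))
    (by intro a b x; induction x using Submodule.Quotient.induction_on; simp)
    (by intro a b x; induction x using Submodule.Quotient.induction_on; simp)
    (by intros; simp) (by intros; simp)
  one_act h e he x := by
    induction x using Submodule.Quotient.induction_on with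
    | H x => exact congrArg _ (X.one_act h e he x)
  mul_act h h' h'' a b c hc x := by
    induction x using Submodule.Quotient.induction_on with
    | H x => exact congrArg _ (X.mul_act h h' h'' a b c hc x)

/-- The projection to the top. -/
def topπ (h𝒜 : IsPositivelyFinite 𝒜) (X : GrMod 𝒜) : X ⟶ top h𝒜 X :=
  (⟨fun j => (rad X j).mkQ, fun _ _ _ => rfl⟩ : Hom _ _)

theorem epi_topπ (h𝒜 : IsPositivelyFinite 𝒜) (X : GrMod 𝒜) : Epi (topπ h𝒜 X) :=
  epi_of_surjective _ fun j => (rad X j).mkQ_surjective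

/-- Graded Nakayama: an endomorphism over the top is onto by induction on the degree, starting below
the bound, and then bijective since each component is finite dimensional. -/
theorem isTopQuotient_topπ (h𝒜 : IsPositivelyFinite 𝒜) (hX : IsBoundedFinite X) :
    IsTopQuotient (topπ h𝒜 X) where
  epi := epi_topπ h𝒜 X
  isIso e he := by
    obtain ⟨h1, b, hb⟩ := hX
    have hs : ∀ (n : ℕ) (j : ℤ), j < b + n → Function.Surjective (e.app j) := by
      intro n
      induction n with
      | zero => exact fun j hj x => ⟨0, by rw [hb j (by simpa using hj) x, map_zero]⟩
      | succ n ih =>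
        intro j hj x
        have h2 : e.app j x - x ∈ rad X j := by
          rw [← Submodule.Quotient.mk_eq_zero, Submodule.Quotient.mk_sub, sub_eq_zero]
          exact congrArg (fun q => Hom.app q j x) he
        have h3 : rad X j ≤ LinearMap.range (e.app j) := by
          refine Submodule.span_le.2 ?_
          rintro _ ⟨d, i, h, a, y, hd, rfl⟩
          obtain ⟨z, rfl⟩ := ih i (by push_cast at hj; omega) y
          exact ⟨X.act h a z, e.comm h a z⟩
        obtain ⟨z, hz⟩ := h3 h2
        exact ⟨x - z, by rw [map_sub, hz, sub_sub_cancel]⟩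
    have hs' : ∀ j, Function.Surjective (e.app j) := fun j =>
      hs (j - b + 1).toNat j (by have := Int.self_le_toNat (j - b + 1); omega)
    have : Epi e := epi_of_surjective e hs'
    have : Mono e := mono_of_injective e fun j => by
      have := h1 j
      exact LinearMap.injective_iff_surjective.2 (hs' j)
    exact isIso_of_mono_of_epi e

theorem isFinDim_shift_of {X : GrMod 𝒜} (h1 : ∀ j, Module.Finite K (X.obj j)) {s : Finset ℤ}
    (hs : ∀ j ∉ s, ∀ x : X.obj j, x = 0) : IsFinDim K (shift 𝒜) X := by
  classical
  refine ⟨fun i => have := h1 (-i); Module.Finite.equiv (valEquiv (neg_add_cancel i) X).symm,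
    s.image Neg.neg, fun i hi x => (valEquiv (neg_add_cancel i) X).injective ?_⟩
  rw [map_zero]
  exact hs _ (fun h => hi (Finset.mem_image.2 ⟨-i, h, neg_neg i⟩)) _

/-- Only the degrees of the generators survive: elsewhere a coefficient has negative degree and is
zero, or positive degree and lies in the radical. -/
theorem IsPositivelyFinite.isFinDim_top (h𝒜 : IsPositivelyFinite 𝒜)
    (hX : IsFGProj (shift 𝒜) X) : IsFinDim K (shift 𝒜) (top h𝒜 X) := by
  classical
  have h1 := (h𝒜.isBoundedFinite_of_isFGProj hX).finite
  obtain ⟨m, t, e, p, hep⟩ := hX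
  refine isFinDim_shift_of (s := Finset.univ.image fun s => -t s) (fun j =>
    have := h1 j; inferInstanceAs (Module.Finite K (X.obj j ⧸ rad X j))) fun j hj x => ?_
  obtain ⟨x, rfl⟩ := Submodule.Quotient.mk_surjective _ x
  refine (Submodule.Quotient.mk_eq_zero _).2 ?_
  have hx : x = ∑ s, (p s).app j ((e s).app j x) := by
    conv_lhs => rw [show x = Hom.app (𝟙 X) j x from rfl, ← hep, sum_app]
    rfl
  rw [hx]
  refine Submodule.sum_mem _ fun s _ => ?_
  have h3 : j ≠ -t s := fun h => hj (Finset.mem_image.2 ⟨s, Finset.mem_univ s, h.symm⟩)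
  rcases lt_or_gt_of_ne (show j + t s ≠ 0 by omega) with h | h
  · rw [show (e s).app j x = 0 from h𝒜.eq_zero (j + t s) h _, map_zero]
    exact zero_mem _
  · rw [show (p s).app j ((e s).app j x) = _ from
      app_eq_act (neg_add_cancel (t s)) (p s) (m := j) ((e s).app j x)]
    exact act_mem_rad _ h _ _

theorem IsPositivelyFinite.isBoundedFinite_free (h𝒜 : IsPositivelyFinite 𝒜) {T : Type u}
    (d : T → ℤ) {b : ℤ} (hb : ∀ t, b ≤ d t) (hd : ∀ j, {t | d t ≤ j}.Finite) :
    IsBoundedFinite (free 𝒜 d) := by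
  have h0 : ∀ (j : ℤ) (x : Π₀ t, 𝒜 (j - d t)) (t : T), j < d t → x t = 0 := fun j x t h =>
    h𝒜.eq_zero _ (by omega) _
  have := h𝒜.finite
  refine ⟨fun j => ?_, b, fun j hj (x : Π₀ t, 𝒜 (j - d t)) => ?_⟩
  · have := (hd j).to_subtype
    let φ : (Π₀ t, 𝒜 (j - d t)) →ₗ[K] ((t : {t | d t ≤ j}) → 𝒜 (j - d t)) :=
      LinearMap.pi fun t => DFinsupp.lapply (t : T)
    have hφ : Function.Injective φ := fun x y hxy => by
      ext1 t
      by_cases ht : d t ≤ j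
      · exact congrFun hxy ⟨t, ht⟩
      · rw [h0 j x t (by omega), h0 j y t (by omega)]
    exact Module.Finite.of_injective φ hφ
  · refine DFinsupp.ext fun t => h0 j x t ?_
    have := hb t
    omega

/-- Choose generators from bases of all components. Boundedness below leaves finitely many of degree
at most any j, so the free module stays locally finite. -/
theorem IsPositivelyFinite.exists_shortExact (h𝒜 : IsPositivelyFinite 𝒜) (hX : IsBoundedFinite X) :
    ∃ S : ShortComplex (GrMod 𝒜), S.ShortExact ∧ S.X₃ = X ∧ Projective S.X₂ ∧
      IsBoundedFinite S.X₁ := by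
  obtain ⟨h1, b, hb⟩ := hX
  let T := ULift.{u} (Σ j, Fin (Module.finrank K (X.obj j)))
  let d : T → ℤ := fun t => t.down.1
  let g : ∀ t : T, X.obj (d t) := fun t => Module.finBasis K (X.obj t.down.1) t.down.2
  have hd : ∀ t : T, b ≤ d t := fun t => by
    by_contra! h
    have h2 : Module.finrank K (X.obj t.down.1) = 0 := by
      have : Subsingleton (X.obj t.down.1) := subsingleton_of_forall_eq 0 (hb _ h)
      exact Module.finrank_zero_of_subsingleton
    exact (Fin.cast h2 t.down.2).elim0
  have hfin : ∀ j, {t | d t ≤ j}.Finite := fun j => by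
    have h3 : (Equiv.ulift.symm '' (⋃ i ∈ Set.Icc b j, Sigma.mk i '' Set.univ) : Set T).Finite := by
      refine Set.Finite.image _ (Set.Finite.biUnion (Set.finite_Icc b j) fun i _ => ?_)
      exact Set.Finite.image _ Set.finite_univ
    refine h3.subset fun t ht => ⟨t.down, ?_, rfl⟩
    exact Set.mem_biUnion (show t.down.1 ∈ Set.Icc b j from ⟨hd t, ht⟩) ⟨t.down.2, trivial, rfl⟩
  let p : free 𝒜 d ⟶ X := freeLift d g
  have hp : Epi p := epi_of_surjective p fun j => by
    rw [← LinearMap.range_eq_top, eq_top_iff, ← (Module.finBasis K (X.obj j)).span_eq,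
      Submodule.span_le]
    rintro _ ⟨s, rfl⟩
    exact ⟨freeGen d ⟨⟨j, s⟩⟩, freeLift_gen d g ⟨⟨j, s⟩⟩⟩
  refine ⟨ShortComplex.mk (kernel.ι p) p (kernel.condition p),
    { exact := ShortComplex.exact_kernel p }, rfl, inferInstanceAs (Projective (free 𝒜 d)), ?_⟩
  exact (h𝒜.isBoundedFinite_free d hd hfin).of_mono (f := kernel.ι p) inferInstance

theorem IsPositivelyFinite.isClassWithTops (h𝒜 : IsPositivelyFinite 𝒜) :
    IsClassWithTops (IsBoundedFinite (𝒜 := 𝒜)) (fun T => ∀ j, Module.Finite K (T.obj j)) where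
  step _ hQ := h𝒜.exists_shortExact hQ
  top Q hQ := ⟨top h𝒜 Q, topπ h𝒜 Q, isTopQuotient_topπ h𝒜 hQ, fun j =>
    have := hQ.finite j
    inferInstanceAs (Module.Finite K (Q.obj j ⧸ rad Q j))⟩

theorem exists_ne_zero (X : GrMod 𝒜) (h : ¬ IsZero X) : ∃ (w : ℤ) (x : X.obj w), x ≠ 0 := by
  by_contra! h0
  exact h ((IsZero.iff_id_eq_zero X).2 (by ext j x; exact h0 j _))

theorem surjective_app_ofVal [Simple X] {w : ℤ} {x : X.obj w} (hx : x ≠ 0) (j : ℤ) :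
    Function.Surjective ((ofVal (add_neg_cancel w) x).app j) := by
  have h0 : ofVal (add_neg_cancel w) x ≠ 0 := fun h => hx (by
    rw [← val_ofVal (add_neg_cancel w) x, h]
    rfl)
  have := epi_of_nonzero_to_simple h0
  exact app_surjective_of_epi _ j

/-- A simple graded module lives in a single degree. -/
theorem IsPositivelyFinite.exists_degree (h𝒜 : IsPositivelyFinite 𝒜) (X : GrMod 𝒜) [Simple X] :
    ∃ (w : ℤ) (x : X.obj w), x ≠ 0 ∧ ∀ j ≠ w, ∀ y : X.obj j, y = 0 := by
  obtain ⟨w, x, hx⟩ := exists_ne_zero X (Simple.not_isZero X)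
  -- A nonzero element generates a simple module, and multiplication cannot lower degrees.
  have hlt : ∀ {i j : ℤ} {y : X.obj i}, y ≠ 0 → j < i → ∀ z : X.obj j, z = 0 := by
    intro i j y hy hj z
    obtain ⟨a, rfl⟩ := surjective_app_ofVal hy j z
    rw [show a = 0 from h𝒜.eq_zero (j + -i) (by omega) _, map_zero]
  refine ⟨w, x, hx, fun j hj y => ?_⟩
  rcases lt_or_gt_of_ne hj with h | h
  · exact hlt hx h y
  · by_contra hy
    exact hx (hlt hy h x)

theorem IsPositivelyFinite.isFinDim_of_simple (h𝒜 : IsPositivelyFinite 𝒜) (X : GrMod 𝒜) [Simple X] :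
    IsFinDim K (shift 𝒜) X := by
  obtain ⟨w, x, hx, h0⟩ := h𝒜.exists_degree X
  refine isFinDim_shift_of (s := {w}) (fun j => ?_) fun j hj => h0 j (by simpa using hj)
  have := h𝒜.finite (j + -w)
  have : Module.Finite K ((shift 𝒜 (-w)).obj j) := this
  exact Module.Finite.of_surjective _ (surjective_app_ofVal hx j)

/-- The kernel of Λ(-w) → X is generated by its finite dimensional part in degree w and the
generators of Λ_{≥1}; the latter lie in the kernel because X is concentrated in degree w. -/
theorem IsPositivelyFinite.exists_shortExact_of_simple (h𝒜 : IsPositivelyFinite 𝒜) (X : GrMod 𝒜)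
    [Simple X] : ∃ (S : ShortComplex (GrMod 𝒜)) (w : ℤ), S.ShortExact ∧ S.X₃ = X ∧
      S.X₂ = shift 𝒜 (-w) ∧ IsFinGen (shift 𝒜) S.X₁ := by
  obtain ⟨w, x, hx, h0⟩ := h𝒜.exists_degree X
  let p : shift 𝒜 (-w) ⟶ X := ofVal (add_neg_cancel w) x
  have hp : Epi p := epi_of_surjective p (surjective_app_ofVal hx)
  let S := ShortComplex.mk (kerι p) p (kerι_comp p)
  have hm : Mono S.f := mono_of_injective _ fun j => Subtype.val_injective
  refine ⟨S, w, { exact := S.exact_of_f_is_kernel (kerIsLimit p) }, rfl, rfl, ?_⟩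
  obtain ⟨m, d, a, hd, ha⟩ := h𝒜.gens
  have := h𝒜.finite (w + -w)
  have : Module.Finite K ((shift 𝒜 (-w)).obj w) := this
  let B := Module.finBasis K (LinearMap.ker (p.app w))
  let a' : ∀ k, (ker p).obj (w + d k) := fun k =>
    ⟨(⟨a k, by
      have : w + d k + -w = d k := by omega
      rw [this]
      exact (a k).2⟩ : 𝒜 (w + d k + -w)), h0 _ (by have := hd k; omega) _⟩
  refine isFinGen_of_forall (X := ker p)
    (T := Fin (Module.finrank K (LinearMap.ker (p.app w))) ⊕ Fin m)
    (Sum.elim (fun _ => w) (fun k => w + d k))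
    (fun t => match t with
      | Sum.inl s => B s
      | Sum.inr k => a' k) fun Y q hq => ?_
  ext j y
  change q.app j y = 0
  rcases lt_trichotomy j w with hj | rfl | hj
  · have : y = 0 := Subtype.ext (h𝒜.eq_zero (j + -w) (by omega) y.1)
    rw [this, map_zero]
  · have : q.app j = 0 := B.ext fun s => hq (Sum.inl s)
    rw [this]
    rfl
  · obtain ⟨c, hc⟩ := ha (j + -w) (by omega) y.1
    have hy : y = ∑ k, (ker p).act (show j + -w - d k + (w + d k) = j by omega) (c k) (a' k) := by
      let ψ : (ker p).obj j →ₗ[K] A := (𝒜 (j + -w)).subtype ∘ₗ (LinearMap.ker (p.app j)).subtype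
      have hψ : Function.Injective ψ := Subtype.val_injective.comp Subtype.val_injective
      exact hψ (hc.trans (map_sum ψ (fun k => (ker p).act
        (show j + -w - d k + (w + d k) = j by omega) (c k) (a' k)) Finset.univ).symm)
    rw [hy, map_sum]
    refine Finset.sum_eq_zero fun k _ => ?_
    rw [q.comm, show q.app (w + d k) (a' k) = 0 from hq (Sum.inr k), map_zero]

end Tops

end GrMod

/-! ### Verification of the axioms in the graded case -/

namespace GrMod

section Dualizing

variable {K Λ : Type u} [Field K] [Ring Λ] [Algebra K Λ] {𝒜 : ℤ → Submodule K Λ}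

theorem isDualizing [SetLike.GradedMonoid 𝒜] (h : IsPositivelyFinite 𝒜)
    (h' : IsPositivelyFinite (opGrading 𝒜)) : IsDualizing (oppositeShift 𝒜) where
  dense := isDenseFamily_shift
  dense' := isDenseFamily_shift.reindex (Equiv.neg ℤ)
  cover := hasFreeCovers_shift
  dual N := ⟨_, ⟨dualPairingOfOpOp N⟩⟩
  dual' M := ⟨_, ⟨dualPairing M⟩⟩
  hom N := ⟨_, ⟨extDualOfOpOp 0 N⟩⟩
  top L hL := ⟨top h L, topπ h L, h.isFinDim_top hL,
    isTopQuotient_topπ h (h.isBoundedFinite_of_isFGProj hL)⟩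
  top' := by
    have hG := h'.isClassWithTops
    refine ⟨_, ⟨hG.step, fun Q hQ => ?_⟩, fun Q hQ => ⟨fun j => ?_, ?_⟩⟩
    · obtain ⟨T, π, hπ, hT⟩ := hG.top Q hQ
      exact ⟨T, π, hπ, _, ⟨(dualPairingOfOpOp T).symm fun i =>
        have := hT i
        Module.Finite.equiv (valEquiv (add_neg_cancel i) T).symm⟩⟩
    · have := hQ.finite j
      exact Module.Finite.equiv (valEquiv (add_neg_cancel j) Q)
    · obtain ⟨s, hs⟩ := hQ.support
      obtain ⟨b, hb⟩ := s.bddBelow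
      refine ⟨b, fun j hj x => (valEquiv (add_neg_cancel j) Q).symm.injective ?_⟩
      rw [map_zero]
      exact hs j (fun hjs => absurd (hb hjs) (not_le.2 hj)) _
  finDim S _ := h.isFinDim_of_simple S
  fin T _ := by
    obtain ⟨S, w, hS, h3, h2, h1⟩ := h.exists_shortExact_of_simple T
    refine ⟨S, hS, h3, ?_, h1⟩
    rw [h2]
    exact isFGProj_self _
  fin' T _ := by
    obtain ⟨S, w, hS, h3, h2, h1⟩ := h'.exists_shortExact_of_simple T
    refine ⟨S, hS, h3, ?_, (isFinGen_reindex (Equiv.neg ℤ) _).2 h1⟩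
    rw [h2]
    exact isFGProj_self (R := fun i => shift (opGrading 𝒜) (-i)) w

theorem exists_gens_left [GradedAlgebra 𝒜]
    (h : (Submodule.span Λ (⋃ i > 0, (𝒜 i : Set Λ))).FG) :
    ∃ (m : ℕ) (d : Fin m → ℤ) (a : ∀ k, 𝒜 (d k)), (∀ k, 0 < d k) ∧
      ∀ e > 0, ∀ x : 𝒜 e, ∃ c : ∀ k, 𝒜 (e - d k), (x : Λ) = ∑ k, (c k : Λ) * a k := by
  obtain ⟨s, hs, hspan⟩ := Submodule.fg_span_iff_fg_span_finset_subset _ |>.1 h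
  let f := s.equivFin.symm
  have hd : ∀ k, ∃ d > 0, (f k : Λ) ∈ 𝒜 d := fun k => by
    simpa using hs (f k).2
  choose d hd hmem using hd
  refine ⟨s.card, d, fun k => ⟨f k, hmem k⟩, hd, fun e he x => ?_⟩
  have hx : (x : Λ) ∈ Submodule.span Λ (s : Set Λ) := by
    rw [← hspan]
    exact Submodule.subset_span (Set.mem_biUnion he x.2)
  obtain ⟨c, -, hc⟩ := Submodule.mem_span_finset.1 hx
  -- The generators are homogeneous, so taking degree-`e` components of the relation leaves
  -- homogeneous coefficients of the complementary degrees.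
  refine ⟨fun k => DirectSum.decompose 𝒜 (c (f k)) (e - d k), ?_⟩
  rw [← Finset.sum_coe_sort, ← f.sum_comp] at hc
  calc (x : Λ) = DirectSum.decompose 𝒜 (x : Λ) e := by rw [DirectSum.decompose_coe, DirectSum.of_eq_same]
    _ = ∑ k, (DirectSum.decompose 𝒜 (c (f k) * f k) e : Λ) := by
      rw [← hc, DirectSum.decompose_sum, DFinsupp.finsetSum_apply, AddSubmonoidClass.coe_finsetSum]
      rfl
    _ = _ := Finset.sum_congr rfl fun k _ => by
      rw [← DirectSum.coe_decompose_mul_add_of_right_mem 𝒜 (hmem k), sub_add_cancel]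

theorem exists_gens_right [GradedAlgebra 𝒜]
    (h : (Submodule.span Λᵐᵒᵖ (⋃ i > 0, (𝒜 i : Set Λ))).FG) :
    ∃ (m : ℕ) (d : Fin m → ℤ) (a : ∀ k, opGrading 𝒜 (d k)), (∀ k, 0 < d k) ∧
      ∀ e > 0, ∀ x : opGrading 𝒜 e, ∃ c : ∀ k, opGrading 𝒜 (e - d k),
        (x : Λᵐᵒᵖ) = ∑ k, (c k : Λᵐᵒᵖ) * a k := by
  obtain ⟨s, hs, hspan⟩ := Submodule.fg_span_iff_fg_span_finset_subset _ |>.1 h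
  let f := s.equivFin.symm
  have hd : ∀ k, ∃ d > 0, (f k : Λ) ∈ 𝒜 d := fun k => by
    simpa using hs (f k).2
  choose d hd hmem using hd
  refine ⟨s.card, d, fun k => opEquiv 𝒜 _ ⟨f k, hmem k⟩, hd, fun e he x => ?_⟩
  have hx : (unopₗ 𝒜 e x : Λ) ∈ Submodule.span Λᵐᵒᵖ (s : Set Λ) := by
    rw [← hspan]
    exact Submodule.subset_span (Set.mem_biUnion he (unopₗ 𝒜 e x).2)
  obtain ⟨c, -, hc⟩ := Submodule.mem_span_finset.1 hx
  refine ⟨fun k => opEquiv 𝒜 _ (DirectSum.decompose 𝒜 (c (f k)).unop (e - d k)), ?_⟩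
  rw [← Finset.sum_coe_sort, ← f.sum_comp] at hc
  apply MulOpposite.unop_injective
  rw [Finset.unop_sum]
  calc (unopₗ 𝒜 e x : Λ) = DirectSum.decompose 𝒜 (unopₗ 𝒜 e x : Λ) e := by
        rw [DirectSum.decompose_coe, DirectSum.of_eq_same]
    _ = ∑ k, (DirectSum.decompose 𝒜 (f k * (c (f k)).unop) e : Λ) := by
      rw [← hc, DirectSum.decompose_sum, DFinsupp.finsetSum_apply, AddSubmonoidClass.coe_finsetSum]
      rfl
    _ = ∑ k, (f k : Λ) * DirectSum.decompose 𝒜 (c (f k)).unop (e - d k) :=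
      Finset.sum_congr rfl fun k _ => by
        rw [← DirectSum.coe_decompose_mul_add_of_left_mem 𝒜 (hmem k), add_sub_cancel]
    _ = _ := rfl

variable {n : ℕ}

theorem IsGenASRegularWithDuality.isPositivelyFinite [GradedAlgebra 𝒜]
    (h : IsGenASRegularWithDuality 𝒜 n) : IsPositivelyFinite 𝒜 where
  eq_zero i hi a := Subtype.ext ((Submodule.mem_bot K).1 ((h.positive i hi).le a.2))
  finite := h.finite
  gens := exists_gens_left h.fg_left

theorem IsGenASRegularWithDuality.isPositivelyFinite_opGrading [GradedAlgebra 𝒜]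
    (h : IsGenASRegularWithDuality 𝒜 n) : IsPositivelyFinite (opGrading 𝒜) where
  eq_zero i hi _ :=
    (opEquiv 𝒜 i).symm.injective (h.isPositivelyFinite.eq_zero i hi _)
  finite i := have := h.finite i; Module.Finite.equiv (opEquiv 𝒜 i)
  gens := exists_gens_right h.fg_right

end Dualizing

end GrMod

/-! ### Finiteness and injectivity for top Ext groups -/

theorem HasFPRes.finite_ext {K : Type*} [Field K] {C : Type*} [Category C] [Abelian C] [Linear K C]
    [HasExt.{u} C] {ι : Type} {R : ι → C} (hR : ∀ i, Projective (R i)) {k : ℕ} {M Y : C}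
    (hM : HasFPRes R k M) (hY : ∀ i, Module.Finite K (R i ⟶ Y)) : Module.Finite K (Ext M Y k) := by
  obtain ⟨m, t, α, h⟩ := hM.exists_generators hR
  let φ : (∀ s, R (t s) ⟶ Y) →ₗ[K] Ext M Y k :=
    { toFun := fun x => ∑ s, (α s).push (x s)
      map_add' := fun x y => by simp [Finset.sum_add_distrib]
      map_smul' := fun r x => by simp [Finset.smul_sum] }
  refine Module.Finite.of_surjective φ fun η => ?_
  obtain ⟨x, rfl⟩ := h Y η
  exact ⟨x, rfl⟩

theorem CategoryTheory.ShortComplex.ShortExact.injective_pull {K : Type*} [Field K] {C : Type*}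
    [Category C] [Abelian C] [Linear K C] [HasExt.{u} C] {S : ShortComplex C} (hS : S.ShortExact)
    {Y : C} {m : ℕ} (h : Subsingleton (Ext S.X₁ Y m)) :
    Function.Injective (Ext.pullₗ K Y (m + 1) S.g) :=
  (injective_iff_map_eq_zero _).2 fun β hβ => by
    obtain ⟨γ, rfl⟩ := Ext.contravariant_sequence_exact₃ hS Y β hβ (add_comm 1 m)
    rw [Subsingleton.elim γ 0, Ext.comp_zero]

/-! ### Degree bounds and termination in the graded case -/

namespace GrMod

variable {K Λ : Type u} [Field K] [Ring Λ] [Algebra K Λ] {𝒜 : ℤ → Submodule K Λ}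

section Degrees

variable [SetLike.GradedMonoid 𝒜]

/-- `X` lives in degrees at least `b`. -/
def IsBoundedBelow (X : GrMod 𝒜) (b : ℤ) : Prop := ∀ j < b, ∀ x : X.obj j, x = 0

theorem IsBoundedBelow.of_epi {X Y : GrMod 𝒜} {b : ℤ} (h : IsBoundedBelow X b) (f : X ⟶ Y)
    (hf : Epi f) : IsBoundedBelow Y b := fun j hj y => by
  obtain ⟨x, rfl⟩ := app_surjective_of_epi f j y
  rw [h j hj x, map_zero]

theorem IsBoundedBelow.of_mono {X Y : GrMod 𝒜} {b : ℤ} (h : IsBoundedBelow Y b) (f : X ⟶ Y)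
    (hf : Mono f) : IsBoundedBelow X b := fun j hj x =>
  app_injective_of_mono f j (by rw [h j hj (f.app j x), map_zero])

theorem IsPositivelyFinite.exists_shortExact_of_isBoundedBelow (h𝒜 : IsPositivelyFinite 𝒜)
    {X : GrMod 𝒜} {b : ℤ} (hX : IsBoundedBelow X b) :
    ∃ S : ShortComplex (GrMod 𝒜), S.ShortExact ∧ S.X₃ = X ∧ Projective S.X₂ ∧
      IsBoundedBelow S.X₁ b := by
  let d : {t : Σ j, X.obj j // b ≤ t.1} → ℤ := fun t => t.1.1
  let g : ∀ t, X.obj (d t) := fun t => t.1.2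
  let p : free 𝒜 d ⟶ X := freeLift d g
  have hp : Epi p := epi_of_surjective p fun j x => by
    by_cases hj : b ≤ j
    · exact ⟨freeGen d ⟨⟨j, x⟩, hj⟩, freeLift_gen d g ⟨⟨j, x⟩, hj⟩⟩
    · exact ⟨0, by rw [hX j (not_le.1 hj) x, map_zero]⟩
  have hF : IsBoundedBelow (free 𝒜 d) b := fun j hj (x : Π₀ t, 𝒜 (j - d t)) =>
    DFinsupp.ext fun t => h𝒜.eq_zero _ (by have := t.2; change b ≤ d t at this; omega) _
  exact ⟨ShortComplex.mk (kernel.ι p) p (kernel.condition p),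
    { exact := ShortComplex.exact_kernel p }, rfl, inferInstanceAs (Projective (free 𝒜 d)),
    hF.of_mono (kernel.ι p) inferInstance⟩

/-- A module living in degrees at least b has syzygies with the same bound, and such modules have no
nonzero map to one living below b. -/
theorem IsPositivelyFinite.subsingleton_ext (h𝒜 : IsPositivelyFinite 𝒜) {X W : GrMod 𝒜} {b : ℤ}
    (hX : IsBoundedBelow X b) (hW : ∀ j ≥ b, ∀ x : W.obj j, x = 0) (k : ℕ) :
    Subsingleton (Ext X W k) := by
  have h0 : ∀ {X : GrMod 𝒜}, IsBoundedBelow X b → ∀ f : X ⟶ W, f = 0 := fun hX f => by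
    ext j x
    by_cases hj : b ≤ j
    · exact hW j hj _
    · rw [hX j (not_le.1 hj) x, map_zero, map_zero]
  induction k generalizing X with
  | zero =>
    refine subsingleton_of_forall_eq 0 fun α => ?_
    obtain ⟨f, rfl⟩ := Ext.addEquiv₀.symm.surjective α
    rw [h0 hX f, map_zero]
  | succ k ih =>
    obtain ⟨S, hS, rfl, h2, h1⟩ := h𝒜.exists_shortExact_of_isBoundedBelow hX
    cases k with
    | zero => exact (subsingleton_ext_one_iff hS h2 W).2 fun f => ⟨0, by rw [h0 h1 f, comp_zero]⟩
    | succ k => exact (subsingleton_ext_succ_iff hS h2 W k).2 (ih h1)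

end Degrees

section Termination

variable [GradedAlgebra 𝒜] {n : ℕ}

/-- The measure is the total dimension of Ext^n(M, Λ(c)) for c from c₀ to -b. The bounds pass to the
quotient U, whose groups embed in those of M; the embedding is proper at c = -e, where e is the
degree of W. -/
theorem isFinDim_and_isExtFinDim_of_isBoundedBelow (hn : n ≠ 0)
    (h : IsGenASRegularWithDuality 𝒜 n) {b c₀ : ℤ} {M : GrMod 𝒜} (hM : HCat (shift 𝒜) n M)
    (hb : IsBoundedBelow M b) (hc : ∀ c < c₀, ∀ α : Ext M (shift 𝒜 c) n, α = 0) :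
    IsFinDim K (shift 𝒜) M ∧ IsExtFinDim K (shift 𝒜) n M := by
  have h𝒜 := h.isPositivelyFinite
  have hd := isDualizing h𝒜 h.isPositivelyFinite_opGrading
  have hpd := hasProjectiveDimensionLT_of_globalDim h.regular.globalDim_eq
  induction hN : ∑ c ∈ Finset.Icc c₀ (-b), Module.finrank K (Ext M (shift 𝒜 c) n) using
    Nat.strong_induction_on generalizing M with
  | _ N ih =>
    subst hN
    obtain ⟨W, T, U, f, g, w, hW, hT, hMW, ⟨t, ht⟩, hT', hS, hU⟩ := hd.exists_filtration_step hn
      (h.regular.reindex (Equiv.neg ℤ)) (fun N => ⟨extDualOfOpOp n N⟩)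
      (fun M => ⟨_, ⟨extDual n M⟩⟩) hM
    obtain ⟨e, x, hx, hWe⟩ := h𝒜.exists_degree W
    have hbe : b ≤ e := by
      by_contra! hlt
      exact hMW (h𝒜.subsingleton_ext hb (fun j hj => hWe j (by omega)) n)
    -- The nonzero element `x` of `W` is a nonzero map from Λ(-e), which the trace pairs with
    -- Ext^n(T, Λ(-e)). Lifting `η` to `M` places -e in the window and shows that the dimension
    -- drops there.
    obtain ⟨η, hη⟩ : ∃ η : Ext T (shift 𝒜 (-e)) n, η ≠ 0 := by
      by_contra! h0
      have h1 : ofVal (add_neg_cancel e) x = 0 := ht.eq_zero_of_forall fun η => by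
        rw [h0 η, Ext.zero_push, map_zero]
      refine hx ?_
      rw [← val_ofVal (add_neg_cancel e) x, h1]
      rfl
    obtain ⟨α, hα⟩ := exists_pull_eq hpd hS η
    have hce : c₀ ≤ -e := by
      by_contra! hlt
      exact hη (by rw [← hα, hc _ hlt α, Ext.pull_zero])
    -- The preceding term of the long exact sequence is Ext^{n-1}(T, Λ(c)), which is zero.
    have hinj : ∀ c, Function.Injective (Ext.pullₗ K (shift 𝒜 c) n g) := by
      obtain ⟨m, rfl⟩ := Nat.exists_eq_succ_of_ne_zero hn
      exact fun c => hS.injective_pull (hT'.2.1 m (Nat.succ_ne_self m).symm c)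
    have hfin : ∀ c, Module.Finite K (Ext M (shift 𝒜 c) n) := fun c =>
      (hM.hasFPRes projective_shift).1.finite_ext projective_shift fun i =>
        have := h.finite (c - i)
        Module.Finite.equiv (coeffEquiv 𝒜 (show c - i + i = c by omega)).symm
    refine isFinDim_and_isExtFinDim_of_shortExact hd.finDim hS hW hT ⟨t, ht⟩ fun hz =>
      ih _ (Finset.sum_lt_sum (fun c _ => ?_) ⟨-e, Finset.mem_Icc.2 ⟨hce, by omega⟩, ?_⟩) (hU hz)
        (hb.of_epi g hS.epi_g) (fun c hlt β => ?_) rfl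
    · have := hfin c
      exact LinearMap.finrank_le_finrank_of_injective (hinj c)
    · have := hfin (-e)
      rw [← LinearMap.finrank_range_of_inj (hinj (-e))]
      refine Submodule.finrank_lt fun htop => ?_
      obtain ⟨β, rfl⟩ : α ∈ LinearMap.range (Ext.pullₗ K (shift 𝒜 (-e)) n g) := by
        rw [htop]
        trivial
      refine hη (hα.symm.trans ?_)
      exact (hS.exact_pull (K := K) (shift 𝒜 (-e)) n).apply_apply_eq_zero β
    · exact hinj c ((hc c hlt _).trans (map_zero _).symm)

theorem isFinDim_and_isExtFinDim_of_hCat (hn : n ≠ 0) (h : IsGenASRegularWithDuality 𝒜 n)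
    {M : GrMod 𝒜} (hM : HCat (shift 𝒜) n M) :
    IsFinDim K (shift 𝒜) M ∧ IsExtFinDim K (shift 𝒜) n M := by
  have h𝒜 := h.isPositivelyFinite
  have hres := (hM.hasFPRes projective_shift).1
  obtain ⟨b, hb⟩ : ∃ b, IsBoundedBelow M b := by
    obtain ⟨k, rfl⟩ := Nat.exists_eq_succ_of_ne_zero hn
    obtain ⟨S, hS, rfl, h2, -⟩ := hres
    obtain ⟨b, hb⟩ := (h𝒜.isBoundedFinite_of_isFGProj h2).bounded
    exact ⟨b, IsBoundedBelow.of_epi hb S.g hS.epi_g⟩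
  -- The lower bound c₀ comes from finitely many generating classes in Ext^n(M, Λ(t s)): a map Λ(t
  -- s) → Λ(c) is an element of degree c - t s, so it is zero for c < t s.
  obtain ⟨m, t, α, hα⟩ := hres.exists_generators projective_shift
  obtain ⟨c₀, hc₀⟩ := (Set.finite_range t).bddBelow
  refine isFinDim_and_isExtFinDim_of_isBoundedBelow hn h hM hb (c₀ := c₀) fun c hc β => ?_
  obtain ⟨x, rfl⟩ := hα _ β
  refine Finset.sum_eq_zero fun s _ => ?_
  have h1 := hc₀ (Set.mem_range_self s)
  have h2 : x s = 0 := (coeffEquiv 𝒜 (show c - t s + t s = c by omega)).injective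
    ((h𝒜.eq_zero _ (by omega) _).trans (map_zero _).symm)
  rw [h2, Ext.push_zero]

theorem isAlmostSplitSetting (hn : n ≠ 0) (h : IsGenASRegularWithDuality 𝒜 n)
    (hks : IsKrullSchmidt (H 𝒜 n)) :
    IsAlmostSplitSetting (oppositeShift 𝒜) n dual (dualTr n) where
  dualizing := isDualizing h.isPositivelyFinite h.isPositivelyFinite_opGrading
  ne_zero := hn
  pd := hasProjectiveDimensionLT_of_globalDim h.regular.globalDim_eq
  ks := hks
  transpose N := ⟨_, ⟨extDualOfOpOp n N⟩⟩
  dual _ := ⟨dualPairing _⟩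
  dualTr _ := ⟨_, ⟨extDual n _⟩, ⟨dualPairingOfOpOp _⟩⟩
  finDim _ hM := (isFinDim_and_isExtFinDim_of_hCat hn h hM).1
  extFinDim _ hM := (isFinDim_and_isExtFinDim_of_hCat hn h hM).2

theorem IsGenASRegularWithDuality.hasAlmostSplit (h : IsGenASRegularWithDuality 𝒜 n)
    (hks : IsKrullSchmidt (H 𝒜 n)) :
    (n = 1 → HasAlmostSplitSequences (H 𝒜 1)) ∧
      (1 ≤ n → HasAlmostSplitExts (H 𝒜 n) (H (opGrading 𝒜) n) dual (dualTr n) n) := by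
  refine ⟨?_, fun hn => ?_⟩
  · rintro rfl
    exact (isAlmostSplitSetting one_ne_zero h hks).hasAlmostSplitSequences
  · exact (isAlmostSplitSetting (Nat.one_le_iff_ne_zero.1 hn) h hks).hasAlmostSplitExts
      fun N hN => (hCat_reindex (Equiv.neg ℤ) n N).2 hN

end Termination

end GrMod

theorem mainTheorem9 (K Λ : Type u) [Field K] [Ring Λ] [Algebra K Λ] (n : ℕ) :
    (ModuleCat.IsGenASRegularWithDuality Λ K n → IsKrullSchmidt (ModuleCat.H Λ n) →
      (n = 1 → HasAlmostSplitSequences (ModuleCat.H Λ 1)) ∧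
      (1 ≤ n → HasAlmostSplitExts (ModuleCat.H Λ n) (ModuleCat.H Λᵐᵒᵖ n)
        (ModuleCat.dual K) (ModuleCat.dualTr K n) n)) ∧
    (∀ (𝒜 : ℤ → Submodule K Λ) [GradedAlgebra 𝒜],
      GrMod.IsGenASRegularWithDuality 𝒜 n → IsKrullSchmidt (GrMod.H 𝒜 n) →
      (n = 1 → HasAlmostSplitSequences (GrMod.H 𝒜 1)) ∧
      (1 ≤ n → HasAlmostSplitExts (GrMod.H 𝒜 n) (GrMod.H (opGrading 𝒜) n)
        GrMod.dual (GrMod.dualTr n) n)) :=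
  ⟨fun h hks => h.hasAlmostSplit hks, fun _ _ h hks => h.hasAlmostSplit hks⟩
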